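/- Let $\mathbb K$ be a field of characteristic $0$, let $r\ge 0$, let $p_0,\dots,p_r\in\mathbb K[n]$ with $p_0\neq0$ and $p_r\ne0$, and let $L^*=\sum_{i=0}^r p_i(n)S_n^{-i}$ act on $\mathbb K(n)$, where $(S_n^{-i}R)(n)=R(n-i)$. **Data.** Let $(Q_i)_{i\in I}$ be a (possibly infinite) family of nonconstant square-free polynomials of $\mathbb K[n]$ such that $\gcd(Q_i(n+k),Q_j(n))=1$ for all $i,j\in I$, $k\in\mathbb Z$ unless $i=j$ and $k=0$, and such that every irreducible polynomial divides some $Q_i(n+h)$, $h\in\mathbb Z$. Let $S\subset I$ be a finite set such that $p_0p_r=c\prod_{i\in S}\prod_{h\in H_i}Q_i(n+h)^{e_{i,h}}$ with $c\in\mathbb K\setminus\{0\}$, nonempty finite $H_i\subset\mathbb Z$ and $e_{i,h}\ge1$ (a shiftless decomposition of $p_0p_r$), and such that for $i\in S$ the polynomial $Q_i$ is refined with respect to $p_0$ and to $p_r$: for $P\in\{p_0,p_r\}$ and every $h\in\mathbb Z$ there is $\ell\in\mathbb N$ with $\gcd(P,Q_i(n+h)^{\ell+1})=Q_i(n+h)^\ell$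 up to a constant. For $Q=Q_i$ let $\mathbb K_Q(n)$ be the $\mathbb K$-span of the $n^\ell/Q(n+h)^j$, $h\in\mathbb Z$, $j\ge1$, $0\le\ell<j\deg Q$, and for $P\neq 0$ let $\operatorname{ord}_j(P)$ be the largest $\ell$ with $Q(n-j)^\ell\mid P$. **Weak reduction of poles** $[R]_Q$. While $R$ has a pole at a zero of $Q(n-j)$ for some $j<0$, take the minimal such $j$, let $s$ be the maximal order of these poles, let $\lambda/Q(n-j)^s$ with $\deg\lambda<s\deg Q$ be the part of the partial fraction decomposition of $R$ carrying them, let $e=\operatorname{ord}_j(p_0)$ and $\tilde p_0=(p_0/Q(n-j)^e)\bmod Q(n-j)^s$, let $A$ be the polynomial with $\deg A<s\deg Q$ and $\lambda\equiv A\tilde p_0\pmod{Q(n-j)^s}$, and replace $R$ by $R-L^*\bigl(A(n)/Q(n-j)^{s+e}\bigr)$. Then, while $R$ has a pole at a zero of $Q(n-j)$ for some $j\ge r$, take the maximal such $j$, define $s,\lambda$ in the same way, and $e,A$ in the same way with $p_r$ in place of $p_0$, and replace $R$ by $R-L^*\bigl(A(n+r)/Q(n-j+r)^{s+e}\bigr)$.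 Return $R$. **Weak reduction of polynomials** $[P]_\infty$. Let $\sigma\in\mathbb Z$ and $0\ne p\in\mathbb K[s]$ (the indicial polynomial) be defined by $L^*(n^s)=n^{s+\sigma}(p(s)+O(1/n))$ for all $s\in\mathbb Z$. Start with $a=0$; while $P\neq0$ and $d:=\deg P\ge\sigma$: if $p(d-\sigma)=0$, move the leading term of $P$ from $P$ to $a$; otherwise replace $P$ by $P-\frac{\operatorname{lc}(P)}{p(d-\sigma)}L^*(n^{d-\sigma})$. Return $a+P$. **Bases.** For $i\in S$ and $Q=Q_i$, let $B_{Q_i}$ be an echelon basis, computed by Gaussian elimination with respect to the monomials $n^k$ and $n^\ell/Q(n-j)^s$ ($\ell<\deg Q$), the polar monomials being larger than the polynomial ones, of the span of the finitely many $\bigl[L^*\bigl(n^\ell/Q(n-j)^s\bigr)\bigr]_Q$ with $s\ge1$, $0\le\ell<s\deg Q$ and either $j<0$, $s\le\operatorname{ord}_j(p_0)$, or $j\ge0$, $s\le\operatorname{ord}_{j+r}(p_r)$. Let $B_{\rm pol}$ be an echelon basis (with respect to the degree) of the span of $\bigcup_{i\in S}(B_{Q_i}\cap\mathbb K[n])$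 and of the $[L^*(n^s)]_\infty$ with $s\in\mathbb N$, $p(s)=0$. **Reduction algorithm** $[R]$. Decompose $R=P_\infty+\sum_{i\in I}R_i$ with $P_\infty\in\mathbb K[n]$, $R_i\in\mathbb K_{Q_i}(n)$, almost all zero. Replace each nonzero $R_i$ by $[R_i]_{Q_i}$, and for $i\in S$ reduce the result further by $B_{Q_i}$. Add $P_\infty$, and write the sum as $P+\tilde R$ with $P\in\mathbb K[n]$ and $\tilde R=0$ or $\deg\tilde R<0$. Return $P'+\tilde R$, where $P'$ is the reduction of $[P]_\infty$ by $B_{\rm pol}$. **Theorem.** All the objects above are well defined, the algorithm terminates on every $R\in\mathbb K(n)$, and the map $R\mapsto[R]$ that it computes is a canonical form associated to $L^*$: it is a $\mathbb K$-linear map $\mathbb K(n)\to\mathbb K(n)$ such that $[L^*(R)]=0$ and $R-[R]\in L^*(\mathbb K(n))$ for every $R\in\mathbb K(n)$. -/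

import Mathlib

open Polynomial

noncomputable section

namespace ShiftReduction

/-! ## Partial computations

Algorithms are written as partial functions (`Part`), so that termination of the loops and
solvability of the equations solved on the way are part of what has to be proved. -/

/-- "Compute the object with property `P`": defined exactly when there is a unique one. -/
def theUnique {α : Type*} (P : α → Prop) : Part α :=
  ⟨∃! x, P x, fun h => h.choose⟩

/-- Run all the computations of an indexed family and collect the results. -/
def runAll {ι : Type*} {α : ι → Type*} (f : ∀ i, Part (α i)) : Part (∀ i, α i) :=
  ⟨∀ i, (f i).Dom, fun h i => (f i).get (h i)⟩

/-- The elements of a set, in some order; defined exactly when the set is finite. -/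
def enumerate {α : Type*} (s : Set α) : Part (List α) :=
  ⟨s.Finite, fun h => h.toFinset.toList⟩

variable {K : Type*} [Field K]

/-! ## Shifts and the operator -/

/-- `Q(n - j)` for a polynomial `Q` and an integer `j`. -/
def sh (j : ℤ) (Q : K[X]) : K[X] := taylor (-(j : K)) Q

/-- A polynomial seen as a rational function. -/
abbrev toRat (P : K[X]) : RatFunc K := algebraMap K[X] (RatFunc K) P

/-- The substitution `R(n) ↦ R(n - j)` on rational functions, that is, `S_n^{-j}`. -/
def shiftRat (j : ℤ) : RatFunc K →ₐ[K] RatFunc K :=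
  RatFunc.mapAlgHom (taylorAlgHom (-(j : K)))
    (nonZeroDivisors_le_comap_nonZeroDivisors_of_injective _ (taylor_injective (-(j : K))))

theorem shiftRat_toRat (j : ℤ) (P : K[X]) : shiftRat j (toRat P) = toRat (sh j P) := by
  have h := RatFunc.map_apply_div (taylorAlgHom (-(j : K)))
    (nonZeroDivisors_le_comap_nonZeroDivisors_of_injective _ (taylor_injective (-(j : K)))) P 1
  simpa [shiftRat, sh, RatFunc.coe_mapAlgHom_eq_coe_map] using h

/-- The operator `L* = ∑_{i=0}^r p_i(n) S_n^{-i}` acting on `K(n)`. -/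
def adjointOp (p : ℕ → K[X]) (r : ℕ) : RatFunc K →ₗ[K] RatFunc K :=
  ∑ i ∈ Finset.range (r + 1),
    (LinearMap.mulLeft K (toRat (p i))) ∘ₗ (shiftRat (i : ℤ)).toLinearMap

theorem adjointOp_apply (p : ℕ → K[X]) (r : ℕ) (R : RatFunc K) :
    adjointOp p r R = ∑ i ∈ Finset.range (r + 1), toRat (p i) * shiftRat (i : ℤ) R := by
  simp [adjointOp]

/-- The same operator `L*` acting on `K[n]`. -/
def adjointOpPoly (p : ℕ → K[X]) (r : ℕ) (P : K[X]) : K[X] :=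
  ∑ i ∈ Finset.range (r + 1), p i * sh (i : ℤ) P

theorem toRat_adjointOpPoly (p : ℕ → K[X]) (r : ℕ) (P : K[X]) :
    toRat (adjointOpPoly p r P) = adjointOp p r (toRat P) := by
  rw [adjointOp_apply, adjointOpPoly, toRat, map_sum]
  exact Finset.sum_congr rfl fun i _ => by rw [map_mul, shiftRat_toRat]

/-- A canonical form associated to an operator `L` on `K(n)`. -/
def IsCanonicalForm (L φ : RatFunc K →ₗ[K] RatFunc K) : Prop :=
  ∀ R, φ (L R) = 0 ∧ R - φ R ∈ LinearMap.range L

/-! ## Shiftless decompositions -/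

/-- Each `Q i` is a nonconstant square-free polynomial, and
`gcd(Q_i(n+k), Q_j(n)) = 1` for all `i, j` and all integers `k` unless `i = j` and `k = 0`. -/
structure IsShiftless {ι : Type*} (Q : ι → K[X]) : Prop where
  nonconst : ∀ i, 0 < (Q i).natDegree
  squarefree : ∀ i, Squarefree (Q i)
  coprime : ∀ (i j : ι) (k : ℤ), (i ≠ j ∨ k ≠ 0) → IsCoprime (sh (-k) (Q i)) (Q j)

/-- `F` is, up to a nonzero constant, a product of positive powers of shifts `Q_i(n+h)` with
`i ∈ S`, each `i ∈ S` occurring. -/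
def HasShiftFactorization {ι : Type*} (S : Finset ι) (Q : ι → K[X]) (F : K[X]) : Prop :=
  ∃ (c : K) (H : ι → Finset ℤ) (e : ι → ℤ → ℕ), c ≠ 0 ∧
    (∀ i ∈ S, (H i).Nonempty ∧ ∀ h ∈ H i, 1 ≤ e i h) ∧
    F = C c * ∏ i ∈ S, ∏ h ∈ H i, sh (-h) (Q i) ^ e i h

open scoped Classical in
/-- `Q` is refined with respect to `P`: for each integer `h` there is `ℓ` such that
`gcd(P, Q(n+h)^(ℓ+1)) = Q(n+h)^ℓ`, up to nonzero constants. -/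
def IsRefined (Q P : K[X]) : Prop :=
  ∀ h : ℤ, ∃ l : ℕ,
    Associated (EuclideanDomain.gcd P (sh (-h) Q ^ (l + 1))) (sh (-h) Q ^ l)

/-- Every irreducible polynomial divides some shift of some `Q i`. -/
def Exhausts {ι : Type*} (Q : ι → K[X]) : Prop :=
  ∀ g : K[X], Irreducible g → ∃ (i : ι) (h : ℤ), g ∣ sh (-h) (Q i)

/-- The space `K_Q(n)` spanned by the `n^ℓ / Q(n+h)^j`, `h ∈ ℤ`, `j ≥ 1`, `ℓ < j deg Q`. -/
def polarSpace (Q : K[X]) : Submodule K (RatFunc K) :=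
  Submodule.span K {f | ∃ (h : ℤ) (j l : ℕ), 1 ≤ j ∧ l < j * Q.natDegree ∧
    f = toRat (X ^ l) / toRat (sh (-h) Q) ^ j}

/-! ## Weak reduction of the polar part -/

/-- `ord_j(P)`: the largest `ℓ` such that `Q(n-j)^ℓ` divides `P` (for `P ≠ 0`, `Q` nonconstant). -/
def ord (Q P : K[X]) (j : ℤ) : ℕ := multiplicity (sh j Q) P

/-- `R` has a pole at a zero of `Q(n-j)`. -/
def HasPoleAt (Q : K[X]) (R : RatFunc K) (j : ℤ) : Prop := ¬ IsCoprime (sh j Q) R.denom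

/-- The highest order of a pole of `R` at the zeros of `Q(n-j)` (for `Q` square-free): the least
`s` such that `Q(n-j)^s R` has no pole there. -/
def poleOrder (Q : K[X]) (R : RatFunc K) (j : ℤ) : ℕ :=
  sInf {s | ¬ HasPoleAt Q (toRat (sh j Q) ^ s * R) j}

/-- `lam / Q(n-j)^s`, with `deg lam < s deg Q`, is the part of the partial fraction decomposition
of `R` that carries the poles at the zeros of `Q(n-j)`. -/
def IsPolarPart (Q : K[X]) (R : RatFunc K) (j : ℤ) (s : ℕ) (lam : K[X]) : Prop :=
  lam.degree < ((s * Q.natDegree : ℕ) : WithBot ℕ) ∧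
    ¬ HasPoleAt Q (R - toRat lam / toRat (sh j Q) ^ s) j

/-- The polynomial `A` of a step of the weak reduction at `Q(n-j)` with extreme coefficient `P`
(`p_0` or `p_r`). If `lam / Q(n-j)^s` is the polar part of `R` and `P'` is the remainder of
`P / Q(n-j)^{ord_j(P)}` modulo `Q(n-j)^s`, then `lam = A P' + B Q(n-j)^s` with
`deg A < s deg Q`. -/
def bezoutNumerator (Q P : K[X]) (R : RatFunc K) (j : ℤ) : Part K[X] :=
  let s := poleOrder Q R j
  let P' := (P / sh j Q ^ ord Q P j) % (sh j Q ^ s)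
  (theUnique (IsPolarPart Q R j s)).bind fun lam =>
    theUnique fun A : K[X] =>
      A.degree < ((s * Q.natDegree : ℕ) : WithBot ℕ) ∧ ∃ B : K[X], lam = A * P' + B * sh j Q ^ s

open scoped Classical in
/-- One round of the first loop: `j < 0` minimal is treated with `p_0`. -/
def lowStep (p : ℕ → K[X]) (r : ℕ) (Q : K[X]) (R : RatFunc K) : Part (RatFunc K ⊕ RatFunc K) :=
  if ∃ j : ℤ, j < 0 ∧ HasPoleAt Q R j then
    (theUnique fun j : ℤ => IsLeast {j | j < 0 ∧ HasPoleAt Q R j} j).bind fun j =>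
      (bezoutNumerator Q (p 0) R j).bind fun A =>
        Part.some (Sum.inr (R - adjointOp p r
          (toRat A / toRat (sh j Q) ^ (poleOrder Q R j + ord Q (p 0) j))))
  else Part.some (Sum.inl R)

open scoped Classical in
/-- One round of the second loop: `j ≥ r` maximal is treated with `p_r`. -/
def highStep (p : ℕ → K[X]) (r : ℕ) (Q : K[X]) (R : RatFunc K) : Part (RatFunc K ⊕ RatFunc K) :=
  if ∃ j : ℤ, (r : ℤ) ≤ j ∧ HasPoleAt Q R j then
    (theUnique fun j : ℤ => IsGreatest {j | (r : ℤ) ≤ j ∧ HasPoleAt Q R j} j).bind fun j =>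
      (bezoutNumerator Q (p r) R j).bind fun A =>
        Part.some (Sum.inr (R - adjointOp p r
          (toRat (sh (-(r : ℤ)) A) /
            toRat (sh (j - r) Q) ^ (poleOrder Q R j + ord Q (p r) j))))
  else Part.some (Sum.inl R)

/-- Weak reduction of poles `[R]_Q`: the two loops, one after the other (`PFun.fix` iterates a
step until it returns a left value). -/
def weakPolar (p : ℕ → K[X]) (r : ℕ) (Q : K[X]) (R : RatFunc K) : Part (RatFunc K) :=
  (PFun.fix (lowStep p r Q) R).bind fun R' => PFun.fix (highStep p r Q) R'

/-! ## Weak reduction of polynomials -/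

/-- `q` is the indicial polynomial of `L*` at infinity and `sig` the corresponding exponent:
`L*(n^s) = n^(s+sig) (q(s) + O(1/n))` for all integers `s`, with `q ≠ 0`. -/
def IsIndicial (p : ℕ → K[X]) (r : ℕ) (sig : ℤ) (q : K[X]) : Prop :=
  q ≠ 0 ∧ ∀ s : ℤ,
    let E : RatFunc K :=
      adjointOp p r (RatFunc.X ^ s) / RatFunc.X ^ (s + sig) - RatFunc.C (q.eval (s : K))
    E = 0 ∨ E.intDegree < 0

/-- Computation of the exponent `sig` and of the indicial polynomial `q` of `L*`. -/
def indicialData (p : ℕ → K[X]) (r : ℕ) : Part (ℤ × K[X]) :=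
  theUnique fun t : ℤ × K[X] => IsIndicial p r t.1 t.2

open scoped Classical in
/-- One round of the weak reduction of polynomials, on the pair `(a, P)`. -/
def polyStep (p : ℕ → K[X]) (r : ℕ) (sig : ℤ) (q : K[X]) (t : K[X] × K[X]) :
    Part (K[X] ⊕ (K[X] × K[X])) :=
  let a := t.1
  let P := t.2
  let d : ℤ := (P.natDegree : ℤ) - sig
  if P ≠ 0 ∧ sig ≤ (P.natDegree : ℤ) then
    if q.eval (d : K) = 0 then
      Part.some (Sum.inr (a + monomial P.natDegree P.leadingCoeff, P.eraseLead))
    else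
      Part.some (Sum.inr (a,
        P - C (P.leadingCoeff / q.eval (d : K)) * adjointOpPoly p r (X ^ d.toNat)))
  else Part.some (Sum.inl (a + P))

/-- Weak reduction of polynomials `[P]_∞`. -/
def weakPoly (p : ℕ → K[X]) (r : ℕ) (sig : ℤ) (q : K[X]) (P : K[X]) : Part K[X] :=
  PFun.fix (polyStep p r sig q) (0, P)

/-! ## Echelon bases -/

section Echelon

variable {μ : Type*} [LinearOrder μ]

/-- The leading (largest) monomial of a vector, `⊥` for the zero vector. -/
def lead (v : μ →₀ K) : WithBot μ := v.support.max

/-- Subtract from `w` the multiple of `b` that cancels its coefficient at the leading monomial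
of `b`. -/
def cancelLead (w b : μ →₀ K) : μ →₀ K :=
  match lead b with
  | ⊥ => w
  | (m : μ) => w - (w m / b m) • b

/-- Reduction of a vector by an echelon basis, listed by decreasing leading monomials. -/
def reduceBy (v : μ →₀ K) (B : List (μ →₀ K)) : μ →₀ K := B.foldl cancelLead v

open scoped Classical in
/-- Add a vector to an echelon basis. -/
def echelonInsert (B : List (μ →₀ K)) (g : μ →₀ K) : List (μ →₀ K) :=
  if reduceBy g B = 0 then B
  else B.orderedInsert (fun a b => lead b ≤ lead a) (reduceBy g B)

/-- An echelon basis of the span of a list of vectors, by Gaussian elimination. -/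
def echelon (G : List (μ →₀ K)) : List (μ →₀ K) := G.foldl echelonInsert []

end Echelon

/-! ## Coordinates in `K_Q(n) + K[n]` -/

/-- The indices `k` of the polynomial monomials `n^k` and the indices `(j, s, ℓ)` of the polar
monomials `n^ℓ / Q(n-j)^(s+1)`, `ℓ < deg Q`; polar monomials are larger than polynomial ones. -/
abbrev Mon (Q : K[X]) : Type := ℕ ⊕ₗ (ℤ ×ₗ (ℕ ×ₗ Fin Q.natDegree))

/-- The monomial with a given index. -/
def mono (Q : K[X]) (m : Mon Q) : RatFunc K :=
  match ofLex m with
  | Sum.inl k => toRat (X ^ k)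
  | Sum.inr t =>
      let j := (ofLex t).1
      let s := (ofLex (ofLex t).2).1
      let l := (ofLex (ofLex t).2).2
      toRat (X ^ (l : ℕ)) / toRat (sh j Q) ^ (s + 1)

/-- The rational function with given coordinates. -/
def ofCoords (Q : K[X]) (v : Mon Q →₀ K) : RatFunc K := v.sum fun m c => c • mono Q m

/-- The coordinates of a rational function of `K_Q(n) + K[n]`. -/
def coords (Q : K[X]) (R : RatFunc K) : Part (Mon Q →₀ K) := theUnique fun v => ofCoords Q v = R

/-! ## Precomputation of the bases -/

/-- The triples `(j, s, ℓ)` that index the generators of `[L*(K_Q(n))]_Q`: `s ≥ 1`,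
`ℓ < s deg Q`, and `j < 0`, `s ≤ ord_j(p_0)` or `j ≥ 0`, `s ≤ ord_{j+r}(p_r)`. -/
def generatorIndices (p : ℕ → K[X]) (r : ℕ) (Q : K[X]) : Set (ℤ × ℕ × ℕ) :=
  {t | 1 ≤ t.2.1 ∧ t.2.2 < t.2.1 * Q.natDegree ∧
    ((t.1 < 0 ∧ t.2.1 ≤ ord Q (p 0) t.1) ∨ (0 ≤ t.1 ∧ t.2.1 ≤ ord Q (p r) (t.1 + r)))}

/-- The coordinates of the generator `[L*(n^ℓ / Q(n-j)^s)]_Q`. -/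
def generator (p : ℕ → K[X]) (r : ℕ) (Q : K[X]) (t : ℤ × ℕ × ℕ) : Part (Mon Q →₀ K) :=
  (weakPolar p r Q (adjointOp p r (toRat (X ^ t.2.2) / toRat (sh t.1 Q) ^ t.2.1))).bind (coords Q)

/-- The echelon basis `B_Q`. -/
def polarBasis (p : ℕ → K[X]) (r : ℕ) (Q : K[X]) : Part (List (Mon Q →₀ K)) :=
  (enumerate (generatorIndices p r Q)).bind fun ts =>
    (runAll fun k : Fin ts.length => generator p r Q (ts.get k)).map fun g => echelon (List.ofFn g)

/-- The coordinates of a polynomial in the basis of the `n^k`. -/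
def polyCoords (P : K[X]) : ℕ →₀ K := (Polynomial.basisMonomials K).repr P

/-- The polynomial with given coordinates. -/
def ofPolyCoords (v : ℕ →₀ K) : K[X] := (Polynomial.basisMonomials K).repr.symm v

open scoped Classical in
/-- The elements of `B_Q ∩ K[n]`. -/
def polynomialElements (Q : K[X]) (B : List (Mon Q →₀ K)) : List K[X] :=
  ((B.map (ofCoords Q)).filter fun R => R.denom = 1).map RatFunc.num

/-- The echelon basis `B_pol`, computed from the bases `B_{Q_i}`, `i ∈ S`, and the
`[L*(n^s)]_∞` with `s ∈ ℕ` a root of the indicial polynomial. -/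
def polynomialBasis {ι : Type*} (p : ℕ → K[X]) (r : ℕ) (sig : ℤ) (q : K[X]) (Q : ι → K[X])
    (S : Finset ι) (B : ∀ i : S, List (Mon (Q i) →₀ K)) : Part (List (ℕ →₀ K)) :=
  (enumerate {s : ℕ | q.eval (s : K) = 0}).bind fun ss =>
    (runAll fun k : Fin ss.length => weakPoly p r sig q (adjointOpPoly p r (X ^ ss.get k))).map
      fun g => echelon
        ((S.attach.toList.flatMap (fun i : S => polynomialElements (Q i) (B i)) ++ List.ofFn g).map
          polyCoords)

/-! ## Reduction of rational functions -/

/-- The decomposition `R = P_∞ + ∑ R_i` with `P_∞ ∈ K[n]` and `R_i ∈ K_{Q_i}(n)`. -/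
def decompose {ι : Type*} (Q : ι → K[X]) (R : RatFunc K) : Part (K[X] × (ι →₀ RatFunc K)) :=
  theUnique fun d => (∀ i, d.2 i ∈ polarSpace (Q i)) ∧ R = toRat d.1 + d.2.sum fun _ f => f

/-- The polynomial `P` in `R = P + R'` with `R'` of negative degree. -/
def polyPart (R : RatFunc K) : K[X] := R.num / R.denom

open scoped Classical in
/-- Weak reduction of a component `R_i` followed, when `i ∈ S`, by its reduction by `B_{Q_i}`. -/
def reducePolar {ι : Type*} (p : ℕ → K[X]) (r : ℕ) (Q : ι → K[X]) (S : Finset ι)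
    (B : ∀ i : S, List (Mon (Q i) →₀ K)) (i : ι) (R : RatFunc K) : Part (RatFunc K) :=
  (weakPolar p r (Q i) R).bind fun R' =>
    if h : i ∈ S then
      (coords (Q i) R').map fun v => ofCoords (Q i) (reduceBy v (B ⟨i, h⟩))
    else Part.some R'

/-- Reduction of a rational function, given the precomputed bases. -/
def reduceWith {ι : Type*} (p : ℕ → K[X]) (r : ℕ) (sig : ℤ) (q : K[X]) (Q : ι → K[X])
    (S : Finset ι) (B : ∀ i : S, List (Mon (Q i) →₀ K)) (Bpol : List (ℕ →₀ K))
    (R : RatFunc K) : Part (RatFunc K) :=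
  (decompose Q R).bind fun d =>
    (runAll fun i : d.2.support => reducePolar p r Q S B i (d.2 i)).bind fun f =>
      let R₁ : RatFunc K := toRat d.1 + ∑ i, f i
      let P := polyPart R₁
      (weakPoly p r sig q P).map fun P' =>
        toRat (ofPolyCoords (reduceBy (polyCoords P') Bpol)) + (R₁ - toRat P)

/-- The whole reduction algorithm `[R]` for `L*`: indicial polynomial, precomputation of the
bases, then reduction of `R`. -/
def reduce {ι : Type*} (p : ℕ → K[X]) (r : ℕ) (Q : ι → K[X]) (S : Finset ι) (R : RatFunc K) :
    Part (RatFunc K) :=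
  (indicialData p r).bind fun t =>
    (runAll fun i : S => polarBasis p r (Q i)).bind fun B =>
      (polynomialBasis p r t.1 t.2 Q S B).bind fun Bpol =>
        reduceWith p r t.1 t.2 Q S B Bpol R

end ShiftReduction

end

/-!
The algorithm is a chain of loops and of solutions of equations. Each link is shown to be defined
everywhere and to have a graph contained in a linear relation `Rel`; if moreover `(0, w) ∈ Rel`
forces `w = 0`, then `exists_linearMap_of_rel` says that the link computes a linear map, and that
this map is characterised by `Rel`.

* Weak reduction of poles (`exists_weakPolar`): `R` is related to `R'` if `R'` has no poles at the
  zeros of `Q(n-j)` for `j < 0` and `j ≥ r`, and `R - R'` is in `L*(V)`, where `V` (`reducerSpace`)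
  consists of the sums of fractions whose polar order at `Q(n-j)` exceeds what `p_0` (for `j < 0`)
  or `p_r` (for `j ≥ 0`) cancels. If `T ∈ V` is nonzero, its leftmost poles at negative indices
  survive in `p_0 T`, and its rightmost poles at nonnegative indices survive in `p_r S_n^{-r} T`, so
  that `L* T` is not reduced. This is the place where refinement is used: it makes
  `p_0 / Q(n-j)^{ord_j(p_0)}` prime to `Q(n-j)`, and likewise for `p_r`.
* Weak reduction of polynomials (`exists_weakPoly`): the same, with the leading monomial `n^s`,
  `q(s) ≠ 0`, of a polynomial `T` surviving in `L* T` as a multiple of `n^(s+σ)`. The indicial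
  polynomial `q` exists because `L*(n^s) n^{-s}` has an expansion at infinity whose coefficients are
  polynomials in `s`, and because `L*` is not zero on polynomials (`exists_isIndicial`).
* The decomposition `R = P_∞ + ∑ R_i` (`exists_decompose`) exists by Bézout's identity and is unique
  because distinct components have disjoint poles.

Every reduction changes its input by an element of the image of `L*`, which gives `R - [R] ∈ L*(K(n))`.

It remains to see that `[L* R] = 0`, for `R = P` a polynomial and for `R = f ∈ K_Q(n)`. Since
`K_Q(n)` is spanned by `V` and by the finitely many fractions that index the generators
(`polarSpace_le_sup`), and `[L* T]_Q = 0` for `T ∈ V`, the basis `B_Q` spans `[L*(K_Q(n))]_Q`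
(`exists_polarBasis`). If `L* f = P + T` with `T ∈ K_Q(n)`, then `[T]_Q = [L* f]_Q - P` is reduced
by `B_Q` to the reduction of `-P`. Polar monomials being larger than polynomial ones, only the
polynomial elements of `B_Q` act on `P`, so that `P + T` becomes a combination of polynomial
elements of `B_Q` (`exists_reducePolar`). These are in `L*(K_Q(n))`, hence of degree less than `σ`;
they are fixed by the weak reduction of polynomials, and reduced to zero by `B_pol`. Finally
`[L* P]_∞` is a combination of the `[L*(n^s)]_∞` with `q(s) = 0`, also reduced to zero by `B_pol`.
These facts are put together in `exists_reduce`.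
-/

noncomputable section

namespace ShiftReduction

variable {K : Type*} [Field K]

/-! ### Partial computations -/

theorem theUnique_eq_some {α : Type*} {P : α → Prop} {a : α} (ha : P a)
    (huniq : ∀ b, P b → b = a) : theUnique P = Part.some a := by
  have h : ∃! x, P x := ⟨a, ha, huniq⟩
  refine Part.eq_some_iff.2 ⟨h, huniq _ h.choose_spec.1⟩

theorem runAll_eq_some {ι : Type*} {α : ι → Type*} {f : ∀ i, Part (α i)} {g : ∀ i, α i}
    (h : ∀ i, f i = Part.some (g i)) : runAll f = Part.some g := by
  obtain rfl : f = fun i => Part.some (g i) := funext h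
  exact Part.eq_some_iff.2 ⟨fun _ => trivial, rfl⟩

theorem enumerate_eq_some {α : Type*} {s : Set α} (h : s.Finite) :
    enumerate s = Part.some h.toFinset.toList :=
  Part.eq_some_iff.2 ⟨h, rfl⟩

theorem mem_fix_of_step {α β : Type*} {f : α → Part (β ⊕ α)} {a a' : α} {b : β}
    (h : f a = Part.some (Sum.inr a')) (hb : b ∈ PFun.fix f a') : b ∈ PFun.fix f a :=
  PFun.fix_fwd_eq (f := f) (a := a) (Part.eq_some_iff.1 h) ▸ hb

theorem mem_fix_of_final {α β : Type*} {f : α → Part (β ⊕ α)} {a : α} {b : β}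
    (h : f a = Part.some (Sum.inl b)) : b ∈ PFun.fix f a :=
  PFun.fix_stop (f := f) (Part.eq_some_iff.1 h)

/-- A computation that always succeeds, and whose input and output are related by a linear relation
that is functional, computes a linear map. -/
theorem exists_linearMap_of_rel {V W : Type*} [AddCommGroup V] [Module K V] [AddCommGroup W]
    [Module K W] (f : V → Part W) (Rel : Submodule K (V × W))
    (hex : ∀ v, ∃ w, f v = Part.some w ∧ (v, w) ∈ Rel) (huniq : ∀ w, (0, w) ∈ Rel → w = 0) :
    ∃ φ : V →ₗ[K] W, ∀ v, f v = Part.some (φ v) ∧ ∀ w, (v, w) ∈ Rel ↔ φ v = w := by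
  choose g hg hrel using hex
  have key : ∀ v w, (v, w) ∈ Rel → w = g v := fun v w h => by
    have := Rel.sub_mem h (hrel v)
    rw [Prod.mk_sub_mk, sub_self] at this
    exact sub_eq_zero.1 (huniq _ this)
  exact ⟨{ toFun := g
           map_add' := fun a b => (key _ _ (Rel.add_mem (hrel a) (hrel b))).symm
           map_smul' := fun c a => (key _ _ (Rel.smul_mem c (hrel a))).symm },
    fun v => ⟨hg v, fun w => ⟨fun h => (key v w h).symm, fun h => h ▸ hrel v⟩⟩⟩

/-! ### Echelon bases -/

section Echelon

variable {μ : Type*} [LinearOrder μ]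

theorem lead_eq_bot {v : μ →₀ K} : lead v = ⊥ ↔ v = 0 := by
  simp [lead, Finset.max_eq_bot]

theorem exists_lead {v : μ →₀ K} (hv : v ≠ 0) : ∃ m : μ, lead v = m :=
  Option.ne_none_iff_exists'.1 (mt lead_eq_bot.1 hv)

theorem apply_ne_zero_of_lead {v : μ →₀ K} {m : μ} (h : lead v = m) : v m ≠ 0 :=
  Finsupp.mem_support_iff.1 (Finset.mem_of_max h)

theorem apply_eq_zero_of_lead_lt {v : μ →₀ K} {m : μ} (h : lead v < m) : v m = 0 := by
  by_contra hm
  exact absurd (Finset.le_max (Finsupp.mem_support_iff.2 hm)) (not_le.2 h)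

theorem cancelLead_of_lead {b : μ →₀ K} {m : μ} (h : lead b = m) (w : μ →₀ K) :
    cancelLead w b = w - (w m / b m) • b := by
  simp only [cancelLead]
  split <;> rename_i h'
  · rw [h] at h'; exact absurd h' (WithBot.coe_ne_bot)
  · rw [h] at h'; rw [WithBot.coe_inj.1 h']

theorem cancelLead_zero_right (w : μ →₀ K) : cancelLead w 0 = w := by
  simp only [cancelLead]
  split <;> rename_i h'
  · rfl
  · rw [lead_eq_bot.2 rfl] at h'; exact absurd h'.symm (WithBot.coe_ne_bot)

/-- Cancelling a leading coefficient, as a linear map. -/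
def cancelLeadₗ (b : μ →₀ K) : (μ →₀ K) →ₗ[K] (μ →₀ K) where
  toFun w := cancelLead w b
  map_add' w w' := by
    by_cases hb : b = 0
    · simp [hb, cancelLead_zero_right]
    · obtain ⟨m, hm⟩ := exists_lead hb
      simp only [cancelLead_of_lead hm, Finsupp.add_apply, add_div, add_smul]
      abel
  map_smul' c w := by
    by_cases hb : b = 0
    · simp [hb, cancelLead_zero_right]
    · obtain ⟨m, hm⟩ := exists_lead hb
      simp only [cancelLead_of_lead hm, Finsupp.smul_apply, smul_eq_mul, mul_div_assoc, mul_smul,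
        smul_sub, RingHom.id_apply]

/-- Reduction by a list of vectors, as a linear map. -/
def reduceByₗ : List (μ →₀ K) → (μ →₀ K) →ₗ[K] (μ →₀ K)
  | [] => LinearMap.id
  | b :: B => reduceByₗ B ∘ₗ cancelLeadₗ b

theorem reduceByₗ_apply (B : List (μ →₀ K)) (v : μ →₀ K) : reduceByₗ B v = reduceBy v B := by
  induction B generalizing v with
  | nil => rfl
  | cons b B ih => exact ih _

theorem sub_cancelLead_mem (w b : μ →₀ K) : w - cancelLead w b ∈ Submodule.span K {b} := by
  by_cases hb : b = 0
  · simp [hb, cancelLead_zero_right]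
  · obtain ⟨m, hm⟩ := exists_lead hb
    rw [cancelLead_of_lead hm, sub_sub_cancel]
    exact Submodule.smul_mem _ _ (Submodule.mem_span_singleton_self b)

theorem sub_reduceBy_mem (v : μ →₀ K) (B : List (μ →₀ K)) :
    v - reduceBy v B ∈ Submodule.span K {b | b ∈ B} := by
  induction B generalizing v with
  | nil => simp [reduceBy]
  | cons b B ih =>
    have h1 := Submodule.span_mono (R := K) (s := {b}) (t := {c | c ∈ b :: B})
      (by simp) (sub_cancelLead_mem v b)
    have h2 := Submodule.span_mono (R := K) (s := {c | c ∈ B}) (t := {c | c ∈ b :: B})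
      (fun c hc => List.mem_cons_of_mem _ hc) (ih (cancelLead v b))
    have := Submodule.add_mem _ h1 h2
    rwa [sub_add_sub_cancel] at this

/-- A list of nonzero vectors with strictly decreasing leading monomials. -/
def IsEchelon (B : List (μ →₀ K)) : Prop :=
  (∀ b ∈ B, b ≠ 0) ∧ B.Pairwise fun a b => lead b < lead a

theorem IsEchelon.of_cons {b : μ →₀ K} {B : List (μ →₀ K)} (h : IsEchelon (b :: B)) :
    IsEchelon B :=
  ⟨fun c hc => h.1 c (List.mem_cons_of_mem _ hc), (List.pairwise_cons.1 h.2).2⟩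

theorem cancelLead_eq_self {w b : μ →₀ K} (h : ∀ m : μ, lead b = m → w m = 0) :
    cancelLead w b = w := by
  by_cases hb : b = 0
  · rw [hb, cancelLead_zero_right]
  · obtain ⟨m, hm⟩ := exists_lead hb
    simp [cancelLead_of_lead hm, h m hm]

theorem cancelLead_self (b : μ →₀ K) : cancelLead b b = 0 := by
  by_cases hb : b = 0
  · rw [hb, cancelLead_zero_right]
  · obtain ⟨m, hm⟩ := exists_lead hb
    rw [cancelLead_of_lead hm, div_self (apply_ne_zero_of_lead hm), one_smul, sub_self]

theorem reduceBy_apply_eq_self {m : μ} {B : List (μ →₀ K)} (hB : ∀ b ∈ B, b m = 0)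
    (v : μ →₀ K) : reduceBy v B m = v m := by
  induction B generalizing v with
  | nil => rfl
  | cons b B ih =>
    change reduceBy (cancelLead v b) B m = v m
    rw [ih (fun c hc => hB c (List.mem_cons_of_mem _ hc))]
    by_cases hb : b = 0
    · rw [hb, cancelLead_zero_right]
    · obtain ⟨m', hm'⟩ := exists_lead hb
      simp [cancelLead_of_lead hm', hB b List.mem_cons_self]

theorem reduceBy_zero (B : List (μ →₀ K)) : reduceBy 0 B = 0 := by
  rw [← reduceByₗ_apply, map_zero]

theorem IsEchelon.reduceBy_eq_zero_of_mem {B : List (μ →₀ K)} (h : IsEchelon B) {b : μ →₀ K}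
    (hb : b ∈ B) : reduceBy b B = 0 := by
  induction B with
  | nil => simp at hb
  | cons c B ih =>
    change reduceBy (cancelLead b c) B = 0
    rcases List.mem_cons.1 hb with rfl | hb'
    · rw [cancelLead_self, reduceBy_zero]
    · rw [cancelLead_eq_self, ih h.of_cons hb']
      intro m hm
      exact apply_eq_zero_of_lead_lt (hm ▸ (List.pairwise_cons.1 h.2).1 b hb')

theorem IsEchelon.reduceBy_eq_zero {B : List (μ →₀ K)} (h : IsEchelon B) {v : μ →₀ K}
    (hv : v ∈ Submodule.span K {b | b ∈ B}) : reduceBy v B = 0 := by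
  have hle : Submodule.span K {b | b ∈ B} ≤ LinearMap.ker (reduceByₗ B) :=
    Submodule.span_le.2 fun b hb => by
      simpa [reduceByₗ_apply] using h.reduceBy_eq_zero_of_mem hb
  simpa [reduceByₗ_apply] using hle hv

theorem IsEchelon.reduceBy_apply_lead {B : List (μ →₀ K)} (h : IsEchelon B) {b : μ →₀ K}
    (hb : b ∈ B) {m : μ} (hm : lead b = m) (v : μ →₀ K) : reduceBy v B m = 0 := by
  induction B generalizing v with
  | nil => simp at hb
  | cons c B ih =>
    change reduceBy (cancelLead v c) B m = 0
    rcases List.mem_cons.1 hb with rfl | hb'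
    · rw [reduceBy_apply_eq_self fun c hc =>
        apply_eq_zero_of_lead_lt (hm ▸ (List.pairwise_cons.1 h.2).1 c hc), cancelLead_of_lead hm]
      simp [div_mul_cancel₀ _ (apply_ne_zero_of_lead hm)]
    · exact ih h.of_cons hb' _

theorem IsEchelon.orderedInsert {B : List (μ →₀ K)} (h : IsEchelon B) {v : μ →₀ K} (hv : v ≠ 0)
    (hne : ∀ b ∈ B, lead v ≠ lead b) :
    IsEchelon (B.orderedInsert (fun a b => lead b ≤ lead a) v) := by
  refine ⟨fun b hb => ?_, ?_⟩
  · rcases (List.mem_orderedInsert _).1 hb with rfl | hb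
    · exact hv
    · exact h.1 b hb
  · induction B with
    | nil => simp
    | cons c B ih =>
      have hc := List.pairwise_cons.1 h.2
      have hvc := hne c List.mem_cons_self
      rw [List.orderedInsert_cons]
      split
      · rename_i hle
        have hlt : lead c < lead v := lt_of_le_of_ne hle hvc.symm
        refine List.pairwise_cons.2 ⟨fun b hb => ?_, h.2⟩
        rcases List.mem_cons.1 hb with rfl | hb
        · exact hlt
        · exact (hc.1 b hb).trans hlt
      · rename_i hle
        refine List.pairwise_cons.2 ⟨fun b hb => ?_,
          ih h.of_cons fun b hb => hne b (List.mem_cons_of_mem _ hb)⟩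
        rcases (List.mem_orderedInsert _).1 hb with rfl | hb
        · exact not_le.1 hle
        · exact hc.1 b hb

theorem IsEchelon.echelonInsert {B : List (μ →₀ K)} (h : IsEchelon B) (g : μ →₀ K) :
    IsEchelon (echelonInsert B g) := by
  unfold ShiftReduction.echelonInsert
  split
  · exact h
  · rename_i hv
    refine h.orderedInsert hv fun b hb heq => ?_
    obtain ⟨m, hm⟩ := exists_lead (h.1 b hb)
    exact apply_ne_zero_of_lead (heq.trans hm) (h.reduceBy_apply_lead hb hm g)

theorem span_echelonInsert (B : List (μ →₀ K)) (g : μ →₀ K) :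
    Submodule.span K {b | b ∈ echelonInsert B g} =
      Submodule.span K {b | b ∈ B} ⊔ Submodule.span K {g} := by
  have hg := sub_reduceBy_mem g B
  unfold ShiftReduction.echelonInsert
  split
  · rename_i hv
    rw [hv, sub_zero] at hg
    exact (sup_eq_left.2 (Submodule.span_le.2 (by simpa using hg))).symm
  · have hset : {b | b ∈ B.orderedInsert (fun a b => lead b ≤ lead a) (reduceBy g B)} =
        {b | b ∈ B} ∪ {reduceBy g B} := by
      ext b; simp [List.mem_orderedInsert, or_comm]
    rw [hset, Submodule.span_union]
    refine le_antisymm (sup_le le_sup_left ?_) (sup_le le_sup_left ?_) <;>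
      rw [Submodule.span_singleton_le_iff_mem]
    · have := Submodule.sub_mem _ (Submodule.mem_sup_right (S := Submodule.span K {b | b ∈ B})
        (Submodule.mem_span_singleton_self g)) (Submodule.mem_sup_left hg)
      rwa [sub_sub_cancel] at this
    · have := Submodule.add_mem _ (Submodule.mem_sup_right (S := Submodule.span K {b | b ∈ B})
        (Submodule.mem_span_singleton_self (reduceBy g B))) (Submodule.mem_sup_left hg)
      rwa [add_sub_cancel] at this

theorem isEchelon_foldl (G B : List (μ →₀ K)) (hB : IsEchelon B) :
    IsEchelon (G.foldl echelonInsert B) := by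
  induction G generalizing B with
  | nil => exact hB
  | cons g G ih => exact ih _ (hB.echelonInsert g)

theorem span_foldl_echelonInsert (G B : List (μ →₀ K)) :
    Submodule.span K {b | b ∈ G.foldl echelonInsert B} =
      Submodule.span K {b | b ∈ B} ⊔ Submodule.span K {b | b ∈ G} := by
  induction G generalizing B with
  | nil => simp
  | cons g G ih =>
    have hset : {b | b ∈ g :: G} = {g} ∪ {b | b ∈ G} := by ext b; simp
    rw [List.foldl_cons, ih, span_echelonInsert, hset, Submodule.span_union, sup_assoc]

theorem isEchelon_echelon (G : List (μ →₀ K)) : IsEchelon (echelon G) :=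
  isEchelon_foldl G [] ⟨by simp, List.Pairwise.nil⟩

theorem span_echelon (G : List (μ →₀ K)) :
    Submodule.span K {b | b ∈ echelon G} = Submodule.span K {g | g ∈ G} := by
  simp [echelon, span_foldl_echelonInsert]

end Echelon

/-! ### Shifts -/

theorem sh_eq (j : ℤ) (P : K[X]) : sh j P = taylorAlgHom (-(j : K)) P := rfl

theorem sh_zero_right (j : ℤ) : sh j (0 : K[X]) = 0 := by simp [sh_eq]

theorem sh_mul (j : ℤ) (P P' : K[X]) : sh j (P * P') = sh j P * sh j P' := by simp [sh_eq]

theorem sh_pow (j : ℤ) (P : K[X]) (s : ℕ) : sh j (P ^ s) = sh j P ^ s := by simp [sh_eq]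

theorem sh_sh (i j : ℤ) (P : K[X]) : sh i (sh j P) = sh (i + j) P := by
  rw [sh, sh, sh, taylor_taylor, Int.cast_add, neg_add]

theorem sh_zero (P : K[X]) : sh 0 P = P := by simp [sh]

theorem natDegree_sh (j : ℤ) (P : K[X]) : (sh j P).natDegree = P.natDegree := natDegree_taylor _ _

theorem degree_sh (j : ℤ) (P : K[X]) : (sh j P).degree = P.degree := degree_taylor _ _

theorem sh_eq_zero {j : ℤ} {P : K[X]} : sh j P = 0 ↔ P = 0 := taylor_eq_zero _ _

theorem isCoprime_sh {P P' : K[X]} (h : IsCoprime P P') (j : ℤ) : IsCoprime (sh j P) (sh j P') :=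
  h.map (taylorAlgHom (-(j : K))).toRingHom

theorem toRat_zero : toRat (0 : K[X]) = 0 := map_zero _

theorem toRat_one : toRat (1 : K[X]) = 1 := map_one _

theorem toRat_add (P P' : K[X]) : toRat (P + P') = toRat P + toRat P' := map_add _ _ _

theorem toRat_sub (P P' : K[X]) : toRat (P - P') = toRat P - toRat P' := map_sub _ _ _

theorem toRat_mul (P P' : K[X]) : toRat (P * P') = toRat P * toRat P' := map_mul _ _ _

theorem toRat_pow (P : K[X]) (s : ℕ) : toRat (P ^ s) = toRat P ^ s := map_pow _ _ _

theorem toRat_injective : Function.Injective (toRat : K[X] → RatFunc K) :=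
  RatFunc.algebraMap_injective K

theorem toRat_eq_zero {P : K[X]} : toRat P = 0 ↔ P = 0 :=
  map_eq_zero_iff _ toRat_injective

theorem toRat_ne_zero {P : K[X]} (h : P ≠ 0) : toRat P ≠ 0 := mt toRat_eq_zero.1 h

theorem toRat_C_mul (c : K) (P : K[X]) : toRat (C c * P) = c • toRat P := by
  rw [toRat, map_mul, RatFunc.algebraMap_C, RatFunc.smul_eq_C_mul]

/-- The inclusion of `K[n]` into `K(n)`, as a `K`-linear map. -/
def toRatₗ (K : Type*) [Field K] : K[X] →ₗ[K] RatFunc K where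
  toFun := toRat
  map_add' := map_add _
  map_smul' c P := by rw [smul_eq_C_mul, toRat_C_mul, RingHom.id_apply]

theorem toRatₗ_apply (P : K[X]) : toRatₗ K P = toRat P := rfl

theorem exists_eq_div (R : RatFunc K) : ∃ a b : K[X], b ≠ 0 ∧ R = toRat a / toRat b :=
  ⟨R.num, R.denom, R.denom_ne_zero, R.num_div_denom.symm⟩

theorem shiftRat_shiftRat (i j : ℤ) (R : RatFunc K) :
    shiftRat i (shiftRat j R) = shiftRat (i + j) R := by
  obtain ⟨a, b, -, rfl⟩ := exists_eq_div R
  simp only [map_div₀, shiftRat_toRat, sh_sh]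

theorem shiftRat_zero (R : RatFunc K) : shiftRat 0 R = R := by
  obtain ⟨a, b, -, rfl⟩ := exists_eq_div R
  simp only [map_div₀, shiftRat_toRat, sh_zero]

/-! ### Degrees at infinity -/

theorem intDegree_div_eq {a b : K[X]} (ha : a ≠ 0) (hb : b ≠ 0) :
    (toRat a / toRat b).intDegree = a.natDegree - b.natDegree := by
  rw [RatFunc.intDegree_div (toRat_ne_zero ha) (toRat_ne_zero hb), RatFunc.intDegree_polynomial,
    RatFunc.intDegree_polynomial]

/-- The space of rational functions of degree less than `d`, that is, `O(n^(d-1))`. -/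
def degLT (K : Type*) [Field K] (d : ℤ) : Submodule K (RatFunc K) where
  carrier := {E | E = 0 ∨ E.intDegree < d}
  zero_mem' := Or.inl rfl
  add_mem' := by
    intro a b ha hb
    by_cases hab : a + b = 0
    · exact Or.inl hab
    by_cases hb0 : b = 0
    · simpa [hb0] using ha
    by_cases ha0 : a = 0
    · simpa [ha0] using hb
    · exact Or.inr ((RatFunc.intDegree_add_le hb0 hab).trans_lt
        (max_lt (ha.resolve_left ha0) (hb.resolve_left hb0)))
  smul_mem' := by
    intro c a ha
    by_cases hc : c = 0
    · exact Or.inl (by simp [hc])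
    by_cases ha0 : a = 0
    · exact Or.inl (by simp [ha0])
    · refine Or.inr ?_
      have hc' : (RatFunc.C c : RatFunc K) ≠ 0 := by simpa using hc
      rw [RatFunc.smul_eq_C_mul, RatFunc.intDegree_mul hc' ha0, RatFunc.intDegree_C, zero_add]
      exact ha.resolve_left ha0

theorem mem_degLT {d : ℤ} {E : RatFunc K} : E ∈ degLT K d ↔ E = 0 ∨ E.intDegree < d := Iff.rfl

theorem degLT_mono {d d' : ℤ} (h : d ≤ d') : degLT K d ≤ degLT K d' :=
  fun _ hE => hE.imp id fun h' => h'.trans_le h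

theorem mul_mem_degLT {d d' : ℤ} {E E' : RatFunc K} (h : E ∈ degLT K d)
    (h' : E' ∈ degLT K (d' + 1)) : E * E' ∈ degLT K (d + d') := by
  by_cases hE : E = 0
  · exact Or.inl (by simp [hE])
  by_cases hE' : E' = 0
  · exact Or.inl (by simp [hE'])
  have h1 := h.resolve_left hE
  have h2 := h'.resolve_left hE'
  exact Or.inr (by rw [RatFunc.intDegree_mul hE hE']; omega)

theorem intDegree_zpow (s : ℤ) : (RatFunc.X ^ s : RatFunc K).intDegree = s := by
  have hpow : ∀ n : ℕ, (RatFunc.X ^ n : RatFunc K).intDegree = n := fun n => by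
    rw [← RatFunc.algebraMap_X, ← map_pow, RatFunc.intDegree_polynomial, natDegree_X_pow]
  rcases Int.eq_nat_or_neg s with ⟨n, rfl | rfl⟩
  · rw [zpow_natCast, hpow]
  · rw [zpow_neg, zpow_natCast, RatFunc.intDegree_inv, hpow]

theorem zpow_mem_degLT {s d : ℤ} (h : s < d) : (RatFunc.X ^ s : RatFunc K) ∈ degLT K d :=
  Or.inr (by rwa [intDegree_zpow])

theorem eq_zero_of_C_mem_degLT {c : K} (h : RatFunc.C c ∈ degLT K 0) : c = 0 := by
  rcases h with h | h
  · simpa using h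
  · simp at h

theorem mul_zpow_mem_degLT {d : ℤ} {E : RatFunc K} (h : E ∈ degLT K d) (s : ℤ) :
    E * RatFunc.X ^ s ∈ degLT K (d + s) :=
  mul_mem_degLT h (zpow_mem_degLT (by omega))

theorem mul_zpow_mem_degLT_iff {d : ℤ} {E : RatFunc K} (s : ℤ) :
    E * RatFunc.X ^ s ∈ degLT K (d + s) ↔ E ∈ degLT K d := by
  refine ⟨fun h => ?_, fun h => mul_zpow_mem_degLT h s⟩
  have := mul_zpow_mem_degLT h (-s)
  rwa [mul_assoc, ← zpow_add₀ RatFunc.X_ne_zero, add_neg_cancel, zpow_zero, mul_one,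
    add_neg_cancel_right] at this

theorem C_mul_mem_degLT {d : ℤ} {E : RatFunc K} (c : K) (h : E ∈ degLT K d) :
    RatFunc.C c * E ∈ degLT K d := by
  rw [← RatFunc.smul_eq_C_mul]
  exact Submodule.smul_mem _ _ h

/-- A nonzero multiple of `n^s` is not `O(n^(s-1))`. -/
theorem eq_zero_of_C_mul_zpow_mem_degLT {c : K} {s : ℤ}
    (h : RatFunc.C c * RatFunc.X ^ s ∈ degLT K s) : c = 0 := by
  refine eq_zero_of_C_mem_degLT ((mul_zpow_mem_degLT_iff s).1 ?_)
  rwa [zero_add]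

theorem toRat_mem_degLT {P : K[X]} {d : ℤ} :
    toRat P ∈ degLT K d ↔ P = 0 ∨ (P.natDegree : ℤ) < d := by
  rw [mem_degLT, toRat_eq_zero, RatFunc.intDegree_polynomial]

theorem toRat_mem_degLT_iff_coeff {P : K[X]} {d : ℤ} :
    toRat P ∈ degLT K d ↔ ∀ k : ℕ, d ≤ k → P.coeff k = 0 := by
  rw [toRat_mem_degLT]
  refine ⟨?_, fun h => ?_⟩
  · rintro (rfl | h) k hk
    · simp
    · exact coeff_eq_zero_of_natDegree_lt (by omega)
  · by_cases hP : P = 0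
    · exact Or.inl hP
    · refine Or.inr (not_le.1 fun hd => hP ?_)
      exact leadingCoeff_eq_zero.1 (h _ hd)

theorem eq_zero_of_toRat_mem_degLT {P : K[X]} {d : ℤ} (h : toRat P ∈ degLT K d) (hd : d ≤ 0) :
    P = 0 := by
  rcases toRat_mem_degLT.1 h with h | h
  · exact h
  · omega

theorem shiftRat_mem_degLT {d : ℤ} {E : RatFunc K} (h : E ∈ degLT K d) (j : ℤ) :
    shiftRat j E ∈ degLT K d := by
  obtain ⟨a, b, hb, rfl⟩ := exists_eq_div E
  by_cases ha : a = 0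
  · exact Or.inl (by simp [ha])
  have hb' : sh j b ≠ 0 := mt sh_eq_zero.1 hb
  have ha' : sh j a ≠ 0 := mt sh_eq_zero.1 ha
  rcases h with h | h
  · exact absurd h (div_ne_zero (toRat_ne_zero ha) (toRat_ne_zero hb))
  · refine Or.inr ?_
    rw [intDegree_div_eq ha hb] at h
    rwa [map_div₀, shiftRat_toRat, shiftRat_toRat, intDegree_div_eq ha' hb', natDegree_sh,
      natDegree_sh]

/-! ### The indicial polynomial -/

/-- An a priori bound for the degree of `L* f`, from the largest degree of a coefficient. -/
theorem exists_adjointOp_mem_degLT (p : ℕ → K[X]) (r : ℕ) :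
    ∃ D : ℤ, ∀ (d : ℤ) (f : RatFunc K), f ∈ degLT K d → adjointOp p r f ∈ degLT K (d + D) := by
  refine ⟨((Finset.range (r + 1)).sup fun i => (p i).natDegree : ℕ), fun d f hf => ?_⟩
  rw [adjointOp_apply]
  refine Submodule.sum_mem _ fun i hi => ?_
  rw [mul_comm]
  refine mul_mem_degLT (shiftRat_mem_degLT hf _) (toRat_mem_degLT.2 (Or.inr ?_))
  have := Finset.le_sup (f := fun i => (p i).natDegree) hi
  omega

/-- The polynomial `s ↦ binom(s, m)`. -/
def binomPoly (K : Type*) [Field K] (m : ℕ) : K[X] := C ((m.factorial : K)⁻¹) * descPochhammer K m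

theorem binomPoly_zero : binomPoly K 0 = 1 := by simp [binomPoly]

theorem binomPoly_eval_add_one [CharZero K] (m : ℕ) (s : K) :
    (binomPoly K (m + 1)).eval (s + 1) =
      (binomPoly K (m + 1)).eval s + (binomPoly K m).eval s := by
  have h1 : (descPochhammer K (m + 1)).eval (s + 1) = (s + 1) * (descPochhammer K m).eval s := by
    simp [descPochhammer_succ_left]
  have h2 : (m.factorial : K) ≠ 0 := Nat.cast_ne_zero.2 m.factorial_ne_zero
  have h3 : (m + 1 : K) ≠ 0 := by exact_mod_cast m.succ_ne_zero
  simp only [binomPoly, eval_mul, eval_C, h1, descPochhammer_succ_eval, Nat.factorial_succ,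
    Nat.cast_mul, Nat.cast_add, Nat.cast_one]
  field_simp
  ring

/-- The truncated binomial series of `(1 + y)^s` is compatible with `s ↦ s + 1` up to one term. -/
theorem truncated_binomial_succ [CharZero K] (y : RatFunc K) (M : ℕ) (s : K) :
    ∑ m ∈ Finset.range (M + 1), RatFunc.C ((binomPoly K m).eval (s + 1)) * y ^ m =
      (1 + y) * ∑ m ∈ Finset.range (M + 1), RatFunc.C ((binomPoly K m).eval s) * y ^ m -
        RatFunc.C ((binomPoly K M).eval s) * y ^ (M + 1) := by
  induction M with
  | zero => simp [binomPoly_zero]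
  | succ M ih =>
    rw [Finset.sum_range_succ, ih, Finset.sum_range_succ _ (M + 1), binomPoly_eval_add_one, map_add]
    ring

/-- Binomial expansion at infinity of `(1 + c/n)^s`, for all integers `s`. -/
theorem zpow_sub_truncated_binomial_mem [CharZero K] (c : K) (M : ℕ) (s : ℤ) :
    (1 + RatFunc.C c * RatFunc.X⁻¹) ^ s -
      ∑ m ∈ Finset.range (M + 1), RatFunc.C ((binomPoly K m).eval (s : K)) *
        (RatFunc.C c * RatFunc.X⁻¹) ^ m ∈ degLT K (-M) := by
  set y : RatFunc K := RatFunc.C c * RatFunc.X⁻¹ with hy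
  have hX : (RatFunc.X : RatFunc K) ≠ 0 := RatFunc.X_ne_zero
  have hypow : ∀ m : ℕ, y ^ m = RatFunc.C (c ^ m) * RatFunc.X ^ (-(m : ℤ)) := fun m => by
    rw [hy, mul_pow, map_pow, zpow_neg, zpow_natCast, inv_pow]
  have hu : 1 + y = toRat (X + C c) / toRat X := by
    simp only [toRat, map_add, RatFunc.algebraMap_X, RatFunc.algebraMap_C, hy]
    field_simp
  have hu0 : 1 + y ≠ 0 := by
    rw [hu]
    exact div_ne_zero (toRat_ne_zero (X_add_C_ne_zero c)) (toRat_ne_zero X_ne_zero)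
  have hdeg : (1 + y).intDegree = 0 := by
    rw [hu, intDegree_div_eq (X_add_C_ne_zero c) X_ne_zero]
    simp
  have hu1 : 1 + y ∈ degLT K (0 + 1) := Or.inr (by rw [hdeg]; norm_num)
  have hu2 : (1 + y)⁻¹ ∈ degLT K (0 + 1) := Or.inr (by rw [RatFunc.intDegree_inv, hdeg]; norm_num)
  have herr : ∀ s : K,
      RatFunc.C ((binomPoly K M).eval s) * y ^ (M + 1) ∈ degLT K (-M) := fun s => by
    rw [hypow]
    exact C_mul_mem_degLT _ (C_mul_mem_degLT _ (zpow_mem_degLT (by push_cast; omega)))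
  have hstep : ∀ s : ℤ, (1 + y) ^ (s + 1) - ∑ m ∈ Finset.range (M + 1),
        RatFunc.C ((binomPoly K m).eval ((s + 1 : ℤ) : K)) * y ^ m =
      ((1 + y) ^ s - ∑ m ∈ Finset.range (M + 1),
        RatFunc.C ((binomPoly K m).eval (s : K)) * y ^ m) * (1 + y) +
        RatFunc.C ((binomPoly K M).eval (s : K)) * y ^ (M + 1) := fun s => by
    rw [Int.cast_add, Int.cast_one, truncated_binomial_succ, zpow_add_one₀ hu0]
    ring
  have hiff : ∀ s : ℤ, (1 + y) ^ (s + 1) - ∑ m ∈ Finset.range (M + 1),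
        RatFunc.C ((binomPoly K m).eval ((s + 1 : ℤ) : K)) * y ^ m ∈ degLT K (-M) ↔
      (1 + y) ^ s - ∑ m ∈ Finset.range (M + 1),
        RatFunc.C ((binomPoly K m).eval (s : K)) * y ^ m ∈ degLT K (-M) := fun s => by
    rw [hstep, Submodule.add_mem_iff_left _ (herr _)]
    refine ⟨fun h => ?_, fun h => ?_⟩
    · have := mul_mem_degLT h hu2
      rwa [mul_assoc, mul_inv_cancel₀ hu0, mul_one, add_zero] at this
    · have := mul_mem_degLT h hu1
      rwa [add_zero] at this
  induction s using Int.induction_on with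
  | zero =>
    rw [Finset.sum_eq_single 0]
    · simp [binomPoly_zero]
    · intro m _ hm
      simp [binomPoly, descPochhammer_ne_zero_eval_zero K hm]
    · simp
  | succ n ih => exact (hiff _).2 ih
  | pred n ih => exact (hiff _).1 (by rwa [sub_add_cancel])

/-- `g s = ∑_τ c_τ(s) n^τ + O(n^(-M-1))` for all integers `s`, with finitely many polynomials
`c_τ`. -/
def HasExpansion (M : ℕ) (g : ℤ → RatFunc K) : Prop :=
  ∃ c : ℤ →₀ K[X], ∀ s : ℤ,
    g s - c.sum (fun τ q => RatFunc.C (q.eval (s : K)) * RatFunc.X ^ τ) ∈ degLT K (-M)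

theorem hasExpansion_monomial (M : ℕ) (q : K[X]) (τ : ℤ) :
    HasExpansion M fun s => RatFunc.C (q.eval (s : K)) * RatFunc.X ^ τ :=
  ⟨Finsupp.single τ q, fun s => by simp [Finsupp.sum_single_index]⟩

theorem HasExpansion.add {M : ℕ} {g g' : ℤ → RatFunc K} (h : HasExpansion M g)
    (h' : HasExpansion M g') : HasExpansion M fun s => g s + g' s := by
  classical
  obtain ⟨c, hc⟩ := h
  obtain ⟨c', hc'⟩ := h'
  refine ⟨c + c', fun s => ?_⟩
  rw [Finsupp.sum_add_index' (by simp) (by intros; simp [add_mul]), add_sub_add_comm]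
  exact Submodule.add_mem _ (hc s) (hc' s)

theorem HasExpansion.sum {M : ℕ} {ι : Type*} {t : Finset ι} {g : ι → ℤ → RatFunc K}
    (h : ∀ i ∈ t, HasExpansion M (g i)) : HasExpansion M fun s => ∑ i ∈ t, g i s := by
  classical
  induction t using Finset.induction_on with
  | empty => exact ⟨0, fun s => by simp⟩
  | insert i t hi ih =>
    simp only [Finset.sum_insert hi]
    exact (h i (by simp)).add (ih fun k hk => h k (by simp [hk]))

theorem HasExpansion.congr {M : ℕ} {g g' : ℤ → RatFunc K} (h : HasExpansion M g)
    (hg : ∀ s, g' s - g s ∈ degLT K (-M)) : HasExpansion M g' := by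
  obtain ⟨c, hc⟩ := h
  refine ⟨c, fun s => ?_⟩
  have := Submodule.add_mem _ (hg s) (hc s)
  rwa [sub_add_sub_cancel] at this

theorem shiftRat_X (j : ℤ) :
    shiftRat j (RatFunc.X : RatFunc K) = RatFunc.X - RatFunc.C (j : K) := by
  rw [← RatFunc.algebraMap_X]
  change shiftRat j (toRat X) = _
  rw [shiftRat_toRat]
  simp [sh, taylor_X, toRat, sub_eq_add_neg]

/-- `L*(n^s) n^{-s}` is expanded at infinity with coefficients that are polynomials in `s`, by the
binomial series of `(1 - i/n)^s`. -/
theorem hasExpansion_adjointOp_zpow [CharZero K] (p : ℕ → K[X]) (r M : ℕ) :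
    HasExpansion M fun s => adjointOp p r (RatFunc.X ^ s) * RatFunc.X ^ (-s) := by
  have hX : (RatFunc.X : RatFunc K) ≠ 0 := RatFunc.X_ne_zero
  have key : ∀ s : ℤ, adjointOp p r (RatFunc.X ^ s) * RatFunc.X ^ (-s) =
      ∑ i ∈ Finset.range (r + 1), ∑ k ∈ Finset.range ((p i).natDegree + 1),
        RatFunc.C ((p i).coeff k) * RatFunc.X ^ k *
          (1 + RatFunc.C (-(i : K)) * RatFunc.X⁻¹) ^ s := fun s => by
    rw [adjointOp_apply, Finset.sum_mul]
    refine Finset.sum_congr rfl fun i _ => ?_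
    rw [← Finset.sum_mul, map_zpow₀, shiftRat_X, mul_assoc]
    congr 1
    · conv_lhs => rw [(p i).as_sum_range_C_mul_X_pow]
      simp [toRat]
    · rw [zpow_neg, ← inv_zpow, ← mul_zpow]
      congr 1
      rw [sub_mul, mul_inv_cancel₀ hX]
      simp [sub_eq_add_neg]
  simp only [key]
  refine HasExpansion.sum fun i _ => HasExpansion.sum fun k _ => ?_
  have hmain : HasExpansion M fun s => ∑ m ∈ Finset.range (M + k + 1),
      RatFunc.C ((C ((p i).coeff k * (-(i : K)) ^ m) * binomPoly K m).eval (s : K)) *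
        RatFunc.X ^ ((k : ℤ) - m) :=
    HasExpansion.sum fun m _ => hasExpansion_monomial M _ _
  refine hmain.congr fun s => ?_
  have h := C_mul_mem_degLT ((p i).coeff k)
    (mul_zpow_mem_degLT (zpow_sub_truncated_binomial_mem (-(i : K)) (M + k) s) k)
  refine degLT_mono (show -((M + k : ℕ) : ℤ) + k ≤ -M by push_cast; omega) ?_
  convert h using 1
  rw [sub_mul, mul_sub, Finset.sum_mul, Finset.mul_sum, zpow_natCast]
  congr 1
  · ring
  · refine Finset.sum_congr rfl fun m _ => ?_
    rw [zpow_sub₀ hX, zpow_natCast, zpow_natCast, mul_pow, inv_pow, eval_mul, eval_C, map_mul,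
      map_mul, map_pow]
    field_simp

/-- `L*` does not vanish on all polynomials: at a point `x` with `p_0(x) ≠ 0` take a polynomial
that vanishes at `x - 1, …, x - r` only. -/
theorem exists_adjointOpPoly_X_pow_ne_zero [CharZero K] {p : ℕ → K[X]} {r : ℕ} (hp0 : p 0 ≠ 0) :
    ∃ s : ℕ, adjointOpPoly p r (X ^ s) ≠ 0 := by
  by_contra! h
  have hall : ∀ f : K[X], adjointOpPoly p r f = 0 := fun f => by
    apply toRat_injective
    rw [toRat_adjointOpPoly, f.as_sum_range_C_mul_X_pow, toRat, map_sum, map_sum, toRat, map_zero]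
    refine Finset.sum_eq_zero fun k _ => ?_
    have hk : adjointOp p r (toRat (X ^ k)) = 0 := by
      rw [← toRat_adjointOpPoly, h, toRat, map_zero]
    change adjointOp p r (toRat (C (f.coeff k) * X ^ k)) = 0
    rw [toRat_C_mul, map_smul, hk, smul_zero]
  refine hp0 (Polynomial.funext fun x => ?_)
  set f : K[X] := ∏ i ∈ Finset.Icc 1 r, (X - C (x - (i : K))) with hf
  have hfx := congrArg (eval x) (hall f)
  rw [adjointOpPoly, eval_finsetSum, Finset.sum_range_succ', Finset.sum_eq_zero] at hfx
  · simp only [Nat.cast_zero, sh_zero, eval_mul, zero_add, eval_zero, mul_eq_zero] at hfx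
    refine (hfx.resolve_right ?_).trans eval_zero.symm
    rw [hf, eval_prod, ← ne_eq, Finset.prod_ne_zero_iff]
    intro i hi
    have : (i : K) ≠ 0 := Nat.cast_ne_zero.2 (by have := Finset.mem_Icc.1 hi; omega)
    simpa using this
  · intro i hi
    rw [eval_mul, sh, taylor_eval, hf, eval_prod, Finset.prod_eq_zero (i := i + 1), mul_zero]
    · simp only [Finset.mem_Icc, Finset.mem_range] at *; omega
    · simp

theorem toRat_X_pow (s : ℕ) : toRat (X ^ s : K[X]) = RatFunc.X ^ (s : ℤ) := by
  simp [toRat]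

/-- The defining property of the indicial polynomial, without division. -/
theorem isIndicial_iff {p : ℕ → K[X]} {r : ℕ} {sig : ℤ} {q : K[X]} :
    IsIndicial p r sig q ↔ q ≠ 0 ∧ ∀ s : ℤ,
      adjointOp p r (RatFunc.X ^ s) - RatFunc.C (q.eval (s : K)) * RatFunc.X ^ (s + sig) ∈
        degLT K (s + sig) := by
  have hX : (RatFunc.X : RatFunc K) ≠ 0 := RatFunc.X_ne_zero
  refine and_congr Iff.rfl (forall_congr' fun s => ?_)
  rw [← mem_degLT, ← mul_zpow_mem_degLT_iff (s + sig), zero_add, sub_mul,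
    div_mul_cancel₀ _ (zpow_ne_zero _ hX)]

/-- The exponent of the indicial polynomial is the largest one in the expansion of `L*(n^s) n^{-s}`,
up to `O(n^{-M-1})`, that has a nonzero coefficient. The expansion is not `O(n^{-M-1})` if
`L*(n^M) ≠ 0`, this being a polynomial. -/
theorem exists_isIndicial [CharZero K] {p : ℕ → K[X]} {r : ℕ} (hp0 : p 0 ≠ 0) :
    ∃ (sig : ℤ) (q : K[X]), IsIndicial p r sig q := by
  have hX : (RatFunc.X : RatFunc K) ≠ 0 := RatFunc.X_ne_zero
  obtain ⟨M, hM⟩ := exists_adjointOpPoly_X_pow_ne_zero (r := r) hp0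
  obtain ⟨c, hc⟩ := hasExpansion_adjointOp_zpow p r M
  have hne : (c.support.filter fun τ => -(M : ℤ) ≤ τ).Nonempty := by
    rw [Finset.nonempty_iff_ne_empty]
    intro hempty
    -- otherwise the polynomial `L*(n^M)` would be `O(1/n)`
    have hsum : c.sum (fun τ q => RatFunc.C (q.eval ((M : ℤ) : K)) * RatFunc.X ^ τ) ∈
        degLT K (-M) := by
      refine Submodule.sum_mem _ fun τ hτ => C_mul_mem_degLT _ (zpow_mem_degLT ?_)
      exact not_le.1 (Finset.filter_eq_empty_iff.1 hempty hτ)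
    have h := Submodule.add_mem _ (hc M) hsum
    rw [sub_add_cancel] at h
    have h' := mul_zpow_mem_degLT h M
    rw [mul_assoc, ← zpow_add₀ hX, neg_add_cancel, zpow_zero, mul_one, ← toRat_X_pow,
      ← toRat_adjointOpPoly] at h'
    exact hM (eq_zero_of_toRat_mem_degLT h' (by omega))
  obtain ⟨sig, hsig, hmax⟩ := Finset.exists_max_image _ id hne
  rw [Finset.mem_filter] at hsig
  refine ⟨sig, c sig, isIndicial_iff.2 ⟨Finsupp.mem_support_iff.1 hsig.1, fun s => ?_⟩⟩
  rw [add_comm s sig]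
  refine (mul_zpow_mem_degLT_iff (-s)).1 ?_
  rw [add_neg_cancel_right, sub_mul, mul_assoc, ← zpow_add₀ hX, add_neg_cancel_right]
  have h1 := degLT_mono (K := K) hsig.2 (hc s)
  rw [Finsupp.sum, ← Finset.add_sum_erase _ _ hsig.1] at h1
  have h2 : ∑ τ ∈ c.support.erase sig, RatFunc.C ((c τ).eval (s : K)) * RatFunc.X ^ τ ∈
      degLT K sig := by
    refine Submodule.sum_mem _ fun τ hτ => C_mul_mem_degLT _ (zpow_mem_degLT ?_)
    obtain ⟨hne', hτ⟩ := Finset.mem_erase.1 hτ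
    by_cases hMτ : -(M : ℤ) ≤ τ
    · exact lt_of_le_of_ne (hmax τ (Finset.mem_filter.2 ⟨hτ, hMτ⟩)) hne'
    · omega
  have h3 := Submodule.add_mem _ h1 h2
  rwa [sub_add_eq_sub_sub, sub_add_cancel] at h3

theorem IsIndicial.exponent_le [CharZero K] {p : ℕ → K[X]} {r : ℕ} {sig sig' : ℤ} {q q' : K[X]}
    (h : IsIndicial p r sig q) (h' : IsIndicial p r sig' q') : sig' ≤ sig := by
  rw [isIndicial_iff] at h h'
  by_contra! hlt
  refine h'.1 (Polynomial.eq_zero_of_infinite_isRoot q' ?_)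
  refine Set.infinite_of_injective_forall_mem (f := fun s : ℤ => (s : K)) Int.cast_injective ?_
  intro s
  refine eq_zero_of_C_mul_zpow_mem_degLT (s := s + sig') ?_
  have h1 := Submodule.add_mem _
    (degLT_mono (K := K) (show s + sig ≤ s + sig' by omega) (h.2 s))
    (C_mul_mem_degLT (q.eval (s : K))
      (zpow_mem_degLT (K := K) (show s + sig < s + sig' by omega)))
  rw [sub_add_cancel] at h1
  have h2 := Submodule.sub_mem _ h1 (h'.2 s)
  rwa [sub_sub_cancel] at h2

theorem IsIndicial.unique [CharZero K] {p : ℕ → K[X]} {r : ℕ} {sig sig' : ℤ} {q q' : K[X]}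
    (h : IsIndicial p r sig q) (h' : IsIndicial p r sig' q') : sig' = sig ∧ q' = q := by
  obtain rfl : sig' = sig := le_antisymm (h.exponent_le h') (h'.exponent_le h)
  refine ⟨rfl, ?_⟩
  rw [isIndicial_iff] at h h'
  rw [← sub_eq_zero]
  refine Polynomial.eq_zero_of_infinite_isRoot _ ?_
  refine Set.infinite_of_injective_forall_mem (f := fun s : ℤ => (s : K)) Int.cast_injective ?_
  intro s
  refine eq_zero_of_C_mul_zpow_mem_degLT (s := s + sig') ?_
  have h2 := Submodule.sub_mem _ (h.2 s) (h'.2 s)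
  rwa [sub_sub_sub_cancel_left, ← sub_mul, ← map_sub, ← eval_sub] at h2

theorem indicialData_eq_some [CharZero K] {p : ℕ → K[X]} {r : ℕ} {sig : ℤ} {q : K[X]}
    (h : IsIndicial p r sig q) : indicialData p r = Part.some (sig, q) :=
  theUnique_eq_some h fun _ ht => Prod.ext (h.unique ht).1 (h.unique ht).2

/-- A rational function is `c n^(d-1) + O(n^(d-2))` for some constant `c` if it is `O(n^(d-1))`. -/
theorem exists_sub_C_mul_zpow_mem_degLT {d : ℤ} {f : RatFunc K} (hf : f ∈ degLT K (d + 1)) :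
    ∃ c : K, f - RatFunc.C c * RatFunc.X ^ d ∈ degLT K d := by
  by_cases hf' : f ∈ degLT K d
  · exact ⟨0, by simpa using hf'⟩
  have hX : (RatFunc.X : RatFunc K) ≠ 0 := RatFunc.X_ne_zero
  obtain ⟨a, b, hb, rfl⟩ := exists_eq_div f
  have hfd : a ≠ 0 ∧ (a.natDegree : ℤ) - b.natDegree = d := by
    rw [mem_degLT, not_or] at hf'
    have ha : a ≠ 0 := by rintro rfl; simp at hf'
    have h1 := hf.resolve_left hf'.1
    have h2 := hf'.2
    rw [intDegree_div_eq ha hb] at h1 h2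
    exact ⟨ha, by omega⟩
  obtain ⟨ha, hd⟩ := hfd
  have hb' := toRat_ne_zero hb
  refine ⟨a.leadingCoeff / b.leadingCoeff, ?_⟩
  set c := a.leadingCoeff / b.leadingCoeff
  set N := a.natDegree
  set M := b.natDegree
  -- compare `a n^M` with `c b n^N`, both of degree `N + M` with the same leading coefficient
  have hpoly : toRat (a * X ^ M - C c * b * X ^ N) ∈ degLT K (N + M) := by
    rw [toRat_mem_degLT_iff_coeff]
    intro k hk
    rcases (show N + M ≤ k by omega).eq_or_lt with rfl | hk
    · rw [coeff_sub, coeff_mul_X_pow, add_comm N M, coeff_mul_X_pow, coeff_C_mul, sub_eq_zero]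
      exact (div_mul_cancel₀ _ (leadingCoeff_ne_zero.2 hb)).symm
    · refine coeff_eq_zero_of_natDegree_lt (lt_of_le_of_lt ?_ hk)
      refine (natDegree_sub_le _ _).trans (max_le ?_ ?_)
      · exact (natDegree_mul_le).trans (by simp [N])
      · refine (natDegree_mul_le).trans ?_
        have := natDegree_C_mul_le c b
        simp only [natDegree_X_pow]
        omega
  have hdiff : toRat a / toRat b - RatFunc.C c * RatFunc.X ^ d =
      toRat (a * X ^ M - C c * b * X ^ N) * (toRat b)⁻¹ * RatFunc.X ^ (-(M : ℤ)) := by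
    rw [← hd, zpow_sub₀ hX, zpow_neg, zpow_natCast, zpow_natCast]
    simp only [toRat, map_sub, map_mul, map_pow, RatFunc.algebraMap_X,
      RatFunc.algebraMap_C] at hb' ⊢
    field_simp
  have hbinv : (toRat b)⁻¹ ∈ degLT K (-(M : ℤ) + 1) :=
    Or.inr (by rw [RatFunc.intDegree_inv, RatFunc.intDegree_polynomial]; omega)
  rw [hdiff]
  have := mul_zpow_mem_degLT (mul_mem_degLT hpoly hbinv) (-(M : ℤ))
  rwa [show (N : ℤ) + M + -M + -M = d by omega] at this

/-- `L*` raises degrees by at most the exponent of the indicial polynomial, also on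
rational functions. -/
theorem IsIndicial.adjointOp_mem_degLT {p : ℕ → K[X]} {r : ℕ} {sig : ℤ} {q : K[X]}
    (h : IsIndicial p r sig q) {d : ℤ} {f : RatFunc K} (hf : f ∈ degLT K d) :
    adjointOp p r f ∈ degLT K (d + sig) := by
  rw [isIndicial_iff] at h
  obtain ⟨D, hD⟩ := exists_adjointOp_mem_degLT p r
  -- strip leading terms off `f` until the a priori bound is good enough
  have key : ∀ (k : ℕ) (d : ℤ) (f : RatFunc K), f ∈ degLT K d →
      adjointOp p r f ∈ degLT K (max (d + sig) (d - k + D)) := by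
    intro k
    induction k with
    | zero =>
      intro d f hf
      refine degLT_mono ?_ (hD d f hf)
      rw [Nat.cast_zero, sub_zero]
      exact le_max_right _ _
    | succ k ih =>
      intro d f hf
      obtain ⟨c, hc⟩ := exists_sub_C_mul_zpow_mem_degLT (d := d - 1) (by rwa [sub_add_cancel])
      have h1 := ih _ _ hc
      have h2 : adjointOp p r (RatFunc.X ^ (d - 1)) ∈ degLT K (d + sig) := by
        have := Submodule.add_mem _
          (degLT_mono (K := K) (show d - 1 + sig ≤ d + sig by omega) (h.2 (d - 1)))
          (C_mul_mem_degLT (q.eval ((d - 1 : ℤ) : K))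
            (zpow_mem_degLT (K := K) (show d - 1 + sig < d + sig by omega)))
        rwa [sub_add_cancel] at this
      rw [← sub_add_cancel f (RatFunc.C c * RatFunc.X ^ (d - 1)), map_add,
        ← RatFunc.smul_eq_C_mul, map_smul]
      rw [← RatFunc.smul_eq_C_mul] at h1
      refine Submodule.add_mem _ (degLT_mono ?_ h1)
        (Submodule.smul_mem _ _ (degLT_mono (le_max_left _ _) h2))
      push_cast
      omega
  refine degLT_mono ?_ (key (D - sig).toNat d f hf)
  omega

/-- The leading coefficient of `L* P`, for a polynomial `P`. -/
theorem IsIndicial.adjointOpPoly_sub_leading_mem {p : ℕ → K[X]} {r : ℕ} {sig : ℤ} {q : K[X]}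
    (h : IsIndicial p r sig q) (P : K[X]) :
    toRat (adjointOpPoly p r P) - RatFunc.C (P.leadingCoeff * q.eval (P.natDegree : K)) *
      RatFunc.X ^ ((P.natDegree : ℤ) + sig) ∈ degLT K (P.natDegree + sig) := by
  have h1 : toRat P.eraseLead ∈ degLT K P.natDegree := by
    rw [toRat_mem_degLT]
    by_cases h0 : P.eraseLead = 0
    · exact Or.inl h0
    · exact Or.inr (by
        have := natDegree_lt_natDegree h0 (degree_eraseLead_lt (by rintro rfl; simp at h0))
        exact_mod_cast this)
  have h2 := h.adjointOp_mem_degLT h1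
  have h3 := C_mul_mem_degLT P.leadingCoeff ((isIndicial_iff.1 h).2 P.natDegree)
  have h4 := Submodule.add_mem _ h2 h3
  convert h4 using 1
  conv_lhs => rw [← eraseLead_add_C_mul_X_pow P]
  rw [toRat_adjointOpPoly, toRat, map_add, map_add]
  change _ + adjointOp p r (toRat (C P.leadingCoeff * X ^ P.natDegree)) - _ = _
  rw [eraseLead_add_C_mul_X_pow, toRat_C_mul, map_smul, RatFunc.smul_eq_C_mul, toRat_X_pow, map_mul,
    Int.cast_natCast]
  ring

/-! ### Weak reduction of polynomials -/

theorem adjointOpPoly_add (p : ℕ → K[X]) (r : ℕ) (P P' : K[X]) :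
    adjointOpPoly p r (P + P') = adjointOpPoly p r P + adjointOpPoly p r P' := by
  simp [adjointOpPoly, sh, mul_add, Finset.sum_add_distrib]

theorem adjointOpPoly_C_mul (p : ℕ → K[X]) (r : ℕ) (c : K) (P : K[X]) :
    adjointOpPoly p r (C c * P) = C c * adjointOpPoly p r P := by
  simp only [adjointOpPoly, sh_mul, Finset.mul_sum]
  refine Finset.sum_congr rfl fun i _ => ?_
  rw [show sh (i : ℤ) (C c) = C c from taylor_C _ _]
  ring

/-- The span of the `n^s` that are not roots of the indicial polynomial. -/
def nonRootSpace (q : K[X]) : Submodule K K[X] where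
  carrier := {T | ∀ s : ℕ, T.coeff s ≠ 0 → q.eval (s : K) ≠ 0}
  zero_mem' := by simp
  add_mem' := by
    intro a b ha hb s hs
    by_cases h : a.coeff s = 0
    · exact hb s (by simpa [h] using hs)
    · exact ha s h
  smul_mem' := by
    intro c a ha s hs
    exact ha s (by rw [coeff_smul] at hs; exact right_ne_zero_of_mul hs)

/-- The polynomials without monomials that the weak reduction can eliminate. -/
def weaklyReduced (sig : ℤ) (q : K[X]) : Submodule K K[X] where
  carrier := {P | ∀ d : ℕ, sig ≤ d → q.eval (((d : ℤ) - sig : ℤ) : K) ≠ 0 → P.coeff d = 0}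
  zero_mem' := by simp
  add_mem' := by
    intro a b ha hb d hd hq
    rw [coeff_add, ha d hd hq, hb d hd hq, add_zero]
  smul_mem' := by
    intro c a ha d hd hq
    rw [coeff_smul, ha d hd hq, smul_zero]

/-- `P'` is weakly reduced and differs from `P` by an element of `L*` of the span of the `n^s` with
`q(s) ≠ 0`. -/
def weakPolyRel (p : ℕ → K[X]) (r : ℕ) (sig : ℤ) (q : K[X]) : Submodule K (K[X] × K[X]) where
  carrier := {t | t.2 ∈ weaklyReduced sig q ∧ ∃ T ∈ nonRootSpace q, t.1 - t.2 = adjointOpPoly p r T}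
  zero_mem' := ⟨Submodule.zero_mem _, 0, Submodule.zero_mem _, by
    simpa using (adjointOpPoly_C_mul p r 0 0).symm⟩
  add_mem' := by
    rintro a b ⟨ha, T, hT, haT⟩ ⟨hb, T', hT', hbT⟩
    refine ⟨Submodule.add_mem _ ha hb, T + T', Submodule.add_mem _ hT hT', ?_⟩
    rw [adjointOpPoly_add, ← haT, ← hbT, Prod.fst_add, Prod.snd_add, add_sub_add_comm]
  smul_mem' := by
    rintro c a ⟨ha, T, hT, haT⟩
    refine ⟨Submodule.smul_mem _ c ha, c • T, Submodule.smul_mem _ c hT, ?_⟩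
    rw [smul_eq_C_mul, adjointOpPoly_C_mul, ← haT, Prod.smul_fst, Prod.smul_snd, ← smul_sub,
      smul_eq_C_mul]

theorem mem_weakPolyRel {p : ℕ → K[X]} {r : ℕ} {sig : ℤ} {q P P' : K[X]} :
    (P, P') ∈ weakPolyRel p r sig q ↔
      P' ∈ weaklyReduced sig q ∧ ∃ T ∈ nonRootSpace q, P - P' = adjointOpPoly p r T := Iff.rfl

/-- The operator `L*` is injective on the span of the `n^s` with `q(s) ≠ 0`, and no image is weakly
reduced: the leading monomial `n^s` of `T` produces the monomial `n^(s+σ)` in `L* T`. -/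
theorem IsIndicial.eq_zero_of_weaklyReduced {p : ℕ → K[X]} {r : ℕ} {sig : ℤ} {q : K[X]}
    (h : IsIndicial p r sig q) {T : K[X]} (hT : T ∈ nonRootSpace q)
    (hL : adjointOpPoly p r T ∈ weaklyReduced sig q) : T = 0 := by
  by_contra hT0
  have hq := hT T.natDegree (leadingCoeff_ne_zero.2 hT0)
  have hlead := h.adjointOpPoly_sub_leading_mem T
  set c := T.leadingCoeff * q.eval (T.natDegree : K) with hc
  have hc0 : c ≠ 0 := mul_ne_zero (leadingCoeff_ne_zero.2 hT0) hq
  have hbig : toRat (adjointOpPoly p r T) ∉ degLT K (T.natDegree + sig) := fun hmem =>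
    hc0 (eq_zero_of_C_mul_zpow_mem_degLT (s := T.natDegree + sig) (by
      have := Submodule.sub_mem _ hmem hlead
      rwa [sub_sub_cancel] at this))
  refine hbig (toRat_mem_degLT_iff_coeff.2 fun k hk => ?_)
  obtain hlt | heq := hk.lt_or_eq
  · -- above the leading monomial
    have h1 : toRat (adjointOpPoly p r T) ∈ degLT K k := by
      have := Submodule.add_mem _ (degLT_mono (K := K) hk hlead)
        (C_mul_mem_degLT c (zpow_mem_degLT (K := K) hlt))
      rwa [sub_add_cancel] at this
    exact toRat_mem_degLT_iff_coeff.1 h1 k le_rfl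
  · refine hL k (by omega) ?_
    rwa [← heq, add_sub_cancel_right, Int.cast_natCast]

theorem coeff_adjointOpPoly_X_pow {p : ℕ → K[X]} {r : ℕ} {sig : ℤ} {q : K[X]}
    (h : IsIndicial p r sig q) {s d : ℕ} (hd : (s : ℤ) + sig = d) :
    (adjointOpPoly p r (X ^ s)).coeff d = q.eval (s : K) ∧
      (adjointOpPoly p r (X ^ s)).natDegree ≤ d := by
  have hlead := h.adjointOpPoly_sub_leading_mem (X ^ s)
  rw [natDegree_X_pow, leadingCoeff_X_pow, one_mul, hd, ← toRat_X_pow, ← RatFunc.smul_eq_C_mul,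
    ← toRat_C_mul, ← map_sub, toRat_mem_degLT_iff_coeff] at hlead
  refine ⟨?_, natDegree_le_iff_coeff_eq_zero.2 fun k hk => ?_⟩
  · simpa [sub_eq_zero] using hlead d le_rfl
  · simpa [coeff_X_pow, hk.ne'] using hlead k (by exact_mod_cast hk.le)

/-- The loop of the weak reduction of polynomials, on a pair `(a, P)` with `deg P < n` and `a`
weakly reduced. -/
theorem weakPoly_loop {p : ℕ → K[X]} {r : ℕ} {sig : ℤ} {q : K[X]} (h : IsIndicial p r sig q)
    (n : ℕ) : ∀ a P : K[X], P.degree < n → a ∈ weaklyReduced sig q →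
      ∃ P', P' ∈ PFun.fix (polyStep p r sig q) (a, P) ∧ (a + P, P') ∈ weakPolyRel p r sig q := by
  have hfinal : ∀ a P : K[X], ¬ (P ≠ 0 ∧ sig ≤ (P.natDegree : ℤ)) → a ∈ weaklyReduced sig q →
      ∃ P', P' ∈ PFun.fix (polyStep p r sig q) (a, P) ∧ (a + P, P') ∈ weakPolyRel p r sig q := by
    intro a P hP ha
    refine ⟨a + P, mem_fix_of_final ?_, Submodule.add_mem _ ha fun d hd _ => ?_, 0,
      Submodule.zero_mem _, ?_⟩
    · rw [polyStep, if_neg hP]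
    · by_cases hP0 : P = 0
      · rw [hP0, coeff_zero]
      · rw [not_and, not_le] at hP
        exact coeff_eq_zero_of_natDegree_lt (by have := hP hP0; omega)
    · simpa using (adjointOpPoly_C_mul p r 0 0).symm
  induction n with
  | zero =>
    intro a P hP ha
    obtain rfl : P = 0 := by simpa using hP
    exact hfinal a 0 (by simp) ha
  | succ n ih =>
    intro a P hP ha
    by_cases hgo : P ≠ 0 ∧ sig ≤ (P.natDegree : ℤ)
    swap
    · exact hfinal a P hgo ha
    have hdeg : P.natDegree ≤ n := by
      rw [degree_eq_natDegree hgo.1] at hP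
      exact Nat.lt_succ_iff.1 (by exact_mod_cast hP)
    by_cases hq : q.eval (((P.natDegree : ℤ) - sig : ℤ) : K) = 0
    · obtain ⟨P', hP', hrel⟩ := ih (a + monomial P.natDegree P.leadingCoeff) P.eraseLead
        ((degree_eraseLead_lt hgo.1).trans_le
          ((degree_eq_natDegree hgo.1).le.trans (by exact_mod_cast hdeg)))
        (Submodule.add_mem _ ha fun d _ hdq => by
          rw [coeff_monomial, if_neg]
          rintro rfl
          exact hdq hq)
      refine ⟨P', mem_fix_of_step ?_ hP', ?_⟩
      · simp only [polyStep]
        rw [if_pos hgo, if_pos hq]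
      · rwa [add_assoc, add_comm (monomial _ _), eraseLead_add_monomial_natDegree_leadingCoeff]
          at hrel
    · set s := ((P.natDegree : ℤ) - sig).toNat with hs
      have hsd : (s : ℤ) = (P.natDegree : ℤ) - sig := Int.toNat_of_nonneg (by omega)
      set c := P.leadingCoeff / q.eval (((P.natDegree : ℤ) - sig : ℤ) : K) with hc
      obtain ⟨hcoeff, hle⟩ := coeff_adjointOpPoly_X_pow h (s := s) (d := P.natDegree) (by omega)
      rw [← Int.cast_natCast s, hsd] at hcoeff
      obtain ⟨P', hP', hPr, T, hT, hrel⟩ := ih a (P - C c * adjointOpPoly p r (X ^ s)) (by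
        rw [degree_lt_iff_coeff_zero]
        intro k hk
        rcases (hdeg.trans hk).eq_or_lt with rfl | hk
        · rw [coeff_sub, coeff_C_mul, hcoeff, hc, div_mul_cancel₀ _ hq, sub_eq_zero]; rfl
        · rw [coeff_sub, coeff_C_mul, coeff_eq_zero_of_natDegree_lt hk,
            coeff_eq_zero_of_natDegree_lt (hle.trans_lt hk), mul_zero, sub_zero]) ha
      refine ⟨P', mem_fix_of_step ?_ hP', hPr, T + C c * X ^ s, Submodule.add_mem _ hT ?_, ?_⟩
      · simp only [polyStep]
        rw [if_pos hgo, if_neg hq]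
      · intro k hk
        obtain rfl : k = s := by
          by_contra hne
          simp [coeff_X_pow, hne] at hk
        rwa [← Int.cast_natCast s, hsd]
      · rw [adjointOpPoly_add, adjointOpPoly_C_mul, ← hrel]
        ring

/-- The weak reduction of polynomials terminates and computes a linear map. -/
theorem exists_weakPoly {p : ℕ → K[X]} {r : ℕ} {sig : ℤ} {q : K[X]} (h : IsIndicial p r sig q) :
    ∃ φ : K[X] →ₗ[K] K[X], ∀ P, weakPoly p r sig q P = Part.some (φ P) ∧
      ∀ P', (P, P') ∈ weakPolyRel p r sig q ↔ φ P = P' := by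
  refine exists_linearMap_of_rel _ _ (fun P => ?_) ?_
  · obtain ⟨P', h1, h2⟩ := weakPoly_loop h (P.natDegree + 1) 0 P
      (degree_le_natDegree.trans_lt (by exact_mod_cast P.natDegree.lt_succ_self))
      (Submodule.zero_mem _)
    exact ⟨P', Part.eq_some_iff.2 h1, by rwa [zero_add] at h2⟩
  · rintro P' ⟨hP', T, hT, hrel⟩
    simp only [zero_sub] at hrel hP'
    have hT0 := h.eq_zero_of_weaklyReduced hT (hrel ▸ Submodule.neg_mem _ hP')
    rw [hT0] at hrel
    simpa [adjointOpPoly, sh_zero_right] using hrel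

/-! ### Poles -/

/-- The rational functions without poles at the zeros of `F`. -/
def regularAt (F : K[X]) : Subalgebra K (RatFunc K) where
  carrier := {R | IsCoprime F R.denom}
  mul_mem' := fun {R R'} h h' =>
    IsCoprime.of_isCoprime_of_dvd_right (IsCoprime.mul_right h h') (RatFunc.denom_mul_dvd R R')
  add_mem' := fun {R R'} h h' =>
    IsCoprime.of_isCoprime_of_dvd_right (IsCoprime.mul_right h h') (RatFunc.denom_add_dvd R R')
  algebraMap_mem' := fun c => by
    change IsCoprime F (algebraMap K (RatFunc K) c).denom
    rw [RatFunc.algebraMap_eq_C, RatFunc.denom_C]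
    exact isCoprime_one_right

theorem not_hasPoleAt {Q : K[X]} {R : RatFunc K} {j : ℤ} :
    ¬ HasPoleAt Q R j ↔ R ∈ regularAt (sh j Q) := not_not

theorem div_mem_regularAt {F b : K[X]} (a : K[X]) (h : IsCoprime F b) :
    toRat a / toRat b ∈ regularAt F :=
  IsCoprime.of_isCoprime_of_dvd_right h (RatFunc.denom_div_dvd a b)

theorem div_pow_mem_regularAt {F G : K[X]} (a : K[X]) (s : ℕ) (h : IsCoprime F G) :
    toRat a / toRat G ^ s ∈ regularAt F := by
  have := div_mem_regularAt a (h.pow_right (n := s))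
  rwa [toRat_pow] at this

theorem toRat_mem_regularAt (F P : K[X]) : toRat P ∈ regularAt F := by
  simpa [toRat] using div_mem_regularAt (F := F) P isCoprime_one_right

theorem exists_toRat_of_denom_isUnit {R : RatFunc K} (h : IsUnit R.denom) : R = toRat R.num := by
  have := RatFunc.num_div_denom R
  rw [(RatFunc.monic_denom R).eq_one_of_isUnit h, map_one, div_one] at this
  exact this.symm

/-- A fraction `A / F^s` without poles at the zeros of `F` is a polynomial. -/
theorem pow_dvd_of_div_mem_regularAt {F A : K[X]} (hF : F ≠ 0) {s : ℕ}
    (h : toRat A / toRat F ^ s ∈ regularAt F) : F ^ s ∣ A := by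
  set R := toRat A / toRat F ^ s with hR
  have hdvd : R.denom ∣ F ^ s := by
    rw [hR, toRat, toRat, ← map_pow]
    exact RatFunc.denom_div_dvd _ _
  have hunit : IsUnit R.denom := (IsCoprime.pow_left (m := s) h).isUnit_of_dvd' hdvd dvd_rfl
  have h1 := exists_toRat_of_denom_isUnit hunit
  refine ⟨R.num, toRat_injective ?_⟩
  rw [toRat, toRat, map_mul, map_pow]
  change toRat A = toRat F ^ s * toRat R.num
  rw [← h1, hR, mul_div_cancel₀ _ (pow_ne_zero _ (toRat_ne_zero hF))]

theorem degree_pow_eq {F : K[X]} (hF : F ≠ 0) (s : ℕ) :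
    (F ^ s).degree = ((s * F.natDegree : ℕ) : WithBot ℕ) := by
  rw [degree_pow, degree_eq_natDegree hF, nsmul_eq_mul, ← Nat.cast_mul]

theorem degree_mod_pow_lt {F : K[X]} (hF : F ≠ 0) (P : K[X]) (s : ℕ) :
    (P % F ^ s).degree < ((s * F.natDegree : ℕ) : WithBot ℕ) :=
  (EuclideanDomain.mod_lt P (pow_ne_zero s hF)).trans_eq (degree_pow_eq hF s)

theorem eq_zero_of_div_mem_regularAt {F A : K[X]} {s : ℕ}
    (hA : A.degree < ((s * F.natDegree : ℕ) : WithBot ℕ))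
    (hF : F ≠ 0) (h : toRat A / toRat F ^ s ∈ regularAt F) : A = 0 := by
  refine eq_zero_of_dvd_of_degree_lt (pow_dvd_of_div_mem_regularAt hF h) ?_
  rwa [degree_pow_eq hF]

theorem mem_regularAt_of_mul_mem {F c : K[X]} {R : RatFunc K} (hF : 0 < F.natDegree)
    (hc : IsCoprime F c) (h : toRat c * R ∈ regularAt F) : R ∈ regularAt F := by
  have hc0 : c ≠ 0 := by
    rintro rfl
    have := isCoprime_zero_right.1 hc
    exact hF.ne' (natDegree_eq_zero_of_isUnit this)
  have h1 : toRat 1 / toRat c ∈ regularAt F := div_mem_regularAt 1 hc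
  have h2 := mul_mem h1 h
  rwa [toRat, map_one, one_div, inv_mul_cancel_left₀ (toRat_ne_zero hc0)] at h2

theorem shiftRat_mem_regularAt {Q : K[X]} {R : RatFunc K} {j : ℤ} (h : R ∈ regularAt (sh j Q))
    (i : ℤ) : shiftRat i R ∈ regularAt (sh (i + j) Q) := by
  rw [← RatFunc.num_div_denom R, map_div₀, ← sh_sh]
  change shiftRat i (toRat R.num) / shiftRat i (toRat R.denom) ∈ _
  rw [shiftRat_toRat, shiftRat_toRat]
  exact div_mem_regularAt _ (isCoprime_sh h i)

/-- Every nonzero polynomial divides the product of a power of `F` and a polynomial prime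
to `F`. -/
theorem exists_dvd_pow_mul_of_coprime (F : K[X]) {D : K[X]} (hD : D ≠ 0) :
    ∃ (s : ℕ) (b : K[X]), b ≠ 0 ∧ IsCoprime F b ∧ D ∣ F ^ s * b := by
  induction D using WfDvdMonoid.induction_on_irreducible with
  | zero => exact absurd rfl hD
  | unit u hu => exact ⟨0, 1, one_ne_zero, isCoprime_one_right, by simpa using hu.dvd⟩
  | mul a g ha hg ih =>
    obtain ⟨s, b, hb0, hb, hdvd⟩ := ih ha
    by_cases hgF : g ∣ F
    · refine ⟨s + 1, b, hb0, hb, ?_⟩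
      rw [pow_succ', mul_assoc]
      exact mul_dvd_mul hgF hdvd
    · refine ⟨s, g * b, mul_ne_zero hg.ne_zero hb0,
        IsCoprime.mul_right ((hg.coprime_iff_not_dvd).2 hgF).symm hb, ?_⟩
      rw [mul_left_comm]
      exact mul_dvd_mul_left g hdvd

theorem exists_pow_mul_mem_regularAt (F : K[X]) (R : RatFunc K) :
    ∃ s : ℕ, toRat F ^ s * R ∈ regularAt F := by
  by_cases hF : F = 0
  · exact ⟨1, by simp [hF, zero_mem]⟩
  obtain ⟨s, b, hb0, hb, u, hu⟩ := exists_dvd_pow_mul_of_coprime F R.denom_ne_zero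
  refine ⟨s, ?_⟩
  have hu0 : toRat u ≠ 0 := toRat_ne_zero (by
    rintro rfl; exact mul_ne_zero (pow_ne_zero _ hF) hb0 (by simpa using hu))
  have hu' := congrArg toRat hu
  have : toRat F ^ s * R = toRat (R.num * u) / toRat b := by
    conv_lhs => rw [← RatFunc.num_div_denom R]
    have hd := toRat_ne_zero R.denom_ne_zero
    have hb' := toRat_ne_zero hb0
    simp only [toRat, map_mul, map_pow] at hu' hd hb' ⊢
    field_simp
    linear_combination (algebraMap K[X] (RatFunc K) R.num) * hu'
  rw [this]
  exact div_mem_regularAt _ hb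

theorem exists_polarPart {F : K[X]} (hF : F ≠ 0) {R : RatFunc K} {s : ℕ}
    (h : toRat F ^ s * R ∈ regularAt F) :
    ∃ lam : K[X], lam.degree < ((s * F.natDegree : ℕ) : WithBot ℕ) ∧
      R - toRat lam / toRat F ^ s ∈ regularAt F := by
  have hF' := toRat_ne_zero hF
  set T := toRat F ^ s * R with hT
  obtain ⟨u, v, huv⟩ := IsCoprime.pow_left (m := s) h
  refine ⟨(T.num * v) % F ^ s, degree_mod_pow_lt hF _ _, ?_⟩
  have key : R - toRat ((T.num * v) % F ^ s) / toRat F ^ s =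
      toRat u * T + toRat (T.num * v / F ^ s) := by
    have hR : R = T / toRat F ^ s := by rw [hT, mul_div_cancel_left₀ _ (pow_ne_zero s hF')]
    have hTd : T * toRat T.denom = toRat T.num := by
      rw [← eq_div_iff (toRat_ne_zero T.denom_ne_zero)]
      exact (RatFunc.num_div_denom T).symm
    have h1 := congrArg toRat huv
    have h2 := congrArg toRat (EuclideanDomain.div_add_mod (T.num * v) (F ^ s))
    simp only [toRat_add, toRat_mul, toRat_pow, toRat_one] at h1 h2 ⊢
    rw [hR]
    field_simp
    linear_combination (-T) * h1 - h2 + toRat v * hTd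
  rw [key]
  exact add_mem (mul_mem (toRat_mem_regularAt F u) h) (toRat_mem_regularAt F _)

theorem poleOrder_spec (Q : K[X]) (R : RatFunc K) (j : ℤ) :
    toRat (sh j Q) ^ poleOrder Q R j * R ∈ regularAt (sh j Q) :=
  not_hasPoleAt.1 (Nat.sInf_mem (s := {s | ¬ HasPoleAt Q (toRat (sh j Q) ^ s * R) j})
    (by obtain ⟨s, hs⟩ := exists_pow_mul_mem_regularAt (sh j Q) R
        exact ⟨s, not_hasPoleAt.2 hs⟩))

/-- The cofactor `P / Q(n-j)^{ord_j(P)}` is prime to `Q(n-j)`, for all `j`. -/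
def CofactorCoprime (Q P : K[X]) : Prop :=
  ∀ j : ℤ, IsCoprime (sh j Q) (P / sh j Q ^ ord Q P j)

theorem pow_ord_mul_cofactor {Q : K[X]} (P : K[X]) {j : ℤ} (hQ : sh j Q ≠ 0) :
    sh j Q ^ ord Q P j * (P / sh j Q ^ ord Q P j) = P :=
  EuclideanDomain.mul_div_cancel' (pow_ne_zero _ hQ) (pow_multiplicity_dvd _ _)

/-- The equation solved in a step of the weak reduction is uniquely solvable, and its solution
removes the poles at the zeros of `Q(n-j)`. -/
theorem bezoutNumerator_spec {Q P : K[X]} (hQ : 0 < Q.natDegree) (hP : CofactorCoprime Q P)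
    (R : RatFunc K) (j : ℤ) :
    ∃ A : K[X], bezoutNumerator Q P R j = Part.some A ∧
      A.degree < ((poleOrder Q R j * Q.natDegree : ℕ) : WithBot ℕ) ∧
      R - toRat P * (toRat A / toRat (sh j Q) ^ (poleOrder Q R j + ord Q P j)) ∈
        regularAt (sh j Q) := by
  set s := poleOrder Q R j with hs
  set e := ord Q P j with he
  have hc := hP j
  have hF0 : sh j Q ≠ 0 := by
    intro h
    rw [← natDegree_sh j, h, natDegree_zero] at hQ
    exact hQ.false
  have hPc := pow_ord_mul_cofactor P hF0
  rw [← he] at hc hPc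
  set F := sh j Q with hF
  set c := P / F ^ e with hcdef
  have hdegF : F.natDegree = Q.natDegree := natDegree_sh j Q
  obtain ⟨lam, hlam, hlamR⟩ := exists_polarPart hF0 (poleOrder_spec Q R j)
  rw [← hs, hdegF] at hlam
  rw [← hs] at hlamR
  have h1 : theUnique (IsPolarPart Q R j s) = Part.some lam := by
    refine theUnique_eq_some ⟨hlam, not_hasPoleAt.2 hlamR⟩ fun lam' h' => ?_
    rw [← sub_eq_zero]
    refine eq_zero_of_div_mem_regularAt (F := F) (s := s) ?_ hF0 ?_
    · rw [hdegF]
      exact (degree_sub_le _ _).trans_lt (max_lt h'.1 hlam)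
    · have := sub_mem hlamR (not_hasPoleAt.1 h'.2)
      rwa [sub_sub_sub_cancel_left, ← sub_div, ← toRat_sub] at this
  have hcop : IsCoprime (F ^ s) (c % F ^ s) := by
    have : IsCoprime (F ^ s) c := hc.pow_left
    rwa [← EuclideanDomain.mod_add_div c (F ^ s), IsCoprime.add_mul_left_right_iff] at this
  obtain ⟨y, x, hxy⟩ := hcop
  set A := (lam * x) % F ^ s with hA
  have hAB : lam = A * (c % F ^ s) + (lam * y + (lam * x) / F ^ s * (c % F ^ s)) * F ^ s := by
    linear_combination (-lam) * hxy +
      (-(c % F ^ s)) * EuclideanDomain.div_add_mod (lam * x) (F ^ s)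
  have hAdeg : A.degree < ((s * Q.natDegree : ℕ) : WithBot ℕ) := by
    rw [← hdegF]; exact degree_mod_pow_lt hF0 _ _
  refine ⟨A, ?_, hAdeg, ?_⟩
  · rw [bezoutNumerator, ← hs, ← he, ← hF, ← hcdef]
    rw [h1, Part.bind_some]
    refine theUnique_eq_some ⟨hAdeg, _, hAB⟩ ?_
    rintro A' ⟨hA'deg, B', hB'⟩
    rw [← sub_eq_zero]
    have hdvd : F ^ s ∣ (A' - A) * (c % F ^ s) :=
      ⟨(lam * y + (lam * x) / F ^ s * (c % F ^ s)) - B', by linear_combination hAB - hB'⟩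
    refine eq_zero_of_dvd_of_degree_lt (IsCoprime.dvd_of_dvd_mul_right ⟨y, x, hxy⟩ hdvd) ?_
    rw [degree_pow_eq hF0, hdegF]
    exact (degree_sub_le _ _).trans_lt (max_lt hA'deg hAdeg)
  · obtain ⟨B, hB⟩ : ∃ B, lam - c * A = F ^ s * B :=
      ⟨lam * y + (lam * x) / F ^ s * (c % F ^ s) - A * (c / F ^ s), by
        linear_combination hAB + A * EuclideanDomain.div_add_mod c (F ^ s)⟩
    have key : R - toRat P * (toRat A / toRat F ^ (s + e)) =
        (R - toRat lam / toRat F ^ s) + toRat B := by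
      have hF' := toRat_ne_zero hF0
      have h2 := congrArg toRat hB
      have h3 := congrArg toRat hPc
      simp only [toRat_sub, toRat_mul, toRat_pow] at h2 h3
      rw [← h3, pow_add]
      field_simp
      linear_combination h2
    rw [key]
    exact add_mem hlamR (toRat_mem_regularAt F B)

/-- `Q` is nonconstant and its integer shifts are pairwise coprime. -/
structure ShiftCoprime (Q : K[X]) : Prop where
  natDegree_pos : 0 < Q.natDegree
  coprime : ∀ j k : ℤ, j ≠ k → IsCoprime (sh j Q) (sh k Q)

theorem ShiftCoprime.sh_ne_zero {Q : K[X]} (hQ : ShiftCoprime Q) (j : ℤ) : sh j Q ≠ 0 := by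
  rw [Ne, sh_eq_zero]
  rintro rfl
  exact hQ.natDegree_pos.ne' natDegree_zero

theorem ShiftCoprime.not_isUnit {Q : K[X]} (hQ : ShiftCoprime Q) (j : ℤ) : ¬ IsUnit (sh j Q) :=
  fun h => hQ.natDegree_pos.ne' (by rw [← natDegree_sh j]; exact natDegree_eq_zero_of_isUnit h)

theorem ShiftCoprime.finite_not_isCoprime {Q : K[X]} (hQ : ShiftCoprime Q) {D : K[X]}
    (hD : D ≠ 0) : {j : ℤ | ¬ IsCoprime (sh j Q) D}.Finite := by
  classical
  have hex : ∀ j ∈ {j : ℤ | ¬ IsCoprime (sh j Q) D}, ∃ g : K[X],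
      g ∈ UniqueFactorizationMonoid.normalizedFactors D ∧ Irreducible g ∧ g ∣ sh j Q := by
    intro j hj
    obtain ⟨g, hg, h1, h2⟩ : ∃ g, Irreducible g ∧ g ∣ sh j Q ∧ g ∣ D := by
      by_contra! h
      exact hj (isCoprime_of_irreducible_dvd (fun h0 => hD h0.2) fun z hz h1 h2 => h z hz h1 h2)
    obtain ⟨g', hg', hassoc⟩ :=
      UniqueFactorizationMonoid.exists_mem_normalizedFactors_of_dvd hD hg h2
    exact ⟨g', hg', hassoc.irreducible hg, hassoc.symm.dvd.trans h1⟩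
  choose! g hg1 hg2 hg3 using hex
  refine Set.Finite.of_finite_image (f := g)
    ((UniqueFactorizationMonoid.normalizedFactors D).toFinset.finite_toSet.subset ?_) ?_
  · rintro _ ⟨j, hj, rfl⟩
    exact Multiset.mem_toFinset.2 (hg1 j hj)
  · intro j hj k hk hjk
    by_contra hne
    exact (hg2 j hj).not_isUnit ((hQ.coprime j k hne).isUnit_of_dvd' (hg3 j hj)
      (hjk ▸ hg3 k hk))

theorem ShiftCoprime.finite_poles {Q : K[X]} (hQ : ShiftCoprime Q) (R : RatFunc K) :
    {j : ℤ | R ∉ regularAt (sh j Q)}.Finite :=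
  hQ.finite_not_isCoprime R.denom_ne_zero

theorem ShiftCoprime.cofactorCoprime_of_isRefined {Q P : K[X]} (hQ : ShiftCoprime Q)
    (h : IsRefined Q P) : CofactorCoprime Q P := by
  classical
  intro j
  obtain ⟨l, hl⟩ := h (-j)
  rw [neg_neg] at hl
  have hF0 := hQ.sh_ne_zero j
  have hFu := hQ.not_isUnit j
  set F := sh j Q with hF
  have hdvd : F ^ l ∣ P := hl.symm.dvd.trans (EuclideanDomain.gcd_dvd_left _ _)
  have hndvd : ¬ F ^ (l + 1) ∣ P := fun h' => by
    have h1 : F ^ (l + 1) ∣ F ^ l := (EuclideanDomain.dvd_gcd h' dvd_rfl).trans hl.dvd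
    have := (pow_dvd_pow_iff hF0 hFu).1 h1
    omega
  have hord : ord Q P j = l := multiplicity_eq_of_dvd_of_not_dvd hdvd hndvd
  rw [hord]
  obtain ⟨c, hc⟩ := hdvd
  have hcP : P / F ^ l = c := by
    rw [hc, mul_div_cancel_left₀ _ (pow_ne_zero l hF0)]
  rw [hcP]
  refine isCoprime_of_dvd _ _ (fun h' => hF0 h'.1) fun z hz _ hzF hzc => hz ?_
  have h1 : z * F ^ l ∣ F ^ l := (EuclideanDomain.dvd_gcd
    (by rw [hc, mul_comm]; exact mul_dvd_mul_left _ hzc)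
    (by rw [pow_succ, mul_comm]; exact mul_dvd_mul_left _ hzF)).trans hl.dvd
  obtain ⟨w, hw⟩ := h1
  exact IsUnit.of_mul_eq_one w (mul_right_cancel₀ (pow_ne_zero l hF0) (by linear_combination -hw))

theorem ord_eq_zero_of_isCoprime {Q P : K[X]} (hQ : ShiftCoprime Q) {j : ℤ}
    (h : IsCoprime (sh j Q) P) : ord Q P j = 0 :=
  multiplicity_eq_zero.2 fun hdvd => hQ.not_isUnit j (h.isUnit_of_dvd' dvd_rfl hdvd)

theorem cofactorCoprime_of_isCoprime {Q P : K[X]} (hQ : ShiftCoprime Q)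
    (h : ∀ j, IsCoprime (sh j Q) P) : CofactorCoprime Q P := fun j => by
  rw [ord_eq_zero_of_isCoprime hQ (h j), pow_zero, EuclideanDomain.div_one]
  exact h j

/-! ### Weak reduction of poles -/

theorem degree_mul_pow_lt {Q A : K[X]} {j : ℤ} {s : ℕ}
    (hA : A.degree < ((s * Q.natDegree : ℕ) : WithBot ℕ)) (k : ℕ) :
    (A * sh j Q ^ k).degree < (((s + k) * Q.natDegree : ℕ) : WithBot ℕ) := by
  by_cases hA0 : A = 0
  · rw [hA0, zero_mul, degree_zero]
    exact WithBot.bot_lt_coe _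
  have h1 : A.natDegree < s * Q.natDegree := by
    rw [degree_eq_natDegree hA0] at hA
    exact_mod_cast hA
  refine degree_le_natDegree.trans_lt (Nat.cast_lt.2 ((natDegree_mul_le).trans_lt ?_))
  have h2 := natDegree_pow_le (p := sh j Q) (n := k)
  rw [natDegree_sh] at h2
  rw [add_mul]
  omega

/-- The fractions `A / Q(n-j)^(s+e)` with `deg A < s deg Q`: they are spanned by the
`n^l / Q(n-j)^k` with `l < deg Q` and `k > e`. -/
def polarAt (Q : K[X]) (j : ℤ) (e : ℕ) : Submodule K (RatFunc K) where
  carrier := {T | ∃ (s : ℕ) (A : K[X]), A.degree < ((s * Q.natDegree : ℕ) : WithBot ℕ) ∧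
    T = toRat A / toRat (sh j Q) ^ (s + e)}
  zero_mem' := ⟨0, 0, by simp, by simp⟩
  add_mem' := by
    rintro _ _ ⟨s, A, hA, rfl⟩ ⟨s', A', hA', rfl⟩
    refine ⟨s + s', A * sh j Q ^ s' + A' * sh j Q ^ s,
      (degree_add_le _ _).trans_lt (max_lt (degree_mul_pow_lt hA _) ?_), ?_⟩
    · rw [add_comm s s']
      exact degree_mul_pow_lt hA' _
    · by_cases hF : sh j Q = 0
      · obtain rfl : Q = 0 := sh_eq_zero.1 hF
        have h0 : ∀ {B : K[X]} {s : ℕ},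
            B.degree < ((s * (0 : K[X]).natDegree : ℕ) : WithBot ℕ) → B = 0 := fun hB => by
          simpa using hB
        simp [h0 hA, h0 hA']
      · have hF' := toRat_ne_zero hF
        rw [toRat_add, toRat_mul, toRat_mul, toRat_pow, toRat_pow]
        field_simp
        ring
  smul_mem' := by
    rintro c _ ⟨s, A, hA, rfl⟩
    exact ⟨s, c • A, (degree_smul_le _ _).trans_lt hA, by
      rw [smul_eq_C_mul, toRat_C_mul, smul_div_assoc]⟩

theorem div_mem_polarAt {Q A : K[X]} (j : ℤ) {s : ℕ} (e : ℕ)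
    (hA : A.degree < ((s * Q.natDegree : ℕ) : WithBot ℕ)) :
    toRat A / toRat (sh j Q) ^ (s + e) ∈ polarAt Q j e := ⟨s, A, hA, rfl⟩

theorem div_pow_mem_polarSpace {Q A : K[X]} (j : ℤ) {s : ℕ}
    (hA : A.degree < ((s * Q.natDegree : ℕ) : WithBot ℕ)) :
    toRat A / toRat (sh j Q) ^ s ∈ polarSpace Q := by
  rcases Nat.eq_zero_or_pos s with rfl | hs
  · obtain rfl : A = 0 := by simpa using hA
    simp
  rw [A.as_sum_range_C_mul_X_pow, toRat, map_sum, Finset.sum_div]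
  refine Submodule.sum_mem _ fun l hl => ?_
  change toRat (C (A.coeff l) * X ^ l) / _ ∈ _
  rw [toRat_C_mul, smul_div_assoc]
  by_cases hA0 : A = 0
  · simp [hA0]
  refine Submodule.smul_mem _ _ (Submodule.subset_span ⟨-j, s, l, hs, ?_, by rw [neg_neg]⟩)
  rw [degree_eq_natDegree hA0] at hA
  exact (Nat.lt_succ_iff.1 (Finset.mem_range.1 hl)).trans_lt (by exact_mod_cast hA)

theorem polarAt_le_polarSpace (Q : K[X]) (j : ℤ) (e : ℕ) : polarAt Q j e ≤ polarSpace Q := by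
  rintro _ ⟨s, A, hA, rfl⟩
  refine div_pow_mem_polarSpace j (hA.trans_le ?_)
  exact_mod_cast Nat.mul_le_mul_right _ (Nat.le_add_right s e)

theorem polarSpace_eq_iSup (Q : K[X]) : polarSpace Q = ⨆ j, polarAt Q j 0 := by
  refine le_antisymm (Submodule.span_le.2 ?_) (iSup_le fun j => polarAt_le_polarSpace Q j 0)
  rintro _ ⟨h, s, l, -, hl, rfl⟩
  refine Submodule.mem_iSup_of_mem (-h) (div_mem_polarAt (-h) 0 ?_)
  exact (degree_X_pow_le l).trans_lt (by exact_mod_cast hl)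

theorem mem_regularAt_of_mem_polarAt {Q F : K[X]} {j : ℤ} {e : ℕ} {T : RatFunc K}
    (hT : T ∈ polarAt Q j e) (h : IsCoprime F (sh j Q)) : T ∈ regularAt F := by
  obtain ⟨s, A, -, rfl⟩ := hT
  exact div_pow_mem_regularAt A _ h

theorem mem_regularAt_of_mem_polarSpace {Q F : K[X]} {T : RatFunc K}
    (hT : T ∈ polarSpace Q) (h : ∀ j, IsCoprime F (sh j Q)) : T ∈ regularAt F := by
  have : polarSpace Q ≤ Subalgebra.toSubmodule (regularAt F) := by
    rw [polarSpace_eq_iSup]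
    exact iSup_le fun j T hT => mem_regularAt_of_mem_polarAt hT (h j)
  exact this hT

/-- If `Q(n-j)^e` is the part of `P` at the zeros of `Q(n-j)`, multiplication by `P` does not
remove the poles of a nonzero element of `polarAt Q j e`. -/
theorem eq_zero_of_mem_polarAt {Q P c : K[X]} (hQ : ShiftCoprime Q) {j : ℤ} {e : ℕ} {T : RatFunc K}
    (hT : T ∈ polarAt Q j e) (hP : P = sh j Q ^ e * c) (hc : IsCoprime (sh j Q) c)
    (h : toRat P * T ∈ regularAt (sh j Q)) : T = 0 := by
  obtain ⟨s, A, hA, rfl⟩ := hT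
  have hF := hQ.sh_ne_zero j
  have hF' := toRat_ne_zero hF
  have heq : toRat P * (toRat A / toRat (sh j Q) ^ (s + e)) =
      toRat c * (toRat A / toRat (sh j Q) ^ s) := by
    rw [hP, toRat_mul, toRat_pow, pow_add]
    field_simp
  rw [heq] at h
  have h' := mem_regularAt_of_mul_mem (by rw [natDegree_sh]; exact hQ.natDegree_pos) hc h
  rw [eq_zero_of_div_mem_regularAt (by rwa [natDegree_sh]) hF h', toRat_zero, zero_div]

theorem sum_sub_mem_regularAt {Q : K[X]} {e : ℤ → ℕ} {f : ℤ →₀ RatFunc K} (hQ : ShiftCoprime Q)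
    (hf : ∀ j, f j ∈ polarAt Q j (e j)) (j : ℤ) :
    (f.sum fun _ x => x) - f j ∈ regularAt (sh j Q) := by
  classical
  have h : (f.sum fun _ x => x) - f j = ∑ k ∈ f.support.erase j, f k := by
    by_cases hj : j ∈ f.support
    · rw [Finsupp.sum, ← Finset.add_sum_erase _ _ hj, add_sub_cancel_left]
    · rw [Finset.erase_eq_of_notMem hj, Finsupp.notMem_support_iff.1 hj, sub_zero, Finsupp.sum]
  rw [h]
  exact sum_mem fun k hk => mem_regularAt_of_mem_polarAt (hf k)
    (hQ.coprime j k (Finset.ne_of_mem_erase hk).symm)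

theorem mem_regularAt_of_mem_iSup {Q P c : K[X]} (hQ : ShiftCoprime Q) {e : ℤ → ℕ} {T : RatFunc K}
    (hT : T ∈ ⨆ j, polarAt Q j (e j)) {j : ℤ} (hP : P = sh j Q ^ e j * c)
    (hc : IsCoprime (sh j Q) c) (h : toRat P * T ∈ regularAt (sh j Q)) :
    T ∈ regularAt (sh j Q) := by
  obtain ⟨f, hf, rfl⟩ := (Submodule.mem_iSup_iff_exists_finsupp _ _).1 hT
  have h1 := sum_sub_mem_regularAt hQ hf j
  have h2 := mul_mem (toRat_mem_regularAt (sh j Q) P) h1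
  have h3 : toRat P * f j ∈ regularAt (sh j Q) := by
    have := sub_mem h h2
    rwa [← mul_sub, sub_sub_cancel] at this
  rwa [eq_zero_of_mem_polarAt hQ (hf j) hP hc h3, sub_zero] at h1

theorem eq_zero_of_mem_polarSpace {Q : K[X]} (hQ : ShiftCoprime Q) {T : RatFunc K}
    (hT : T ∈ polarSpace Q) (h : ∀ j, T ∈ regularAt (sh j Q)) : T = 0 := by
  rw [polarSpace_eq_iSup] at hT
  obtain ⟨f, hf, rfl⟩ := (Submodule.mem_iSup_iff_exists_finsupp _ _).1 hT
  have hf0 : f = 0 := by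
    ext1 j
    have h1 := sub_mem (h j) (sum_sub_mem_regularAt hQ hf j)
    rw [sub_sub_cancel] at h1
    exact eq_zero_of_mem_polarAt (P := 1) (c := 1) hQ (hf j) (by simp) isCoprime_one_right
      (by rwa [toRat_one, one_mul])
  simp [hf0]

theorem adjointOp_mem_regularAt {p : ℕ → K[X]} {r : ℕ} {Q : K[X]} {T : RatFunc K} {k : ℤ}
    (h : ∀ i : ℕ, i ≤ r → T ∈ regularAt (sh (k - i) Q)) :
    adjointOp p r T ∈ regularAt (sh k Q) := by
  rw [adjointOp_apply]
  refine sum_mem fun i hi => mul_mem (toRat_mem_regularAt _ _) ?_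
  have := shiftRat_mem_regularAt (h i (Nat.lt_succ_iff.1 (Finset.mem_range.1 hi))) i
  rwa [add_sub_cancel] at this

/-- At the leftmost poles of `T`, only the term `p_0 T` of `L* T` contributes. -/
theorem adjointOp_sub_low_mem_regularAt {p : ℕ → K[X]} {r : ℕ} {Q : K[X]} {T : RatFunc K} {k : ℤ}
    (h : ∀ i : ℤ, i < k → T ∈ regularAt (sh i Q)) :
    adjointOp p r T - toRat (p 0) * T ∈ regularAt (sh k Q) := by
  rw [adjointOp_apply, Finset.sum_range_succ', Nat.cast_zero, shiftRat_zero, add_sub_cancel_right]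
  refine sum_mem fun i _ => mul_mem (toRat_mem_regularAt _ _) ?_
  have := shiftRat_mem_regularAt (h (k - (i + 1 : ℕ)) (by omega)) (i + 1 : ℕ)
  rwa [add_sub_cancel] at this

/-- At the rightmost poles of `T`, shifted by `r`, only the term `p_r S_n^{-r} T` of `L* T`
contributes. -/
theorem adjointOp_sub_high_mem_regularAt {p : ℕ → K[X]} {r : ℕ} {Q : K[X]} {T : RatFunc K} {k : ℤ}
    (h : ∀ i : ℤ, k < i → T ∈ regularAt (sh i Q)) :
    adjointOp p r T - toRat (p r) * shiftRat r T ∈ regularAt (sh (k + r) Q) := by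
  rw [adjointOp_apply, Finset.sum_range_succ, add_sub_cancel_right]
  refine sum_mem fun i hi => mul_mem (toRat_mem_regularAt _ _) ?_
  have hi := Finset.mem_range.1 hi
  have := shiftRat_mem_regularAt (h (k + r - i) (by omega)) i
  rwa [add_sub_cancel] at this

/-- The orders up to which the poles at the zeros of `Q(n-j)` are cancelled by the extreme
coefficients of `L*`. -/
def cancelOrder (p : ℕ → K[X]) (r : ℕ) (Q : K[X]) (j : ℤ) : ℕ :=
  if j < 0 then ord Q (p 0) j else ord Q (p r) (j + r)

/-- The space of the fractions that are used by the weak reduction of poles. -/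
def reducerSpace (p : ℕ → K[X]) (r : ℕ) (Q : K[X]) : Submodule K (RatFunc K) :=
  ⨆ j, polarAt Q j (cancelOrder p r Q j)

theorem reducerSpace_le_polarSpace (p : ℕ → K[X]) (r : ℕ) (Q : K[X]) :
    reducerSpace p r Q ≤ polarSpace Q := iSup_le fun j => polarAt_le_polarSpace Q j _

/-- The rational functions whose poles at the zeros of shifts of `Q` are at the zeros of
`Q(n), …, Q(n-r+1)`. -/
def polarReduced (r : ℕ) (Q : K[X]) : Submodule K (RatFunc K) :=
  ⨅ j : {j : ℤ // j < 0 ∨ (r : ℤ) ≤ j}, Subalgebra.toSubmodule (regularAt (sh j Q))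

theorem mem_polarReduced {r : ℕ} {Q : K[X]} {R : RatFunc K} :
    R ∈ polarReduced r Q ↔ ∀ j : ℤ, j < 0 ∨ (r : ℤ) ≤ j → R ∈ regularAt (sh j Q) := by
  simp [polarReduced, Submodule.mem_iInf]

/-- No element of `L*` of the reducer space is reduced, except `0`: the leftmost poles of `T` at
negative indices survive in `p_0 T`, and its rightmost poles at other indices survive, shifted
by `r`, in `p_r S_n^{-r} T`. -/
theorem eq_zero_of_adjointOp_mem_polarReduced {p : ℕ → K[X]} {r : ℕ} {Q : K[X]}
    (hQ : ShiftCoprime Q) (h0 : CofactorCoprime Q (p 0)) (hr : CofactorCoprime Q (p r))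
    {T : RatFunc K} (hT : T ∈ reducerSpace p r Q) (hL : adjointOp p r T ∈ polarReduced r Q) :
    T = 0 := by
  rw [mem_polarReduced] at hL
  have hfin := hQ.finite_poles T
  have hlow : ∀ j : ℤ, j < 0 → T ∈ regularAt (sh j Q) := by
    by_contra! hne
    obtain ⟨j, ⟨hj, hjT⟩, hmin⟩ := (hfin.subset (t := {j : ℤ | j < 0 ∧ T ∉ regularAt (sh j Q)})
      fun j hj => hj.2).exists_minimal hne
    refine hjT (mem_regularAt_of_mem_iSup hQ hT (P := p 0) ?_ (h0 j) ?_)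
    · rw [cancelOrder, if_pos hj]
      exact (pow_ord_mul_cofactor (p 0) (hQ.sh_ne_zero j)).symm
    · have := sub_mem (hL j (Or.inl hj))
        (adjointOp_sub_low_mem_regularAt (p := p) (r := r) (k := j) fun i hi => by
          by_contra hi'
          exact absurd (hmin ⟨hi.trans hj, hi'⟩ hi.le) (not_le.2 hi))
      rwa [sub_sub_cancel] at this
  have hhigh : ∀ j : ℤ, 0 ≤ j → T ∈ regularAt (sh j Q) := by
    by_contra! hne
    obtain ⟨j, ⟨hj, hjT⟩, hmax⟩ := (hfin.subset (t := {j : ℤ | 0 ≤ j ∧ T ∉ regularAt (sh j Q)})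
      fun j hj => hj.2).exists_maximal hne
    have hreg := sub_mem (hL (j + r) (Or.inr (by omega)))
      (adjointOp_sub_high_mem_regularAt (p := p) (r := r) (k := j) fun i hi => by
        by_contra hi'
        exact absurd (hmax ⟨hj.trans hi.le, hi'⟩ hi.le) (not_le.2 hi))
    rw [sub_sub_cancel] at hreg
    have hreg' := shiftRat_mem_regularAt hreg (-r)
    rw [map_mul, shiftRat_shiftRat, shiftRat_toRat, neg_add_cancel, shiftRat_zero,
      neg_add_cancel_comm_assoc] at hreg'
    refine hjT (mem_regularAt_of_mem_iSup hQ hT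
      (c := sh (-(r : ℤ)) (p r / sh (j + r) Q ^ ord Q (p r) (j + r))) ?_ ?_ hreg')
    · rw [cancelOrder, if_neg (not_lt.2 hj)]
      conv_lhs => rw [← pow_ord_mul_cofactor (p r) (hQ.sh_ne_zero (j + r))]
      rw [sh_mul, sh_pow, sh_sh, neg_add_cancel_comm_assoc]
    · have := isCoprime_sh (hr (j + r)) (-(r : ℤ))
      rwa [sh_sh, neg_add_cancel_comm_assoc] at this
  refine eq_zero_of_mem_polarSpace hQ (reducerSpace_le_polarSpace p r Q hT) fun j => ?_
  rcases lt_or_ge j 0 with hj | hj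
  · exact hlow j hj
  · exact hhigh j hj

/-- One round of the first loop removes the leftmost poles. -/
theorem lowStep_spec {p : ℕ → K[X]} {r : ℕ} {Q : K[X]} (hQ : ShiftCoprime Q)
    (h0 : CofactorCoprime Q (p 0)) {R : RatFunc K} {j : ℤ} (hj : j < 0)
    (hmin : ∀ k < j, R ∈ regularAt (sh k Q)) (hpole : R ∉ regularAt (sh j Q)) :
    ∃ T ∈ reducerSpace p r Q, lowStep p r Q R = Part.some (Sum.inr (R - adjointOp p r T)) ∧
      ∀ k ≤ j, R - adjointOp p r T ∈ regularAt (sh k Q) := by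
  have hpole' : HasPoleAt Q R j := hpole
  obtain ⟨A, hA, hAdeg, hAR⟩ := bezoutNumerator_spec hQ.natDegree_pos h0 R j
  have hT : toRat A / toRat (sh j Q) ^ (poleOrder Q R j + ord Q (p 0) j) ∈
      polarAt Q j (ord Q (p 0) j) := div_mem_polarAt j _ hAdeg
  set T := toRat A / toRat (sh j Q) ^ (poleOrder Q R j + ord Q (p 0) j) with hTdef
  have hTreg : ∀ k ≠ j, T ∈ regularAt (sh k Q) := fun k hk =>
    mem_regularAt_of_mem_polarAt hT (hQ.coprime k j hk)
  refine ⟨T, ?_, ?_, fun k hk => ?_⟩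
  · refine Submodule.mem_iSup_of_mem j ?_
    rwa [cancelOrder, if_pos hj]
  · have hleast : IsLeast {j | j < 0 ∧ HasPoleAt Q R j} j := ⟨⟨hj, hpole'⟩, fun k hk => by
      by_contra hlt
      exact hk.2 (hmin k (not_le.1 hlt))⟩
    rw [lowStep, if_pos ⟨j, hj, hpole'⟩, theUnique_eq_some hleast fun k hk => hk.unique hleast,
      Part.bind_some, hA, Part.bind_some]
  · rcases hk.eq_or_lt with rfl | hk
    · have := sub_mem hAR (adjointOp_sub_low_mem_regularAt (p := p) (r := r) (k := k)
        fun i hi => hTreg i hi.ne)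
      rwa [sub_sub_sub_cancel_right] at this
    · exact sub_mem (hmin k hk) (adjointOp_mem_regularAt fun i _ => hTreg _ (by omega))

/-- One round of the second loop removes the rightmost poles. -/
theorem highStep_spec {p : ℕ → K[X]} {r : ℕ} {Q : K[X]} (hQ : ShiftCoprime Q)
    (hr : CofactorCoprime Q (p r)) {R : RatFunc K} {j : ℤ} (hj : (r : ℤ) ≤ j)
    (hmax : ∀ k > j, R ∈ regularAt (sh k Q)) (hpole : R ∉ regularAt (sh j Q))
    (hlow : ∀ k < 0, R ∈ regularAt (sh k Q)) :
    ∃ T ∈ reducerSpace p r Q, highStep p r Q R = Part.some (Sum.inr (R - adjointOp p r T)) ∧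
      (∀ k ≥ j, R - adjointOp p r T ∈ regularAt (sh k Q)) ∧
      ∀ k < 0, R - adjointOp p r T ∈ regularAt (sh k Q) := by
  have hpole' : HasPoleAt Q R j := hpole
  obtain ⟨A, hA, hAdeg, hAR⟩ := bezoutNumerator_spec hQ.natDegree_pos hr R j
  have hT : toRat (sh (-(r : ℤ)) A) /
      toRat (sh (j - r) Q) ^ (poleOrder Q R j + ord Q (p r) j) ∈
      polarAt Q (j - r) (ord Q (p r) j) :=
    div_mem_polarAt (j - r) _ (by rwa [degree_sh])
  set T := toRat (sh (-(r : ℤ)) A) /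
    toRat (sh (j - r) Q) ^ (poleOrder Q R j + ord Q (p r) j) with hTdef
  have hshift : shiftRat r T = toRat A / toRat (sh j Q) ^ (poleOrder Q R j + ord Q (p r) j) := by
    rw [hTdef, map_div₀, map_pow, shiftRat_toRat, shiftRat_toRat, sh_sh, sh_sh, add_neg_cancel,
      sh_zero, add_sub_cancel]
  have hTreg : ∀ k ≠ j - r, T ∈ regularAt (sh k Q) := fun k hk =>
    mem_regularAt_of_mem_polarAt hT (hQ.coprime k (j - r) hk)
  refine ⟨T, ?_, ?_, fun k hk => ?_, fun k hk => ?_⟩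
  · refine Submodule.mem_iSup_of_mem (j - r) ?_
    rwa [cancelOrder, if_neg (by omega), sub_add_cancel]
  · have hgreatest : IsGreatest {j | (r : ℤ) ≤ j ∧ HasPoleAt Q R j} j :=
      ⟨⟨hj, hpole'⟩, fun k hk => by
        by_contra hlt
        exact hk.2 (hmax k (not_le.1 hlt))⟩
    rw [highStep, if_pos ⟨j, hj, hpole'⟩,
      theUnique_eq_some hgreatest fun k hk => hk.unique hgreatest,
      Part.bind_some, hA, Part.bind_some]
  · rcases hk.eq_or_lt with rfl | hk
    · rw [← hshift] at hAR
      have h1 := adjointOp_sub_high_mem_regularAt (p := p) (r := r) (k := j - r)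
        fun i hi => hTreg i hi.ne'
      rw [sub_add_cancel] at h1
      have := sub_mem hAR h1
      rwa [sub_sub_sub_cancel_right] at this
    · exact sub_mem (hmax k hk) (adjointOp_mem_regularAt fun i _ => hTreg _ (by omega))
  · exact sub_mem (hlow k hk) (adjointOp_mem_regularAt fun i _ => hTreg _ (by omega))

/-- The first loop, on an `R` whose poles at the zeros of shifts of `Q` have index at least `-n`. -/
theorem low_loop {p : ℕ → K[X]} {r : ℕ} {Q : K[X]} (hQ : ShiftCoprime Q)
    (h0 : CofactorCoprime Q (p 0)) (n : ℕ) :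
    ∀ R : RatFunc K, (∀ j : ℤ, j < -n → R ∈ regularAt (sh j Q)) →
      ∃ T ∈ reducerSpace p r Q, R - adjointOp p r T ∈ PFun.fix (lowStep p r Q) R ∧
        ∀ j < 0, R - adjointOp p r T ∈ regularAt (sh j Q) := by
  induction n with
  | zero =>
    intro R hR
    refine ⟨0, Submodule.zero_mem _, ?_, by simpa using hR⟩
    rw [map_zero, sub_zero]
    refine mem_fix_of_final ?_
    rw [lowStep, if_neg]
    rintro ⟨j, hj, hpole⟩
    exact hpole (hR j (by simpa using hj))
  | succ n ih =>
    intro R hR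
    by_cases hpole : R ∈ regularAt (sh (-(n + 1 : ℕ) : ℤ) Q)
    · refine ih R fun j hj => ?_
      rcases (show j < -(n + 1 : ℕ) ∨ j = -(n + 1 : ℕ) by omega) with h | rfl
      · exact hR j h
      · exact hpole
    · obtain ⟨T, hT, hstep, hreg⟩ := lowStep_spec (r := r) hQ h0
        (show (-(n + 1 : ℕ) : ℤ) < 0 by omega) hR hpole
      obtain ⟨T', hT', hfix, hreg'⟩ := ih _ fun j hj => hreg j (by omega)
      rw [sub_sub, ← map_add] at hfix hreg'
      exact ⟨T + T', Submodule.add_mem _ hT hT', mem_fix_of_step hstep hfix, hreg'⟩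

/-- The second loop, on an `R` whose poles at the zeros of shifts of `Q` have index at least `0` and
less than `r + n`. -/
theorem high_loop {p : ℕ → K[X]} {r : ℕ} {Q : K[X]} (hQ : ShiftCoprime Q)
    (hr : CofactorCoprime Q (p r)) (n : ℕ) :
    ∀ R : RatFunc K, (∀ j < 0, R ∈ regularAt (sh j Q)) →
      (∀ j : ℤ, r + n ≤ j → R ∈ regularAt (sh j Q)) →
      ∃ T ∈ reducerSpace p r Q, R - adjointOp p r T ∈ PFun.fix (highStep p r Q) R ∧
        R - adjointOp p r T ∈ polarReduced r Q := by
  induction n with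
  | zero =>
    intro R hlow hR
    refine ⟨0, Submodule.zero_mem _, ?_, ?_⟩
    · rw [map_zero, sub_zero]
      refine mem_fix_of_final ?_
      rw [highStep, if_neg]
      rintro ⟨j, hj, hpole⟩
      exact hpole (hR j (by simpa using hj))
    · rw [map_zero, sub_zero, mem_polarReduced]
      rintro j (hj | hj)
      · exact hlow j hj
      · exact hR j (by simpa using hj)
  | succ n ih =>
    intro R hlow hR
    by_cases hpole : R ∈ regularAt (sh (r + n : ℤ) Q)
    · refine ih R hlow fun j hj => ?_
      rcases hj.eq_or_lt with rfl | h
      · exact hpole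
      · exact hR j (by push_cast; omega)
    · obtain ⟨T, hT, hstep, hreg, hlow'⟩ := highStep_spec hQ hr
        (show (r : ℤ) ≤ r + n by omega) (fun k hk => hR k (by push_cast; omega)) hpole hlow
      obtain ⟨T', hT', hfix, hreg'⟩ := ih _ hlow' fun j hj => hreg j hj
      rw [sub_sub, ← map_add] at hfix hreg'
      exact ⟨T + T', Submodule.add_mem _ hT hT', mem_fix_of_step hstep hfix, hreg'⟩

/-- `R'` is reduced and differs from `R` by an element of `L*` of the reducer space. -/
def weakPolarRel (p : ℕ → K[X]) (r : ℕ) (Q : K[X]) : Submodule K (RatFunc K × RatFunc K) :=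
  (polarReduced r Q).comap (LinearMap.snd K _ _) ⊓
    ((reducerSpace p r Q).map (adjointOp p r)).comap (LinearMap.fst K _ _ - LinearMap.snd K _ _)

theorem mem_weakPolarRel {p : ℕ → K[X]} {r : ℕ} {Q : K[X]} {R R' : RatFunc K} :
    (R, R') ∈ weakPolarRel p r Q ↔
      R' ∈ polarReduced r Q ∧ ∃ T ∈ reducerSpace p r Q, adjointOp p r T = R - R' := Iff.rfl

theorem weakPolarRel_functional {p : ℕ → K[X]} {r : ℕ} {Q : K[X]} (hQ : ShiftCoprime Q)
    (h0 : CofactorCoprime Q (p 0)) (hr : CofactorCoprime Q (p r)) {R' : RatFunc K}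
    (h : (0, R') ∈ weakPolarRel p r Q) : R' = 0 := by
  obtain ⟨hR', T, hT, hTR⟩ := h
  change adjointOp p r T = 0 - R' at hTR
  rw [zero_sub] at hTR
  have hT0 := eq_zero_of_adjointOp_mem_polarReduced hQ h0 hr hT
    (by rw [hTR]; exact Submodule.neg_mem _ hR')
  rw [hT0, map_zero] at hTR
  exact neg_eq_zero.1 hTR.symm

/-- The weak reduction of poles terminates and computes a linear map. -/
theorem exists_weakPolar {p : ℕ → K[X]} {r : ℕ} {Q : K[X]} (hQ : ShiftCoprime Q)
    (h0 : CofactorCoprime Q (p 0)) (hr : CofactorCoprime Q (p r)) :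
    ∃ φ : RatFunc K →ₗ[K] RatFunc K, ∀ R, weakPolar p r Q R = Part.some (φ R) ∧
      ∀ R', (R, R') ∈ weakPolarRel p r Q ↔ φ R = R' := by
  refine exists_linearMap_of_rel _ _ (fun R => ?_) fun w => weakPolarRel_functional hQ h0 hr
  obtain ⟨a, ha⟩ := (hQ.finite_poles R).bddBelow
  obtain ⟨T, hT, hfix, hreg⟩ := low_loop (r := r) hQ h0 (-a).toNat R fun j hj => by
    by_contra hpole
    have := ha hpole
    omega
  obtain ⟨b, hb⟩ := (hQ.finite_poles (R - adjointOp p r T)).bddAbove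
  obtain ⟨T', hT', hfix', hreg'⟩ := high_loop hQ hr (b + 1).toNat _ hreg fun j hj => by
    by_contra hpole
    have := hb hpole
    omega
  refine ⟨_, ?_, hreg', T + T', Submodule.add_mem _ hT hT', ?_⟩
  · rw [weakPolar, Part.eq_some_iff.2 hfix, Part.bind_some]
    exact Part.eq_some_iff.2 hfix'
  · rw [map_add]
    change _ = R - (R - adjointOp p r T - adjointOp p r T')
    abel

/-! ### Coordinates -/

/-- The space `K_Q(n) + K[n]`. -/
def fractionSpace (Q : K[X]) : Submodule K (RatFunc K) := LinearMap.range (toRatₗ K) ⊔ polarSpace Q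

theorem toRat_mem_fractionSpace (Q P : K[X]) : toRat P ∈ fractionSpace Q :=
  Submodule.mem_sup_left ⟨P, rfl⟩

theorem toRat_div_eq_add {F : K[X]} (hF : F ≠ 0) (A : K[X]) (s : ℕ) :
    toRat A / toRat F ^ s = toRat (A / F ^ s) + toRat (A % F ^ s) / toRat F ^ s := by
  have hF' := toRat_ne_zero hF
  have h := congrArg toRat (EuclideanDomain.div_add_mod A (F ^ s))
  simp only [toRat_add, toRat_mul, toRat_pow] at h
  field_simp
  linear_combination -h

theorem div_pow_mem_fractionSpace {Q : K[X]} (hQ : ShiftCoprime Q) (A : K[X]) (j : ℤ) (s : ℕ) :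
    toRat A / toRat (sh j Q) ^ s ∈ fractionSpace Q := by
  rw [toRat_div_eq_add (hQ.sh_ne_zero j)]
  refine Submodule.add_mem _ (toRat_mem_fractionSpace Q _) (Submodule.mem_sup_right ?_)
  refine div_pow_mem_polarSpace j ?_
  have := degree_mod_pow_lt (hQ.sh_ne_zero j) A s
  rwa [natDegree_sh] at this

theorem adjointOp_mem_fractionSpace {Q : K[X]} (hQ : ShiftCoprime Q) (p : ℕ → K[X]) (r : ℕ)
    {R : RatFunc K} (hR : R ∈ fractionSpace Q) : adjointOp p r R ∈ fractionSpace Q := by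
  suffices h : fractionSpace Q ≤ (fractionSpace Q).comap (adjointOp p r) from h hR
  refine sup_le ?_ (Submodule.span_le.2 ?_)
  · rintro _ ⟨P, rfl⟩
    rw [Submodule.mem_comap, toRatₗ_apply, ← toRat_adjointOpPoly]
    exact toRat_mem_fractionSpace Q _
  · rintro _ ⟨h, s, l, -, -, rfl⟩
    change adjointOp p r _ ∈ fractionSpace Q
    rw [adjointOp_apply]
    refine Submodule.sum_mem _ fun i _ => ?_
    rw [map_div₀, map_pow, shiftRat_toRat, shiftRat_toRat, sh_sh, ← mul_div_assoc, ← toRat_mul]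
    exact div_pow_mem_fractionSpace hQ _ _ _

/-- The index of the monomial `n^k`. -/
def polyMon (Q : K[X]) (k : ℕ) : Mon Q := toLex (Sum.inl k)

/-- The index of the monomial `n^l / Q(n-j)^(s+1)`. -/
def polarMon (Q : K[X]) (j : ℤ) (s : ℕ) (l : Fin Q.natDegree) : Mon Q :=
  toLex (Sum.inr (toLex (j, toLex (s, l))))

theorem mon_cases {Q : K[X]} (m : Mon Q) :
    (∃ k, m = polyMon Q k) ∨ ∃ j s l, m = polarMon Q j s l := by
  rcases h : ofLex m with k | t
  · exact Or.inl ⟨k, by rw [polyMon, ← h, toLex_ofLex]⟩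
  · exact Or.inr ⟨(ofLex t).1, (ofLex (ofLex t).2).1, (ofLex (ofLex t).2).2, by
      rw [polarMon, Prod.mk.eta, toLex_ofLex, Prod.mk.eta, toLex_ofLex, ← h, toLex_ofLex]⟩

theorem polarMon_ne_polyMon {Q : K[X]} {j : ℤ} {s : ℕ} {l : Fin Q.natDegree} {k : ℕ} :
    polarMon Q j s l ≠ polyMon Q k := fun h => by
  have := congrArg ofLex h
  simp [polarMon, polyMon] at this

theorem polarMon_inj {Q : K[X]} {j j' : ℤ} {s s' : ℕ} {l l' : Fin Q.natDegree} :
    polarMon Q j s l = polarMon Q j' s' l' ↔ j = j' ∧ s = s' ∧ l = l' := by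
  simp [polarMon]

theorem polyMon_injective (Q : K[X]) : Function.Injective (polyMon Q) := fun k k' h => by
  simpa [polyMon] using h

theorem mono_polyMon (Q : K[X]) (k : ℕ) : mono Q (polyMon Q k) = toRat (X ^ k) := rfl

theorem mono_polarMon (Q : K[X]) (j : ℤ) (s : ℕ) (l : Fin Q.natDegree) :
    mono Q (polarMon Q j s l) = toRat (X ^ (l : ℕ)) / toRat (sh j Q) ^ (s + 1) := rfl

/-- The rational function with given coordinates, as a linear map. -/
def ofCoordsₗ (Q : K[X]) : (Mon Q →₀ K) →ₗ[K] RatFunc K := Finsupp.linearCombination K (mono Q)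

theorem ofCoordsₗ_apply (Q : K[X]) (v : Mon Q →₀ K) : ofCoordsₗ Q v = ofCoords Q v := rfl

/-- The coordinates of a polynomial among the coordinates for `K_Q(n) + K[n]`. -/
def embedPoly (Q : K[X]) : (ℕ →₀ K) →ₗ[K] (Mon Q →₀ K) := Finsupp.lmapDomain K K (polyMon Q)

theorem ofPolyCoords_eq_sum (w : ℕ →₀ K) : ofPolyCoords w = w.sum fun k c => C c * X ^ k := by
  rw [ofPolyCoords, Module.Basis.repr_symm_apply, Finsupp.linearCombination_apply]
  simp [smul_eq_C_mul, X_pow_eq_monomial]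

theorem ofCoordsₗ_embedPoly (Q : K[X]) (w : ℕ →₀ K) :
    ofCoordsₗ Q (embedPoly Q w) = toRat (ofPolyCoords w) := by
  rw [ofCoordsₗ, embedPoly, Finsupp.lmapDomain_apply, Finsupp.linearCombination_mapDomain,
    Finsupp.linearCombination_apply, ofPolyCoords_eq_sum, Finsupp.sum, Finsupp.sum, toRat, map_sum]
  refine Finset.sum_congr rfl fun k _ => ?_
  exact (toRat_C_mul _ _).symm

theorem exists_embedPoly {Q : K[X]} {v : Mon Q →₀ K} (h : ∀ j s l, v (polarMon Q j s l) = 0) :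
    ∃ w, v = embedPoly Q w := by
  refine ⟨v.comapDomain (polyMon Q) (polyMon_injective Q).injOn, ?_⟩
  refine (Finsupp.mapDomain_comapDomain _ (polyMon_injective Q) _ fun m hm => ?_).symm
  rcases mon_cases m with ⟨k, rfl⟩ | ⟨j, s, l, rfl⟩
  · exact ⟨k, rfl⟩
  · exact absurd (h j s l) (Finsupp.mem_support_iff.1 hm)

theorem embedPoly_polarMon (Q : K[X]) (w : ℕ →₀ K) (j : ℤ) (s : ℕ) (l : Fin Q.natDegree) :
    embedPoly Q w (polarMon Q j s l) = 0 :=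
  Finsupp.mapDomain_of_notMem_range _ _ fun ⟨_, hk⟩ => polarMon_ne_polyMon hk.symm

theorem ofPolyCoords_polyCoords (P : K[X]) : ofPolyCoords (polyCoords P) = P :=
  (Polynomial.basisMonomials K).repr.symm_apply_apply P

theorem polyCoords_ofPolyCoords (w : ℕ →₀ K) : polyCoords (ofPolyCoords w) = w :=
  (Polynomial.basisMonomials K).repr.apply_symm_apply w

/-- If a rational function has no poles at the zeros of `Q(n-j)`, then its coordinates at the
corresponding monomials vanish: otherwise multiply by the highest power of `Q(n-j)` that leaves a
pole of order one. -/
theorem apply_polarMon_eq_zero {Q : K[X]} (hQ : ShiftCoprime Q) {v : Mon Q →₀ K} {j : ℤ}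
    (h : ofCoordsₗ Q v ∈ regularAt (sh j Q)) (s : ℕ) (l : Fin Q.natDegree) :
    v (polarMon Q j s l) = 0 := by
  classical
  have hF := hQ.sh_ne_zero j
  have hF' := toRat_ne_zero hF
  by_contra hv
  -- the highest pole order `s + 1` that occurs
  obtain ⟨s, ⟨l, hl⟩, hmax⟩ : ∃ s, (∃ l, v (polarMon Q j s l) ≠ 0) ∧
      ∀ s' l', v (polarMon Q j s' l') ≠ 0 → s' ≤ s := by
    have hfin : {s | ∃ l, v (polarMon Q j s l) ≠ 0}.Finite := by
      refine (v.support.finite_toSet.image fun m =>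
        match ofLex m with
        | Sum.inl _ => 0
        | Sum.inr t => (ofLex (ofLex t).2).1).subset ?_
      rintro s ⟨l, hl⟩
      exact ⟨polarMon Q j s l, Finsupp.mem_support_iff.2 hl, rfl⟩
    obtain ⟨s, hs, hmax⟩ := hfin.exists_maximal ⟨s, l, hv⟩
    refine ⟨s, hs, fun s' l' hl' => ?_⟩
    by_contra! hlt
    exact absurd (hmax ⟨l', hl'⟩ hlt.le) (not_le.2 hlt)
  set w : Mon Q →₀ K := ∑ l, Finsupp.single (polarMon Q j s l) (v (polarMon Q j s l)) with hw
  set a : K[X] := ∑ l : Fin Q.natDegree, C (v (polarMon Q j s l)) * X ^ (l : ℕ) with ha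
  have hwa : ofCoordsₗ Q w = toRat a / toRat (sh j Q) ^ (s + 1) := by
    rw [hw, ha, map_sum, toRat, map_sum, Finset.sum_div]
    refine Finset.sum_congr rfl fun l _ => ?_
    change _ = toRat (C _ * X ^ (l : ℕ)) / _
    rw [ofCoordsₗ, Finsupp.linearCombination_single, mono_polarMon, toRat_C_mul, smul_div_assoc]
  have hw1 : ∀ l, w (polarMon Q j s l) = v (polarMon Q j s l) := fun l => by
    rw [hw, Finsupp.finsetSum_apply, Finset.sum_eq_single l]
    · simp
    · intro l' _ hne
      rw [Finsupp.single_apply, if_neg]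
      rw [polarMon_inj]
      exact fun h => hne h.2.2
    · simp
  have hw2 : ∀ m, (∀ l, m ≠ polarMon Q j s l) → w m = 0 := fun m hm => by
    rw [hw, Finsupp.finsetSum_apply]
    exact Finset.sum_eq_zero fun l _ => by rw [Finsupp.single_apply, if_neg (hm l).symm]
  have hrest : toRat (sh j Q) ^ s * ofCoordsₗ Q (v - w) ∈ regularAt (sh j Q) := by
    rw [ofCoordsₗ, Finsupp.linearCombination_apply, Finsupp.sum, Finset.mul_sum]
    refine sum_mem fun m hm => ?_
    rw [mul_smul_comm]
    refine Subalgebra.smul_mem _ ?_ _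
    have hm := Finsupp.mem_support_iff.1 hm
    rw [Finsupp.sub_apply] at hm
    rcases mon_cases m with ⟨k, rfl⟩ | ⟨j', s', l', rfl⟩
    · rw [mono_polyMon, ← toRat_pow]
      exact mul_mem (toRat_mem_regularAt _ _) (toRat_mem_regularAt _ _)
    · rw [mono_polarMon]
      by_cases hj : j' = j
      · subst hj
        by_cases hs : s' = s
        · subst hs
          rw [hw1, sub_self] at hm
          exact absurd rfl hm
        · rw [hw2 _ (fun l h => hs (polarMon_inj.1 h).2.1), sub_zero] at hm
          obtain ⟨t, rfl⟩ : ∃ t, s = s' + 1 + t :=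
            Nat.exists_eq_add_of_le (lt_of_le_of_ne (hmax s' l' hm) hs)
          rw [pow_add, mul_comm, ← mul_assoc, div_mul_cancel₀ _ (pow_ne_zero _ hF'), ← toRat_pow]
          exact mul_mem (toRat_mem_regularAt _ _) (toRat_mem_regularAt _ _)
      · rw [← toRat_pow]
        exact mul_mem (toRat_mem_regularAt _ _)
          (div_pow_mem_regularAt _ _ (hQ.coprime j j' (Ne.symm hj)))
  have hdiv : toRat a / toRat (sh j Q) ^ 1 ∈ regularAt (sh j Q) := by
    have h1 := sub_mem (mul_mem (toRat_mem_regularAt (sh j Q) (sh j Q ^ s)) h) hrest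
    rw [map_sub, hwa, toRat_pow, ← mul_sub, sub_sub_cancel] at h1
    convert h1 using 1
    field_simp
    ring
  have hadeg : a.degree < ((1 * (sh j Q).natDegree : ℕ) : WithBot ℕ) := by
    rw [ha, one_mul, natDegree_sh]
    refine (degree_sum_le _ _).trans_lt ((Finset.sup_lt_iff (WithBot.bot_lt_coe _)).2 fun l _ => ?_)
    exact (degree_C_mul_X_pow_le _ _).trans_lt (by exact_mod_cast l.2)
  have ha0 := eq_zero_of_div_mem_regularAt hadeg hF hdiv
  refine hl ?_
  have hcoeff : a.coeff (l : ℕ) = v (polarMon Q j s l) := by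
    rw [ha, finsetSum_coeff, Finset.sum_eq_single l]
    · simp
    · intro l' _ hne
      rw [coeff_C_mul_X_pow, if_neg]
      exact fun h => hne (Fin.ext h.symm)
    · simp
  rw [← hcoeff, ha0, coeff_zero]

theorem exists_embedPoly_of_regular {Q : K[X]} (hQ : ShiftCoprime Q) {v : Mon Q →₀ K}
    (h : ∀ j, ofCoordsₗ Q v ∈ regularAt (sh j Q)) : ∃ w, v = embedPoly Q w :=
  exists_embedPoly fun j => apply_polarMon_eq_zero hQ (h j)

theorem ofCoordsₗ_injective {Q : K[X]} (hQ : ShiftCoprime Q) :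
    Function.Injective (ofCoordsₗ Q) := by
  refine (injective_iff_map_eq_zero _).2 fun v hv => ?_
  obtain ⟨w, rfl⟩ := exists_embedPoly_of_regular (v := v) hQ fun j => by
    rw [hv]; exact zero_mem _
  rw [ofCoordsₗ_embedPoly, toRat_eq_zero] at hv
  rw [← polyCoords_ofPolyCoords w, hv, polyCoords, map_zero, map_zero]

theorem fractionSpace_le_range {Q : K[X]} (hQ : ShiftCoprime Q) :
    fractionSpace Q ≤ LinearMap.range (ofCoordsₗ Q) := by
  have hpoly : ∀ P, toRat P ∈ LinearMap.range (ofCoordsₗ Q) := fun P =>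
    ⟨embedPoly Q (polyCoords P), by rw [ofCoordsₗ_embedPoly, ofPolyCoords_polyCoords]⟩
  -- successive division by `Q(n-j)`
  have hfrac : ∀ (j : ℤ) (s : ℕ) (A : K[X]),
      toRat A / toRat (sh j Q) ^ s ∈ LinearMap.range (ofCoordsₗ Q) := by
    intro j s
    have hF := hQ.sh_ne_zero j
    have hF' := toRat_ne_zero hF
    induction s with
    | zero => intro A; simpa using hpoly A
    | succ s ih =>
      intro A
      have hA := congrArg toRat (EuclideanDomain.div_add_mod A (sh j Q))
      have heq : toRat A / toRat (sh j Q) ^ (s + 1) = toRat (A / sh j Q) / toRat (sh j Q) ^ s +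
          toRat (A % sh j Q) / toRat (sh j Q) ^ (s + 1) := by
        rw [toRat_add, toRat_mul] at hA
        rw [← hA]
        field_simp
        ring
      rw [heq]
      refine Submodule.add_mem _ (ih _) ?_
      have hdeg : (A % sh j Q).natDegree < Q.natDegree := by
        have := natDegree_mod_lt A (q := sh j Q) (by rw [natDegree_sh]; exact hQ.natDegree_pos.ne')
        rwa [natDegree_sh] at this
      rw [(A % sh j Q).as_sum_range_C_mul_X_pow, toRat, map_sum, Finset.sum_div]
      refine Submodule.sum_mem _ fun l hl => ?_
      change toRat (C _ * X ^ l) / _ ∈ _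
      rw [toRat_C_mul, smul_div_assoc]
      have hl' : l < Q.natDegree := (Nat.lt_succ_iff.1 (Finset.mem_range.1 hl)).trans_lt hdeg
      refine Submodule.smul_mem _ _ ⟨Finsupp.single (polarMon Q j s ⟨l, hl'⟩) 1, ?_⟩
      rw [ofCoordsₗ, Finsupp.linearCombination_single, one_smul, mono_polarMon]
  refine sup_le ?_ (Submodule.span_le.2 ?_)
  · rintro _ ⟨P, rfl⟩
    exact hpoly P
  · rintro _ ⟨h, s, l, -, -, rfl⟩
    exact hfrac (-h) s _

theorem coords_ofCoordsₗ {Q : K[X]} (hQ : ShiftCoprime Q) (v : Mon Q →₀ K) :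
    coords Q (ofCoordsₗ Q v) = Part.some v :=
  theUnique_eq_some rfl fun _ hb => ofCoordsₗ_injective hQ hb

/-- The coordinates of the elements of `K_Q(n) + K[n]` are given by a linear map. -/
theorem exists_coordsₗ {Q : K[X]} (hQ : ShiftCoprime Q) :
    ∃ κ : RatFunc K →ₗ[K] (Mon Q →₀ K), (∀ v, κ (ofCoordsₗ Q v) = v) ∧
      ∀ R ∈ fractionSpace Q, coords Q R = Part.some (κ R) ∧ ofCoordsₗ Q (κ R) = R := by
  obtain ⟨κ, hκ⟩ := LinearMap.exists_leftInverse_of_injective _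
    (LinearMap.ker_eq_bot.2 (ofCoordsₗ_injective hQ))
  have hκ' : ∀ v, κ (ofCoordsₗ Q v) = v := fun v => LinearMap.congr_fun hκ v
  refine ⟨κ, hκ', fun R hR => ?_⟩
  obtain ⟨v, rfl⟩ := fractionSpace_le_range hQ hR
  rw [hκ']
  exact ⟨coords_ofCoordsₗ hQ v, rfl⟩

/-! ### The decomposition of rational functions -/

section Decompose

variable {ι : Type*} {Q : ι → K[X]}

theorem IsShiftless.isCoprime_sh (hQ : IsShiftless Q) {i k : ι} {j l : ℤ} (h : i ≠ k ∨ j ≠ l) :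
    IsCoprime (sh j (Q i)) (sh l (Q k)) := by
  have := ShiftReduction.isCoprime_sh
    (hQ.coprime i k (l - j) (h.imp id fun h => sub_ne_zero.2 h.symm)) l
  rwa [sh_sh, show l + -(l - j) = j by ring] at this

theorem IsShiftless.shiftCoprime (hQ : IsShiftless Q) (i : ι) : ShiftCoprime (Q i) :=
  ⟨hQ.nonconst i, fun _ _ h => hQ.isCoprime_sh (Or.inr h)⟩

/-- `K[n] + ∑_i K_{Q_i}(n)`. -/
def decomposable (Q : ι → K[X]) : Submodule K (RatFunc K) :=
  LinearMap.range (toRatₗ K) ⊔ ⨆ i, polarSpace (Q i)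

theorem div_mul_mem_decomposable {b b' : K[X]} (hcop : IsCoprime b b')
    (hb : ∀ a, toRat a / toRat b ∈ decomposable Q) (hb' : ∀ a, toRat a / toRat b' ∈ decomposable Q)
    (a : K[X]) : toRat a / toRat (b * b') ∈ decomposable Q := by
  by_cases hb0 : b * b' = 0
  · rw [hb0, toRat_zero, div_zero]
    exact Submodule.zero_mem _
  obtain ⟨u, v, huv⟩ := hcop
  have h1 := toRat_ne_zero (left_ne_zero_of_mul hb0)
  have h2 := toRat_ne_zero (right_ne_zero_of_mul hb0)
  have heq : toRat a / toRat (b * b') = toRat (a * u) / toRat b' + toRat (a * v) / toRat b := by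
    have huv' := congrArg toRat huv
    simp only [toRat_add, toRat_mul, toRat_one] at huv' ⊢
    field_simp
    linear_combination (-toRat a) * huv'
  rw [heq]
  exact Submodule.add_mem _ (hb' _) (hb _)

theorem div_prod_mem_decomposable (hQ : IsShiftless Q) (s : Finset (ι × ℤ)) (m : ℕ) (a : K[X]) :
    toRat a / toRat (∏ x ∈ s, sh x.2 (Q x.1) ^ m) ∈ decomposable Q := by
  classical
  induction s using Finset.induction_on generalizing a with
  | empty =>
    rw [Finset.prod_empty, toRat_one, div_one]
    exact Submodule.mem_sup_left ⟨a, rfl⟩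
  | insert x s hx ih =>
    rw [Finset.prod_insert hx]
    refine div_mul_mem_decomposable ?_ (fun a => ?_) ih a
    · refine IsCoprime.prod_right fun y hy => IsCoprime.pow (hQ.isCoprime_sh ?_)
      by_contra! hxy
      exact hx (Prod.ext hxy.1 hxy.2 ▸ hy)
    · have hle : fractionSpace (Q x.1) ≤ decomposable Q :=
        sup_le_sup_left (le_iSup (fun i => polarSpace (Q i)) x.1) _
      rw [toRat_pow]
      exact hle (div_pow_mem_fractionSpace (hQ.shiftCoprime x.1) a _ m)

theorem exists_dvd_prod (hexh : Exhausts Q) {b : K[X]} (hb : b ≠ 0) :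
    ∃ (s : Finset (ι × ℤ)) (m : ℕ), b ∣ ∏ x ∈ s, sh x.2 (Q x.1) ^ m := by
  classical
  induction b using WfDvdMonoid.induction_on_irreducible with
  | zero => exact absurd rfl hb
  | unit u hu => exact ⟨∅, 0, by simpa using hu.dvd⟩
  | mul a g ha hg ih =>
    obtain ⟨s, m, hdvd⟩ := ih ha
    obtain ⟨i, h, hgi⟩ := hexh g hg
    have key : ∀ f : ι × ℤ → K[X], g ∣ f (i, -h) → a ∣ ∏ x ∈ s, f x ^ m →
        g * a ∣ ∏ x ∈ insert (i, -h) s, f x ^ (m + 1) := fun f hf hdvd => by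
      have hsplit : ∏ x ∈ insert (i, -h) s, f x ^ (m + 1) =
          (∏ x ∈ insert (i, -h) s, f x) * ∏ x ∈ insert (i, -h) s, f x ^ m := by
        rw [← Finset.prod_mul_distrib]
        exact Finset.prod_congr rfl fun x _ => pow_succ' _ _
      rw [hsplit]
      exact mul_dvd_mul (hf.trans (Finset.dvd_prod_of_mem f (Finset.mem_insert_self _ s)))
        (hdvd.trans (Finset.prod_dvd_prod_of_subset _ _ _ (Finset.subset_insert _ _)))
    exact ⟨insert (i, -h) s, m + 1, key (fun x => sh x.2 (Q x.1)) hgi hdvd⟩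

theorem mem_decomposable (hQ : IsShiftless Q) (hexh : Exhausts Q) (R : RatFunc K) :
    R ∈ decomposable Q := by
  obtain ⟨a, b, hb, rfl⟩ := exists_eq_div R
  obtain ⟨s, m, u, hu⟩ := exists_dvd_prod hexh hb
  have hprod : ∏ x ∈ s, sh x.2 (Q x.1) ^ m ≠ 0 :=
    Finset.prod_ne_zero_iff.2 fun x _ => pow_ne_zero _ ((hQ.shiftCoprime x.1).sh_ne_zero x.2)
  have hu0 : u ≠ 0 := by
    rintro rfl
    exact hprod (by rw [hu, mul_zero])
  have := div_prod_mem_decomposable hQ s m (a * u)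
  rwa [hu, toRat_mul, toRat_mul, mul_div_mul_right _ _ (toRat_ne_zero hu0)] at this

/-- The sum of a finitely supported family, as a linear map. -/
def sumₗ (K ι : Type*) [Field K] : (ι →₀ RatFunc K) →ₗ[K] RatFunc K :=
  Finsupp.lsum ℕ fun _ => LinearMap.id

/-- The families of polar components with respect to the `Q_i`. -/
def polarFamilies (Q : ι → K[X]) : Submodule K (ι →₀ RatFunc K) :=
  ⨅ i, (polarSpace (Q i)).comap (Finsupp.lapply i)

theorem mem_polarFamilies {f : ι →₀ RatFunc K} :
    f ∈ polarFamilies Q ↔ ∀ i, f i ∈ polarSpace (Q i) := by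
  simp [polarFamilies, Submodule.mem_iInf]

/-- The graph of the decomposition `R = P_∞ + ∑ R_i`. -/
def decomposeRel (Q : ι → K[X]) : Submodule K (RatFunc K × (K[X] × (ι →₀ RatFunc K))) :=
  ((polarFamilies Q).comap (LinearMap.snd K K[X] _)).comap (LinearMap.snd K (RatFunc K) _) ⊓
    LinearMap.eqLocus (LinearMap.fst K (RatFunc K) _)
      (((toRatₗ K).coprod (sumₗ K ι)) ∘ₗ LinearMap.snd K (RatFunc K) _)

theorem mem_decomposeRel {R : RatFunc K} {d : K[X] × (ι →₀ RatFunc K)} :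
    (R, d) ∈ decomposeRel Q ↔
      (∀ i, d.2 i ∈ polarSpace (Q i)) ∧ R = toRat d.1 + d.2.sum fun _ f => f := by
  rw [← mem_polarFamilies]
  rfl

/-- The components of the decomposition are determined, since the poles of the others are
elsewhere. -/
theorem decomposeRel_functional (hQ : IsShiftless Q) {d : K[X] × (ι →₀ RatFunc K)}
    (h : (0, d) ∈ decomposeRel Q) : d = 0 := by
  classical
  obtain ⟨hd, hsum⟩ := mem_decomposeRel.1 h
  have hd2 : d.2 = 0 := by
    ext1 i
    refine eq_zero_of_mem_polarSpace (hQ.shiftCoprime i) (hd i) fun j => ?_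
    by_cases hi : i ∈ d.2.support
    · rw [Finsupp.sum, ← Finset.add_sum_erase _ _ hi] at hsum
      have heq : d.2 i = -(toRat d.1 + ∑ k ∈ d.2.support.erase i, d.2 k) := by
        linear_combination -hsum
      rw [heq]
      refine neg_mem (add_mem (toRat_mem_regularAt _ _) (sum_mem fun k hk => ?_))
      exact mem_regularAt_of_mem_polarSpace (hd k) fun l =>
        hQ.isCoprime_sh (Or.inl (Finset.ne_of_mem_erase hk).symm)
    · rw [Finsupp.notMem_support_iff.1 hi]
      exact zero_mem _
  rw [hd2, Finsupp.sum_zero_index, add_zero] at hsum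
  exact Prod.ext (toRat_eq_zero.1 hsum.symm) hd2

theorem exists_decompose (hQ : IsShiftless Q) (hexh : Exhausts Q) :
    ∃ δ : RatFunc K →ₗ[K] K[X] × (ι →₀ RatFunc K), ∀ R, decompose Q R = Part.some (δ R) ∧
      ∀ d, (R, d) ∈ decomposeRel Q ↔ δ R = d := by
  refine exists_linearMap_of_rel _ _ (fun R => ?_) fun d => decomposeRel_functional hQ
  obtain ⟨_, ⟨P, rfl⟩, y, hy, rfl⟩ := Submodule.mem_sup.1 (mem_decomposable hQ hexh R)
  obtain ⟨f, hf, rfl⟩ := (Submodule.mem_iSup_iff_exists_finsupp _ _).1 hy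
  have hmem : ((toRatₗ K) P + f.sum fun _ x => x, (P, f)) ∈ decomposeRel Q :=
    mem_decomposeRel.2 ⟨hf, rfl⟩
  refine ⟨(P, f), theUnique_eq_some (mem_decomposeRel.1 hmem) fun d hd => ?_, hmem⟩
  have := Submodule.sub_mem _ (mem_decomposeRel.2 hd) hmem
  rw [Prod.mk_sub_mk, sub_self] at this
  exact sub_eq_zero.1 (decomposeRel_functional hQ this)

end Decompose

/-! ### The bases of the images of the polar spaces -/

theorem IsShiftless.isCoprime_of_notMem {ι : Type*} {Q : ι → K[X]} (hQ : IsShiftless Q)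
    {S : Finset ι} {F : K[X]} (hS : HasShiftFactorization S Q F) {i : ι} (hi : i ∉ S) (j : ℤ) :
    IsCoprime (sh j (Q i)) F := by
  obtain ⟨c, H, e, hc, -, rfl⟩ := hS
  refine IsCoprime.mul_right ?_ (IsCoprime.prod_right fun k hk => IsCoprime.prod_right fun h _ =>
    IsCoprime.pow_right (hQ.isCoprime_sh (Or.inl ?_)))
  · exact isCoprime_one_right.of_isCoprime_of_dvd_right (isUnit_C.2 hc.isUnit).dvd
  · rintro rfl
    exact hi hk

theorem polarSpace_le_degLT {Q : K[X]} (hQ : ShiftCoprime Q) : polarSpace Q ≤ degLT K 0 := by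
  refine Submodule.span_le.2 ?_
  rintro _ ⟨h, s, l, -, hl, rfl⟩
  refine Or.inr ?_
  rw [← toRat_pow, intDegree_div_eq (pow_ne_zero _ X_ne_zero) (pow_ne_zero _ (hQ.sh_ne_zero _)),
    natDegree_X_pow, natDegree_pow, natDegree_sh]
  omega

section Single

variable {p : ℕ → K[X]} {r : ℕ} {Q : K[X]}

/-- The fraction `n^l / Q(n-j)^s` with index `(j, s, l)`. -/
def fraction (Q : K[X]) (t : ℤ × ℕ × ℕ) : RatFunc K :=
  toRat (X ^ t.2.2) / toRat (sh t.1 Q) ^ t.2.1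

theorem mem_generatorIndices {t : ℤ × ℕ × ℕ} : t ∈ generatorIndices p r Q ↔
    1 ≤ t.2.1 ∧ t.2.2 < t.2.1 * Q.natDegree ∧ t.2.1 ≤ cancelOrder p r Q t.1 := by
  refine and_congr Iff.rfl (and_congr Iff.rfl ?_)
  rw [cancelOrder]
  split_ifs with h
  · simp [h, not_le.2 h]
  · simp [h, not_lt.1 h]

theorem finite_generatorIndices (hQ : ShiftCoprime Q) (hp0 : p 0 ≠ 0) (hpr : p r ≠ 0) :
    (generatorIndices p r Q).Finite := by
  have hJ : {j : ℤ | cancelOrder p r Q j ≠ 0}.Finite := by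
    refine ((hQ.finite_not_isCoprime hp0).union ((hQ.finite_not_isCoprime hpr).preimage
      (f := fun j : ℤ => j + r) (add_left_injective _).injOn)).subset fun j hj => ?_
    by_contra hcop
    simp only [Set.mem_union, Set.mem_preimage, Set.mem_ofPred_eq, not_or, not_not] at hcop
    refine hj ?_
    rw [cancelOrder]
    split_ifs
    · exact ord_eq_zero_of_isCoprime hQ hcop.1
    · exact ord_eq_zero_of_isCoprime hQ hcop.2
  refine (hJ.biUnion (t := fun j => {j} ×ˢ (Set.Iic (cancelOrder p r Q j) ×ˢ
    Set.Iio (cancelOrder p r Q j * Q.natDegree))) fun j _ => (Set.finite_singleton j).prod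
      ((Set.finite_Iic _).prod (Set.finite_Iio _))).subset ?_
  rintro ⟨j, s, l⟩ ht
  obtain ⟨h1, h2, h3⟩ := mem_generatorIndices.1 ht
  simp only at h1 h2 h3
  refine Set.mem_biUnion (x := j) (show cancelOrder p r Q j ≠ 0 by omega) ⟨rfl, h3, ?_⟩
  exact h2.trans_le (Nat.mul_le_mul_right _ h3)

theorem div_pow_mem_span_fraction {j : ℤ} {s : ℕ} (hs : s ≤ cancelOrder p r Q j) {A : K[X]}
    (hA : A.degree < ((s * Q.natDegree : ℕ) : WithBot ℕ)) :
    toRat A / toRat (sh j Q) ^ s ∈ Submodule.span K (fraction Q '' generatorIndices p r Q) := by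
  by_cases hA0 : A = 0
  · simp [hA0]
  rw [degree_eq_natDegree hA0, Nat.cast_lt] at hA
  have hs1 : 1 ≤ s := by
    by_contra! h
    obtain rfl : s = 0 := by omega
    simp at hA
  rw [A.as_sum_range_C_mul_X_pow, toRat, map_sum, Finset.sum_div]
  refine Submodule.sum_mem _ fun l hl => ?_
  change toRat (C (A.coeff l) * X ^ l) / _ ∈ _
  rw [toRat_C_mul, smul_div_assoc]
  refine Submodule.smul_mem _ _ (Submodule.subset_span ⟨(j, s, l), ?_, rfl⟩)
  exact mem_generatorIndices.2
    ⟨hs1, (Nat.lt_succ_iff.1 (Finset.mem_range.1 hl)).trans_lt hA, hs⟩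

/-- `K_Q(n)` is spanned by the fractions used by the weak reduction and the finitely many fractions
that index the generators. -/
theorem polarSpace_le_sup (hQ : ShiftCoprime Q) : polarSpace Q ≤
    reducerSpace p r Q ⊔ Submodule.span K (fraction Q '' generatorIndices p r Q) := by
  refine Submodule.span_le.2 ?_
  rintro _ ⟨h, s, l, -, hl, rfl⟩
  set j := -h
  have hdeg : (X ^ l : K[X]).degree < ((s * Q.natDegree : ℕ) : WithBot ℕ) :=
    (degree_X_pow_le l).trans_lt (by exact_mod_cast hl)
  rcases le_or_gt s (cancelOrder p r Q j) with hle | hlt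
  · exact Submodule.mem_sup_right (div_pow_mem_span_fraction hle hdeg)
  obtain ⟨k, rfl⟩ := Nat.exists_eq_add_of_le' hlt.le
  set c := cancelOrder p r Q j
  have hF := hQ.sh_ne_zero j
  have hF' := toRat_ne_zero hF
  -- division by `Q(n-j)^k` splits the pole of order `k + c`
  have hdiv : toRat (X ^ l) / toRat (sh j Q) ^ (k + c) =
      toRat (X ^ l % sh j Q ^ k) / toRat (sh j Q) ^ (k + c) +
        toRat (X ^ l / sh j Q ^ k) / toRat (sh j Q) ^ c := by
    have h1 := congrArg toRat (EuclideanDomain.div_add_mod (X ^ l) (sh j Q ^ k))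
    rw [toRat_add, toRat_mul, toRat_pow (sh j Q)] at h1
    rw [← h1, pow_add]
    field_simp
    ring
  change toRat (X ^ l) / toRat (sh j Q) ^ (k + c) ∈ reducerSpace p r Q ⊔ _
  rw [hdiv]
  refine Submodule.add_mem _ (Submodule.mem_sup_left (Submodule.mem_iSup_of_mem j
    (div_mem_polarAt j c ?_))) (Submodule.mem_sup_right (div_pow_mem_span_fraction le_rfl ?_))
  · have := degree_mod_pow_lt hF (X ^ l) k
    rwa [natDegree_sh] at this
  · by_cases h0 : X ^ l / sh j Q ^ k = 0
    · rw [h0, degree_zero]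
      exact WithBot.bot_lt_coe _
    · have h1 := degree_add_div (pow_ne_zero k hF)
        (not_lt.1 (mt (Polynomial.div_eq_zero_iff (pow_ne_zero k hF)).2 h0))
      rw [degree_eq_natDegree (pow_ne_zero k hF), degree_eq_natDegree h0, degree_X_pow,
        natDegree_pow, natDegree_sh, ← Nat.cast_add, Nat.cast_inj] at h1
      rw [degree_eq_natDegree h0, Nat.cast_lt]
      change _ < c * Q.natDegree
      change l < (k + c) * Q.natDegree at hl
      rw [add_mul] at hl
      omega

/-- The echelon basis `B_Q` is computed. The coordinates of the weak reductions of `L* f`,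
`f ∈ K_Q(n)`, are in its span, and its elements are in `L*(K_Q(n))`. -/
theorem exists_polarBasis (hQ : ShiftCoprime Q) (hp0 : p 0 ≠ 0) (hpr : p r ≠ 0)
    {φ : RatFunc K →ₗ[K] RatFunc K}
    (hφ : ∀ R, weakPolar p r Q R = Part.some (φ R) ∧
      ∀ R', (R, R') ∈ weakPolarRel p r Q ↔ φ R = R')
    {κ : RatFunc K →ₗ[K] (Mon Q →₀ K)}
    (hκ : ∀ R ∈ fractionSpace Q, coords Q R = Part.some (κ R) ∧ ofCoordsₗ Q (κ R) = R) :
    ∃ B, polarBasis p r Q = Part.some B ∧ IsEchelon B ∧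
      (∀ f ∈ polarSpace Q, κ (φ (adjointOp p r f)) ∈ Submodule.span K {b | b ∈ B}) ∧
      ∀ b ∈ B, ∃ f ∈ polarSpace Q, ofCoordsₗ Q b = adjointOp p r f := by
  set L := adjointOp p r
  have hφT : ∀ T ∈ reducerSpace p r Q, φ (L T) = 0 := fun T hT =>
    ((hφ _).2 _).1 (mem_weakPolarRel.2 ⟨Submodule.zero_mem _, T, hT, (sub_zero _).symm⟩)
  have hφL : ∀ f ∈ polarSpace Q, ∃ g ∈ polarSpace Q, φ (L f) = L g := fun f hf => by
    obtain ⟨-, T, hT, h⟩ := mem_weakPolarRel.1 (((hφ (L f)).2 _).2 rfl)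
    refine ⟨f - T, Submodule.sub_mem _ hf (reducerSpace_le_polarSpace p r Q hT), ?_⟩
    rw [map_sub]
    change L T = _ at h
    rw [h, sub_sub_cancel]
  have hmem : ∀ f ∈ polarSpace Q, φ (L f) ∈ fractionSpace Q := fun f hf => by
    obtain ⟨g, hg, h⟩ := hφL f hf
    rw [h]
    exact adjointOp_mem_fractionSpace hQ p r (Submodule.mem_sup_right hg)
  have hfrac : ∀ t ∈ generatorIndices p r Q, fraction Q t ∈ polarSpace Q := fun t ht => by
    obtain ⟨-, h2, -⟩ := mem_generatorIndices.1 ht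
    exact div_pow_mem_polarSpace _ ((degree_X_pow_le _).trans_lt (by exact_mod_cast h2))
  have hfin := finite_generatorIndices (p := p) (r := r) hQ hp0 hpr
  set ts := hfin.toFinset.toList with hts
  have hmemts : ∀ t, t ∈ ts ↔ t ∈ generatorIndices p r Q := fun t => by simp [hts]
  set g : Fin ts.length → (Mon Q →₀ K) := fun k => κ (φ (L (fraction Q (ts.get k)))) with hg
  have hrange : {b | b ∈ List.ofFn g} =
      (fun t => κ (φ (L (fraction Q t)))) '' generatorIndices p r Q := by
    ext b
    simp only [Set.mem_ofPred_eq, List.mem_ofFn', Set.mem_image, ← hmemts]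
    constructor
    · rintro ⟨k, rfl⟩
      exact ⟨_, List.get_mem ts k, rfl⟩
    · rintro ⟨t, ht, rfl⟩
      obtain ⟨k, rfl⟩ := List.mem_iff_get.1 ht
      exact ⟨k, rfl⟩
  have hspan := span_echelon (List.ofFn g)
  rw [hrange] at hspan
  refine ⟨echelon (List.ofFn g), ?_, isEchelon_echelon _, ?_, ?_⟩
  · have hrun : (runAll fun k : Fin ts.length => generator p r Q (ts.get k)) = Part.some g := by
      refine runAll_eq_some fun k => ?_
      have ht := (hmemts _).1 (List.get_mem ts k)
      rw [generator, (hφ _).1, Part.bind_some]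
      exact (hκ _ (hmem _ (hfrac _ ht))).1
    rw [polarBasis, enumerate_eq_some hfin, Part.bind_some, hrun, Part.map_some]
  · intro f hf
    have hle : reducerSpace p r Q ⊔ Submodule.span K (fraction Q '' generatorIndices p r Q) ≤
        (Submodule.span K {b | b ∈ echelon (List.ofFn g)}).comap (κ ∘ₗ φ ∘ₗ L) := by
      refine sup_le (fun T hT => ?_) (Submodule.span_le.2 ?_)
      · change κ (φ (L T)) ∈ Submodule.span K _
        rw [hφT T hT, map_zero]
        exact Submodule.zero_mem _
      · rintro _ ⟨t, ht, rfl⟩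
        change κ (φ (L (fraction Q t))) ∈ Submodule.span K _
        rw [hspan]
        exact Submodule.subset_span ⟨t, ht, rfl⟩
    exact hle (polarSpace_le_sup hQ hf)
  · intro b hb
    have hle : Submodule.span K {b | b ∈ echelon (List.ofFn g)} ≤
        ((polarSpace Q).map L).comap (ofCoordsₗ Q) := by
      rw [hspan, Submodule.span_le]
      rintro _ ⟨t, ht, rfl⟩
      change ofCoordsₗ Q (κ (φ (L (fraction Q t)))) ∈ (polarSpace Q).map L
      rw [(hκ _ (hmem _ (hfrac t ht))).2]
      obtain ⟨g, hg, h⟩ := hφL _ (hfrac t ht)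
      exact ⟨g, hg, h.symm⟩
    obtain ⟨f, hf, h⟩ := hle (Submodule.subset_span hb)
    exact ⟨f, hf, h.symm⟩

theorem mem_polynomialElements {B : List (Mon Q →₀ K)} {P : K[X]} :
    P ∈ polynomialElements Q B ↔ ∃ b ∈ B, ofCoordsₗ Q b = toRat P := by
  simp only [polynomialElements, List.mem_map, List.mem_filter, decide_eq_true_eq]
  constructor
  · rintro ⟨R, ⟨⟨b, hb, rfl⟩, hden⟩, rfl⟩
    exact ⟨b, hb, exists_toRat_of_denom_isUnit (by rw [ofCoordsₗ_apply, hden]; exact isUnit_one)⟩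
  · rintro ⟨b, hb, h⟩
    rw [ofCoordsₗ_apply] at h
    exact ⟨_, ⟨⟨b, hb, rfl⟩, by rw [h]; exact RatFunc.denom_algebraMap P⟩, by
      rw [h]; exact RatFunc.num_algebraMap P⟩

theorem polyMon_lt_polarMon {j : ℤ} {s : ℕ} {l : Fin Q.natDegree} {k : ℕ} :
    polyMon Q k < polarMon Q j s l := Sum.Lex.inl_lt_inr _ _

/-- A polynomial is reduced by the polynomial elements of a basis only, the polar monomials being
larger than the polynomial ones. -/
theorem reduceBy_embedPoly (B : List (Mon Q →₀ K)) (P : K[X]) :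
    ∃ P' ∈ Submodule.span K {P | P ∈ polynomialElements Q B},
      ofCoordsₗ Q (reduceBy (embedPoly Q (polyCoords P)) B) = toRat (P - P') := by
  suffices h : ∃ w, reduceBy (embedPoly Q (polyCoords P)) B = embedPoly Q w ∧
      polyCoords P - w ∈ Submodule.span K {u | embedPoly Q u ∈ B} by
    obtain ⟨w, hw, hmem⟩ := h
    refine ⟨P - ofPolyCoords w, ?_, ?_⟩
    · have hle : Submodule.span K {u | embedPoly Q u ∈ B} ≤
          (Submodule.span K {P | P ∈ polynomialElements Q B}).comap
            (Polynomial.basisMonomials K).repr.symm.toLinearMap :=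
        Submodule.span_le.2 fun u hu => Submodule.subset_span
          (mem_polynomialElements.2 ⟨_, hu, ofCoordsₗ_embedPoly Q u⟩)
      have h1 : ofPolyCoords (polyCoords P - w) ∈
          Submodule.span K {P | P ∈ polynomialElements Q B} := hle hmem
      rwa [ofPolyCoords, map_sub, ← ofPolyCoords, ← ofPolyCoords, ofPolyCoords_polyCoords] at h1
    · rw [hw, ofCoordsₗ_embedPoly, sub_sub_cancel]
  generalize polyCoords P = v
  induction B generalizing v with
  | nil => exact ⟨v, rfl, by simp⟩
  | cons b B ih =>
    have hsub : Submodule.span K {u | embedPoly Q u ∈ B} ≤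
        Submodule.span K {u | embedPoly Q u ∈ b :: B} :=
      Submodule.span_mono fun u hu => List.mem_cons_of_mem b hu
    obtain ⟨v', hv', hmem⟩ : ∃ v', cancelLead (embedPoly Q v) b = embedPoly Q v' ∧
        v - v' ∈ Submodule.span K {u | embedPoly Q u ∈ b :: B} := by
      by_cases hb : ∃ u, b = embedPoly Q u
      · obtain ⟨u, rfl⟩ := hb
        obtain ⟨c, hc⟩ := Submodule.mem_span_singleton.1
          (sub_cancelLead_mem (embedPoly Q v) (embedPoly Q u))
        refine ⟨v - c • u, ?_, ?_⟩
        · rw [map_sub, map_smul, hc, sub_sub_cancel]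
        · rw [sub_sub_cancel]
          exact Submodule.smul_mem _ _ (Submodule.subset_span List.mem_cons_self)
      · refine ⟨v, cancelLead_eq_self fun m hm => ?_, by simp⟩
        rcases mon_cases m with ⟨k, rfl⟩ | ⟨j, s, l, rfl⟩
        · refine absurd (exists_embedPoly fun j s l => apply_eq_zero_of_lead_lt ?_) hb
          rw [hm]
          exact WithBot.coe_lt_coe.2 polyMon_lt_polarMon
        · exact embedPoly_polarMon Q v j s l
    obtain ⟨w, hw, hmem'⟩ := ih v'
    refine ⟨w, ?_, ?_⟩
    · rw [← hw, ← hv']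
      rfl
    · have := Submodule.add_mem _ hmem (hsub hmem')
      rwa [sub_add_sub_cancel] at this

end Single

/-! ### The reduction algorithm -/

section Reduction

variable {p : ℕ → K[X]} {r : ℕ} {sig : ℤ} {q : K[X]} {ι : Type*} {Q : ι → K[X]} {S : Finset ι}

/-- The polynomials in the bases `B_{Q_i}`, `i ∈ S`. -/
def basisPolynomials (Q : ι → K[X]) (S : Finset ι) (B : ∀ i : S, List (Mon (Q i) →₀ K)) :
    Set K[X] := {P | ∃ i : S, P ∈ polynomialElements (Q i) (B i)}

/-- The reduction of the component of a rational function in `K_{Q_i}(n)` is a linear map.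
If `L* f` has polynomial part `P` and component `T`, then `T` is reduced to `-P`, up to polynomials
of the basis `B_{Q_i}`: indeed `[T] = [L* f] - P`, and `[L* f]` is in the span of the basis, or zero
if `i ∉ S`. -/
theorem exists_reducePolar (hQ : IsShiftless Q)
    (hp0 : p 0 ≠ 0) (hpr : p r ≠ 0) (h0 : ∀ i, CofactorCoprime (Q i) (p 0))
    (hr : ∀ i, CofactorCoprime (Q i) (p r))
    (hnot : ∀ i ∉ S, ∀ j, cancelOrder p r (Q i) j = 0) :
    ∃ (B : ∀ i : S, List (Mon (Q i) →₀ K)) (ρ : ι → RatFunc K →ₗ[K] RatFunc K),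
      (∀ i : S, polarBasis p r (Q i) = Part.some (B i)) ∧
      (∀ P ∈ basisPolynomials Q S B, ∃ i, ∃ f ∈ polarSpace (Q i), toRat P = adjointOp p r f) ∧
      (∀ i, ∀ R ∈ polarSpace (Q i), reducePolar p r Q S B i R = Part.some (ρ i R) ∧
        R - ρ i R ∈ LinearMap.range (adjointOp p r)) ∧
      ∀ i, ∀ f ∈ polarSpace (Q i), ∀ P : K[X], ∀ T ∈ polarSpace (Q i),
        adjointOp p r f = toRat P + T →
        ∃ P' ∈ Submodule.span K (basisPolynomials Q S B), toRat P + ρ i T = toRat P' := by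
  have hcop := fun i => hQ.shiftCoprime i
  choose φ hφ using fun i => exists_weakPolar (p := p) (r := r) (hcop i) (h0 i) (hr i)
  choose κ hκ using fun i => exists_coordsₗ (hcop i)
  choose B hB hech hspan hlift using fun i : ι =>
    exists_polarBasis (hcop i) hp0 hpr (hφ i) (hκ i).2
  have hφrange : ∀ i R, ∃ T ∈ polarSpace (Q i), R - φ i R = adjointOp p r T := fun i R => by
    obtain ⟨-, T, hT, h⟩ := mem_weakPolarRel.1 (((hφ i R).2 _).2 rfl)
    exact ⟨T, reducerSpace_le_polarSpace p r _ hT, h.symm⟩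
  have hφmem : ∀ i, ∀ R ∈ fractionSpace (Q i), φ i R ∈ fractionSpace (Q i) := fun i R hR => by
    obtain ⟨T, hT, h⟩ := hφrange i R
    rw [← sub_sub_cancel R (φ i R), h]
    exact Submodule.sub_mem _ hR
      (adjointOp_mem_fractionSpace (hcop i) p r (Submodule.mem_sup_right hT))
  have hφpoly : ∀ i P, φ i (toRat P) = toRat P := fun i P => by
    refine ((hφ i _).2 _).1 (mem_weakPolarRel.2 ⟨mem_polarReduced.2 fun j _ =>
      toRat_mem_regularAt _ _, 0, Submodule.zero_mem _, ?_⟩)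
    rw [map_zero, sub_self]
  have hφzero : ∀ i ∉ S, ∀ f ∈ polarSpace (Q i), φ i (adjointOp p r f) = 0 := by
    intro i hi f hf
    refine ((hφ i _).2 _).1 (mem_weakPolarRel.2 ⟨Submodule.zero_mem _, f, ?_, (sub_zero _).symm⟩)
    rw [polarSpace_eq_iSup] at hf
    rw [reducerSpace]
    simpa only [hnot i hi] using hf
  have hκpoly : ∀ i P, κ i (toRat P) = embedPoly (Q i) (polyCoords P) := fun i P => by
    rw [← ofPolyCoords_polyCoords P, ← ofCoordsₗ_embedPoly, (hκ i).1, ofPolyCoords_polyCoords]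
  classical
  obtain ⟨ρ, hρS, hρ⟩ : ∃ ρ : ι → RatFunc K →ₗ[K] RatFunc K,
      (∀ i ∈ S, ρ i = ofCoordsₗ (Q i) ∘ₗ reduceByₗ (B i) ∘ₗ κ i ∘ₗ φ i) ∧ ∀ i ∉ S, ρ i = φ i :=
    ⟨fun i => if i ∈ S then ofCoordsₗ (Q i) ∘ₗ reduceByₗ (B i) ∘ₗ κ i ∘ₗ φ i else φ i,
      fun i hi => if_pos hi, fun i hi => if_neg hi⟩
  refine ⟨fun i => B i, ρ, fun i => hB i, ?_, ?_, ?_⟩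
  · rintro P ⟨i, hP⟩
    obtain ⟨b, hb, h⟩ := mem_polynomialElements.1 hP
    obtain ⟨f, hf, h'⟩ := hlift i b hb
    exact ⟨i, f, hf, h.symm.trans h'⟩
  · intro i R hR
    have hR' := hφmem i R (Submodule.mem_sup_right hR)
    obtain ⟨T, hT, hRT⟩ := hφrange i R
    rw [reducePolar, (hφ i R).1, Part.bind_some]
    by_cases hi : i ∈ S
    · rw [dif_pos hi, hρS i hi, ((hκ i).2 _ hR').1, Part.map_some]
      refine ⟨by rw [← reduceByₗ_apply]; rfl, ?_⟩
      set v := κ i (φ i R) with hv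
      have h1 := ((hκ i).2 _ hR').2
      have hle : Submodule.span K {b | b ∈ B i} ≤
          (LinearMap.range (adjointOp p r)).comap (ofCoordsₗ (Q i)) :=
        Submodule.span_le.2 fun b hb => by
          obtain ⟨f, -, h⟩ := hlift i b hb
          exact ⟨f, h.symm⟩
      have h2 : ofCoordsₗ (Q i) (v - reduceBy v (B i)) ∈ LinearMap.range (adjointOp p r) :=
        hle (sub_reduceBy_mem v (B i))
      rw [map_sub, h1] at h2
      have h3 := Submodule.add_mem _ (LinearMap.mem_range_self (adjointOp p r) T) h2
      rw [← hRT, sub_add_sub_cancel] at h3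
      simpa [← hv, reduceByₗ_apply] using h3
    · rw [dif_neg hi, hρ i hi]
      exact ⟨rfl, T, hRT.symm⟩
  · intro i f hf P T hT hfT
    have hTφ : φ i T = φ i (adjointOp p r f) - toRat P := by
      rw [hfT, map_add, hφpoly, add_sub_cancel_left]
    by_cases hi : i ∈ S
    · obtain ⟨P', hP', h⟩ := reduceBy_embedPoly (B i) P
      refine ⟨P', Submodule.span_mono
        (show {P | P ∈ polynomialElements (Q i) (B i)} ⊆ basisPolynomials Q S fun i => B i from
          fun x hx => ⟨⟨i, hi⟩, hx⟩) hP', ?_⟩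
      rw [hρS i hi]
      change toRat P + ofCoordsₗ (Q i) (reduceByₗ (B i) (κ i (φ i T))) = toRat P'
      rw [hTφ, map_sub, map_sub, reduceByₗ_apply, reduceByₗ_apply,
        (hech i).reduceBy_eq_zero (hspan i f hf), hκpoly, zero_sub, map_neg, h, toRat_sub]
      ring
    · refine ⟨0, Submodule.zero_mem _, ?_⟩
      rw [hρ i hi, hTφ, hφzero i hi f hf, toRat_zero]
      ring

/-- The basis `B_pol` is computed. Its span consists of the polynomials in the bases `B_{Q_i}` and
the weak reductions of the `L*(n^s)`, `q(s) = 0`. -/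
theorem exists_polynomialBasis [CharZero K] (hq : q ≠ 0) {ψ : K[X] →ₗ[K] K[X]}
    (hψ : ∀ P, weakPoly p r sig q P = Part.some (ψ P)) (B : ∀ i : S, List (Mon (Q i) →₀ K)) :
    ∃ Bpol, polynomialBasis p r sig q Q S B = Part.some Bpol ∧ IsEchelon Bpol ∧
      Submodule.span K {b | b ∈ Bpol} = Submodule.span K (polyCoords '' (basisPolynomials Q S B ∪
        {P | ∃ s : ℕ, q.eval (s : K) = 0 ∧ P = ψ (adjointOpPoly p r (X ^ s))})) := by
  have hfin : {s : ℕ | q.eval (s : K) = 0}.Finite :=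
    (q.finite_setOfPred_isRoot hq).preimage (f := fun s : ℕ => (s : K)) Nat.cast_injective.injOn
  set ss := hfin.toFinset.toList with hss
  have hmemss : ∀ s, s ∈ ss ↔ q.eval (s : K) = 0 := fun s => by simp [hss]
  have hrun : (runAll fun k : Fin ss.length =>
      weakPoly p r sig q (adjointOpPoly p r (X ^ ss.get k))) =
      Part.some fun k => ψ (adjointOpPoly p r (X ^ ss.get k)) := runAll_eq_some fun k => hψ _
  refine ⟨echelon ((S.attach.toList.flatMap (fun i : S => polynomialElements (Q i) (B i)) ++
    List.ofFn fun k : Fin ss.length => ψ (adjointOpPoly p r (X ^ ss.get k))).map polyCoords),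
    ?_, isEchelon_echelon _, ?_⟩
  · rw [polynomialBasis, enumerate_eq_some hfin, Part.bind_some, hrun, Part.map_some]
  · rw [span_echelon]
    congr 1
    ext v
    simp only [Set.mem_ofPred_eq, List.mem_map, List.mem_append, List.mem_flatMap,
      Finset.mem_toList, Finset.mem_attach, true_and, List.mem_ofFn', Set.mem_image, Set.mem_union]
    refine exists_congr fun P => and_congr (or_congr Iff.rfl ?_) Iff.rfl
    constructor
    · rintro ⟨k, rfl⟩
      exact ⟨_, (hmemss _).1 (List.get_mem ss k), rfl⟩
    · rintro ⟨s, hs, rfl⟩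
      obtain ⟨k, rfl⟩ := List.mem_iff_get.1 ((hmemss s).2 hs)
      exact ⟨k, rfl⟩

theorem sub_polyPart_mem_degLT (R : RatFunc K) : R - toRat (polyPart R) ∈ degLT K 0 := by
  have hd := R.denom_ne_zero
  have h := congrArg toRat (EuclideanDomain.div_add_mod R.num R.denom)
  have heq : R - toRat (polyPart R) = toRat (R.num % R.denom) / toRat R.denom := by
    rw [eq_div_iff (toRat_ne_zero hd), sub_mul]
    have h2 : R * toRat R.denom = toRat R.num := by
      rw [← eq_div_iff (toRat_ne_zero hd)]
      exact (RatFunc.num_div_denom R).symm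
    rw [toRat_add, toRat_mul] at h
    rw [h2, ← h, polyPart]
    ring
  rw [heq]
  by_cases h0 : R.num % R.denom = 0
  · rw [h0, toRat_zero, zero_div]
    exact Submodule.zero_mem _
  · refine Or.inr ?_
    rw [intDegree_div_eq h0 hd]
    have := natDegree_lt_natDegree h0 (EuclideanDomain.mod_lt R.num hd)
    omega

theorem exists_polyPart (K : Type*) [Field K] :
    ∃ π : RatFunc K →ₗ[K] K[X], (∀ R, polyPart R = π R) ∧ ∀ P, π (toRat P) = P := by
  obtain ⟨π, hπ⟩ := exists_linearMap_of_rel (fun R : RatFunc K => Part.some (polyPart R))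
    ((degLT K 0).comap (LinearMap.fst K (RatFunc K) K[X] - toRatₗ K ∘ₗ
      LinearMap.snd K (RatFunc K) K[X]))
    (fun R => ⟨_, rfl, sub_polyPart_mem_degLT R⟩) (fun P hP => by
      have hP : 0 - toRat P ∈ degLT K 0 := hP
      rw [zero_sub, Submodule.neg_mem_iff] at hP
      exact eq_zero_of_toRat_mem_degLT hP le_rfl)
  refine ⟨π, fun R => Part.some_injective (hπ R).1, fun P => ((hπ _).2 _).1 ?_⟩
  change toRat P - toRat P ∈ degLT K 0
  rw [sub_self]
  exact Submodule.zero_mem _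

end Reduction

theorem reducePolar_sum {p : ℕ → K[X]} {r : ℕ} {ι : Type*} {Q : ι → K[X]} {S : Finset ι}
    {B : ∀ i : S, List (Mon (Q i) →₀ K)} {ρ : ι → RatFunc K →ₗ[K] RatFunc K} {f : ι →₀ RatFunc K}
    (h : ∀ i, reducePolar p r Q S B i (f i) = Part.some (ρ i (f i))) :
    ∃ g : f.support → RatFunc K,
      (runAll fun i : f.support => reducePolar p r Q S B i (f i)) = Part.some g ∧
      ∑ i, g i = Finsupp.lsum K ρ f := by
  refine ⟨fun i => ρ i (f i), runAll_eq_some fun i => h i, ?_⟩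
  rw [Finsupp.lsum_apply, Finsupp.sum]
  exact Finset.sum_coe_sort f.support fun i => ρ i (f i)

/-- Everything the algorithm does to a rational function is linear, it changes the function by
elements of the image of `L*`, and it maps `L* P`, for a polynomial `P`, and `L* f`, for
`f ∈ K_{Q_i}(n)`, to zero. -/
theorem exists_reduce [CharZero K] {p : ℕ → K[X]} {r : ℕ} (hp0 : p 0 ≠ 0) (hpr : p r ≠ 0)
    {ι : Type*} {Q : ι → K[X]} {S : Finset ι} (hQ : IsShiftless Q) (hexh : Exhausts Q)
    (h0 : ∀ i, CofactorCoprime (Q i) (p 0)) (hr : ∀ i, CofactorCoprime (Q i) (p r))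
    (hnot : ∀ i ∉ S, ∀ j, cancelOrder p r (Q i) j = 0) :
    ∃ Φ : RatFunc K →ₗ[K] RatFunc K, (∀ R, reduce p r Q S R = Part.some (Φ R)) ∧
      IsCanonicalForm (adjointOp p r) Φ := by
  obtain ⟨sig, q, hsig⟩ := exists_isIndicial (r := r) hp0
  obtain ⟨ψ, hψ⟩ := exists_weakPoly hsig
  obtain ⟨δ, hδ⟩ := exists_decompose hQ hexh
  obtain ⟨π, hπ, hπpoly⟩ := exists_polyPart K
  obtain ⟨B, ρ, hB, hBL, hρ, hρL⟩ := exists_reducePolar hQ hp0 hpr h0 hr hnot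
  obtain ⟨Bpol, hBpol, hech, hspan⟩ :=
    exists_polynomialBasis (Q := Q) (S := S) hsig.1 (fun P => (hψ P).1) B
  set L := adjointOp p r with hL
  -- the sum of the reduced components
  set Ψ : RatFunc K →ₗ[K] RatFunc K :=
    ((toRatₗ K).coprod (Finsupp.lsum K ρ)) ∘ₗ δ with hΨ
  -- the reduction of polynomials
  set χ : K[X] →ₗ[K] K[X] := (Polynomial.basisMonomials K).repr.symm.toLinearMap ∘ₗ
    reduceByₗ Bpol ∘ₗ (Polynomial.basisMonomials K).repr.toLinearMap ∘ₗ ψ with hχ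
  have hχ_apply : ∀ P, χ P = ofPolyCoords (reduceBy (polyCoords (ψ P)) Bpol) := fun P => by
    rw [← reduceByₗ_apply]
    rfl
  have hΨ_apply : ∀ R, Ψ R = toRat (δ R).1 + Finsupp.lsum K ρ (δ R).2 := fun R => rfl
  have hψL : ∀ P, ∃ T ∈ nonRootSpace q, P - ψ P = adjointOpPoly p r T := fun P =>
    (mem_weakPolyRel.1 (((hψ P).2 _).2 rfl)).2
  have hLpoly : ∀ P, toRat (adjointOpPoly p r P) ∈ LinearMap.range L := fun P =>
    ⟨_, (toRat_adjointOpPoly p r P).symm⟩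
  -- the span of `B_pol` is contained in the image of `L*`
  have hspanL : Submodule.span K {b | b ∈ Bpol} ≤ (LinearMap.range L).comap
      (toRatₗ K ∘ₗ (Polynomial.basisMonomials K).repr.symm.toLinearMap) := by
    rw [hspan, Submodule.span_le]
    rintro _ ⟨P, hP, rfl⟩
    change toRat (ofPolyCoords (polyCoords P)) ∈ LinearMap.range L
    rw [ofPolyCoords_polyCoords]
    rcases hP with hP | ⟨s, -, rfl⟩
    · obtain ⟨i, f, -, h⟩ := hBL P hP
      exact ⟨f, h.symm⟩
    · obtain ⟨T, -, hT⟩ := hψL (adjointOpPoly p r (X ^ s))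
      rw [← sub_sub_cancel (adjointOpPoly p r (X ^ s)) (ψ _), hT, toRat_sub]
      exact Submodule.sub_mem _ (hLpoly _) (hLpoly _)
  have hχ_range : ∀ P, toRat P - toRat (χ P) ∈ LinearMap.range L := fun P => by
    obtain ⟨T, -, hT⟩ := hψL P
    have h1 : toRat (ofPolyCoords (polyCoords (ψ P) - reduceBy (polyCoords (ψ P)) Bpol)) ∈
        LinearMap.range L := hspanL (sub_reduceBy_mem _ _)
    rw [ofPolyCoords, map_sub, ← ofPolyCoords, ← ofPolyCoords, ofPolyCoords_polyCoords,
      ← hχ_apply, toRat_sub] at h1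
    have h2 := Submodule.add_mem _ (hLpoly T) h1
    rwa [← hT, toRat_sub, sub_add_sub_cancel] at h2
  have hχ_zero : ∀ P, ψ P ∈ Submodule.span K (basisPolynomials Q S B ∪
      {P | ∃ s : ℕ, q.eval (s : K) = 0 ∧ P = ψ (adjointOpPoly p r (X ^ s))}) → χ P = 0 := by
    intro P hP
    have hmem : polyCoords (ψ P) ∈ Submodule.span K {b | b ∈ Bpol} := by
      have := Submodule.mem_map_of_mem (f := (Polynomial.basisMonomials K).repr.toLinearMap) hP
      rw [Submodule.map_span] at this
      rw [hspan]
      exact this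
    rw [hχ_apply, hech.reduceBy_eq_zero hmem, ofPolyCoords, map_zero]
  -- an element of `L*(K_Q(n))` has degree less than `σ`
  have hψ_fix : ∀ P ∈ Submodule.span K (basisPolynomials Q S B), ψ P = P := by
    intro P hP
    have hle : Submodule.span K (basisPolynomials Q S B) ≤ (degLT K sig).comap (toRatₗ K) := by
      refine Submodule.span_le.2 fun P hP => ?_
      obtain ⟨i, f, hf, h⟩ := hBL P hP
      have := hsig.adjointOp_mem_degLT (polarSpace_le_degLT (hQ.shiftCoprime i) hf)
      rw [zero_add] at this
      change toRat P ∈ degLT K sig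
      rwa [h]
    refine ((hψ P).2 P).1 (mem_weakPolyRel.2 ⟨fun d hd _ => ?_, 0, Submodule.zero_mem _, ?_⟩)
    · exact toRat_mem_degLT_iff_coeff.1 (hle hP) d hd
    · simp [adjointOpPoly, sh_zero_right]
  refine ⟨toRatₗ K ∘ₗ χ ∘ₗ π ∘ₗ Ψ + (Ψ - toRatₗ K ∘ₗ π ∘ₗ Ψ), fun R => ?_, fun R => ⟨?_, ?_⟩⟩
  · have hd := mem_decomposeRel.1 (((hδ R).2 _).2 rfl)
    obtain ⟨g, hg, hgsum⟩ := reducePolar_sum (B := B) fun i => (hρ i _ (hd.1 i)).1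
    have hrun : (runAll fun i : S => polarBasis p r (Q i)) = Part.some B := runAll_eq_some hB
    rw [reduce, indicialData_eq_some hsig, Part.bind_some, hrun, Part.bind_some, hBpol,
      Part.bind_some, reduceWith, (hδ R).1, Part.bind_some, hg, Part.bind_some, hgsum, ← hΨ_apply]
    change Part.map (fun P' => toRat (ofPolyCoords (reduceBy (polyCoords P') Bpol)) +
      (Ψ R - toRat (polyPart (Ψ R)))) (weakPoly p r sig q (polyPart (Ψ R))) =
      Part.some (toRat (χ (π (Ψ R))) + (Ψ R - toRat (π (Ψ R))))
    rw [hπ, (hψ _).1, Part.map_some, ← hχ_apply]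
  · -- it suffices to treat polynomials and the elements of the polar spaces
    suffices hker : decomposable Q ≤ LinearMap.ker
        ((toRatₗ K ∘ₗ χ ∘ₗ π ∘ₗ Ψ + (Ψ - toRatₗ K ∘ₗ π ∘ₗ Ψ)) ∘ₗ L) from
      hker (mem_decomposable hQ hexh R)
    have hpoly : ∀ x P, Ψ (L x) = toRat P → χ P = 0 → x ∈ LinearMap.ker
        ((toRatₗ K ∘ₗ χ ∘ₗ π ∘ₗ Ψ + (Ψ - toRatₗ K ∘ₗ π ∘ₗ Ψ)) ∘ₗ L) := by
      intro x P hx hP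
      change toRat (χ (π (Ψ (L x)))) + (Ψ (L x) - toRat (π (Ψ (L x)))) = 0
      rw [hx, hπpoly, hP, toRat_zero, sub_self, add_zero]
    refine sup_le ?_ (iSup_le fun i f hf => ?_)
    · rintro _ ⟨P, rfl⟩
      refine hpoly _ (adjointOpPoly p r P) ?_ (hχ_zero _ ?_)
      · have hδP : δ (L (toRat P)) = (adjointOpPoly p r P, 0) :=
          ((hδ _).2 _).1 (mem_decomposeRel.2 ⟨fun i => Submodule.zero_mem _, by
            rw [Finsupp.sum_zero_index, add_zero, toRat_adjointOpPoly]⟩)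
        rw [toRatₗ_apply, hΨ_apply, hδP, map_zero, add_zero]
      · induction P using Polynomial.induction_on' with
        | add P P' h h' =>
          rw [adjointOpPoly_add, map_add]
          exact Submodule.add_mem _ h h'
        | monomial s c =>
          rw [← C_mul_X_pow_eq_monomial, adjointOpPoly_C_mul, ← smul_eq_C_mul, map_smul]
          refine Submodule.smul_mem _ _ ?_
          by_cases hs : q.eval (s : K) = 0
          · exact Submodule.subset_span (Or.inr ⟨s, hs, rfl⟩)
          · rw [((hψ _).2 0).1 (mem_weakPolyRel.2 ⟨Submodule.zero_mem _, X ^ s, ?_, sub_zero _⟩)]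
            · exact Submodule.zero_mem _
            · intro k hk
              obtain rfl : k = s := by
                by_contra hne
                exact hk (by rw [coeff_X_pow, if_neg hne])
              exact hs
    · obtain ⟨_, ⟨P, rfl⟩, T, hT, hPT⟩ := Submodule.mem_sup.1
        (adjointOp_mem_fractionSpace (hQ.shiftCoprime i) p r (Submodule.mem_sup_right hf))
      have hPT : L f = toRat P + T := hPT.symm
      obtain ⟨P', hP', hρT⟩ := hρL i f hf P T hT hPT
      classical
      have hδf : δ (L f) = (P, Finsupp.single i T) := by
        refine ((hδ _).2 _).1 (mem_decomposeRel.2 ⟨fun k => ?_, ?_⟩)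
        · change Finsupp.single i T k ∈ _
          rw [Finsupp.single_apply]
          split_ifs with h
          · exact h ▸ hT
          · exact Submodule.zero_mem _
        · rw [Finsupp.sum_single_index rfl, hPT]
      refine hpoly f P' ?_ (hχ_zero _ ?_)
      · rw [hΨ_apply, hδf, Finsupp.lsum_single, hρT]
      · rw [hψ_fix P' hP']
        exact Submodule.span_mono Set.subset_union_left hP'
  · have hd := mem_decomposeRel.1 (((hδ R).2 _).2 rfl)
    have h1 : R - Ψ R ∈ LinearMap.range L := by
      have heq : R - Ψ R = ∑ i ∈ (δ R).2.support, ((δ R).2 i - ρ i ((δ R).2 i)) := by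
        rw [hΨ_apply, Finset.sum_sub_distrib, Finsupp.lsum_apply]
        have hR := hd.2
        simp only [Finsupp.sum] at hR ⊢
        linear_combination hR
      rw [heq]
      exact Submodule.sum_mem _ fun i _ => (hρ i _ (hd.1 i)).2
    have h2 := Submodule.add_mem _ h1 (hχ_range (π (Ψ R)))
    convert h2 using 1
    change R - (toRat (χ (π (Ψ R))) + (Ψ R - toRat (π (Ψ R)))) = _
    ring

end ShiftReduction

end

theorem mainTheorem1 {K : Type*} [Field K] [CharZero K]
    (p : ℕ → Polynomial K) (r : ℕ) (hp0 : p 0 ≠ 0) (hpr : p r ≠ 0)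
    {ι : Type*} (Q : ι → Polynomial K) (S : Finset ι)
    (hQ : ShiftReduction.IsShiftless Q)
    (hS : ShiftReduction.HasShiftFactorization S Q (p 0 * p r))
    (href0 : ∀ i ∈ S, ShiftReduction.IsRefined (Q i) (p 0))
    (hrefr : ∀ i ∈ S, ShiftReduction.IsRefined (Q i) (p r))
    (hexh : ShiftReduction.Exhausts Q) :
    ∃ φ : RatFunc K →ₗ[K] RatFunc K,
      (∀ R : RatFunc K, ShiftReduction.reduce p r Q S R = Part.some (φ R)) ∧
      ShiftReduction.IsCanonicalForm (ShiftReduction.adjointOp p r) φ := by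
  open ShiftReduction in
  -- `p_0` and `p_r` are prime to all shifts of `Q_i` if `i ∉ S`, so no refinement is needed there
  have hcop0 : ∀ i ∉ S, ∀ j, IsCoprime (sh j (Q i)) (p 0) := fun i hi j =>
    (hQ.isCoprime_of_notMem hS hi j).of_mul_right_left
  have hcopr : ∀ i ∉ S, ∀ j, IsCoprime (sh j (Q i)) (p r) := fun i hi j =>
    (hQ.isCoprime_of_notMem hS hi j).of_mul_right_right
  refine exists_reduce hp0 hpr hQ hexh (fun i => ?_) (fun i => ?_) fun i hi j => ?_
  · by_cases hi : i ∈ S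
    · exact (hQ.shiftCoprime i).cofactorCoprime_of_isRefined (href0 i hi)
    · exact cofactorCoprime_of_isCoprime (hQ.shiftCoprime i) (hcop0 i hi)
  · by_cases hi : i ∈ S
    · exact (hQ.shiftCoprime i).cofactorCoprime_of_isRefined (hrefr i hi)
    · exact cofactorCoprime_of_isCoprime (hQ.shiftCoprime i) (hcopr i hi)
  · rw [cancelOrder]
    split_ifs
    · exact ord_eq_zero_of_isCoprime (hQ.shiftCoprime i) (hcop0 i hi j)
    · exact ord_eq_zero_of_isCoprime (hQ.shiftCoprime i) (hcopr i hi _)
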